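/- Let $\mathbb X$ be a finite set, fix a scaling factor $\kappa>0$ and write $\int dX\,F(X)=\kappa\sum_{X\in\mathbb X}F(X)$. Consider the complex Grassmann algebra generated by $\psi(X),\bar\psi(X)$, $X\in\mathbb X$, with Grassmann derivatives normalized by $\frac{\delta}{\delta\psi(X)}\psi(Y)=\kappa^{-1}\delta_{XY}$ (and likewise for $\bar\psi$). Every element has a unique representation $$V=\sum_{\bar m,m\ge0}\int d^{\bar m}\underline X\,d^m\underline X'\;v_{\bar m,m}(\underline X,\underline X')\,\bar\psi(X_1)\cdots\bar\psi(X_{\bar m})\,\psi(X'_1)\cdots\psi(X'_m)$$ with $v_{\bar m,m}$ antisymmetric in $\underline X$ and in $\underline X'$ (and $v_{\bar m,m}=0$ if $\bar m>|\mathbb X|$ or $m>|\mathbb X|$). Write $V(0)=v_{0,0}$; $V$ is even if $v_{\bar m,m}=0$ whenever $\bar m+m$ is odd. For $h>0$ let $$\|V\|_h=\sum_{\bar m+m\ge1}|v_{\bar m,m}|\,h^{\bar m+m},\qquad |v_{\bar m,m}|=\max_i\sup_{X_i}\int\prod_{j\ne i}dX_j\,|v_{\bar m,m}(X_1,\dots,X_{\bar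 m+m})|.$$ Let $C:\mathbb X\times\mathbb X\to\mathbb C$ and let $\mu_C$ be the Gaussian Grassmann integral with $\int d\mu_C(\psi)\,e^{(\bar\eta,\psi)+(\bar\psi,\eta)}=e^{(\bar\eta,C\eta)}$, where $(\bar\eta,\psi)=\int dX\,\bar\eta(X)\psi(X)$, $(\bar\psi,\eta)=\int dX\,\bar\psi(X)\eta(X)$ and $(\bar\eta,C\eta)=\int dX\,dY\,\bar\eta(X)C(X,Y)\eta(Y)$. Let $(\mu_C*V)(\phi)=\int d\mu_C(\psi)\,V(\psi+\phi)$. Assume that there are constants $\gamma_C>0$ and $\omega_C>0$ such that - $C(X,Y)=\langle f_X,g_Y\rangle$ for vectors $f_X,g_Y$ of a complex Hilbert space with $\|f_X\|\le\gamma_C$, $\|g_X\|\le\gamma_C$ for all $X\in\mathbb X$; - $|C|=\max\{\sup_X\int|C(X,Y)|\,dY,\ \sup_X\int|C(Y,X)|\,dY\}\le\omega_C\gamma_C^2$. For $V$ even with $V(0)=0$ let $Z(V)=(\mu_C*e^V)(0)$ and, if $Z(V)\ne0$, let $W(V)=\log\big(\tfrac1{Z(V)}\,\mu_C*e^V\big)$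 be the effective action, and let $W_p(V)=\frac{d^p}{d\lambda^p}W(\lambda V)\big|_{\lambda=0}$. Let $h>0$ and let either $h'=h+3\gamma_C$ and $\omega'=\omega_C$, or $h'=h+2\gamma_C$ and $\omega'=2\omega_C$. Then the map $V\mapsto W(V)$ is well defined (that is, $Z(V)\neq 0$) and analytic on the set of all even $V$ with $V(0)=0$ and $\omega'\|V\|_{h'}<1$; and for every such $V$, $W(V)$ is analytic in the fields (it is the Grassmann polynomial given by its coefficient functions), $$\|W(V)\|_h\le-\frac1{\omega'}\log\big(1-\omega'\|V\|_{h'}\big),$$ the expansion $W(V)=\sum_{p\ge1}\frac1{p!}W_p(V)$ converges, and for all $P\ge1$ $$\Big\|W(V)-\sum_{p=1}^P\frac1{p!}W_p(V)\Big\|_h\le(\omega')^P\,\frac{\|V\|_{h'}^{P+1}}{1-\omega'\|V\|_{h'}}.$$ -/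

import Mathlib

open scoped Nat

noncomputable section

namespace GrassmannRG

/-- The complex Grassmann algebra with one generator for each element of `σ`. -/
abbrev Grassmann (σ : Type*) : Type _ := ExteriorAlgebra ℂ (σ → ℂ)

section General

variable {σ : Type*}

/-- The generator (Grassmann variable) labelled by `s`. -/
def gen [DecidableEq σ] (s : σ) : Grassmann σ := ExteriorAlgebra.ι ℂ (Pi.single s (1 : ℂ))

/-- The field-independent term `V(0)` of a Grassmann polynomial `V`. -/
def body : Grassmann σ →ₐ[ℂ] ℂ := ExteriorAlgebra.algebraMapInv

/-- The (left) Grassmann derivative with respect to the generator `s`, normalized so that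
the derivative of the generator `t` is the Kronecker delta divided by the scaling factor `κ`
of the "integral" `∫ dX = κ ∑_X`. -/
def gderiv (κ : ℝ) (s : σ) : Module.End ℂ (Grassmann σ) :=
  ((κ : ℂ)⁻¹) • CliffordAlgebra.contractLeft (Q := (0 : QuadraticForm ℂ (σ → ℂ)))
    (LinearMap.proj s : (σ → ℂ) →ₗ[ℂ] ℂ)

/-- The exponential of a Grassmann polynomial without field-independent term. The series stops
by nilpotency: products of more than `card σ` such elements vanish. -/
def gexp [Fintype σ] (V : Grassmann σ) : Grassmann σ :=
  ∑ k ∈ Finset.range (Fintype.card σ + 1), ((k ! : ℂ)⁻¹) • V ^ k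

/-- The logarithm of a Grassmann polynomial whose field-independent term is `1`. The series
`log (1 + N) = ∑_{k ≥ 1} (-1)^(k+1) N^k / k` stops by nilpotency. -/
def glog [Fintype σ] (U : Grassmann σ) : Grassmann σ :=
  ∑ k ∈ Finset.Icc 1 (Fintype.card σ), ((-1 : ℂ) ^ (k + 1) / (k : ℂ)) • (U - 1) ^ k

theorem module_finite_grassmann [Finite σ] : Module.Finite ℂ (Grassmann σ) := by
  classical
  obtain ⟨n, ⟨e⟩⟩ := Finite.exists_equiv_fin σ
  let _ : LinearOrder σ := LinearOrder.lift' e e.injective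
  exact Module.Finite.of_basis (Pi.basisFun ℂ σ).ExteriorAlgebra

instance instFiniteGrassmann [Finite σ] : Module.Finite ℂ (Grassmann σ) :=
  module_finite_grassmann

/-- The Grassmann algebra of finitely many generators is a finite-dimensional complex vector
space. It is given the norm of some basis; as all norms are equivalent, analyticity, derivatives
and convergence do not depend on this choice. -/
instance instNormedAddCommGroupGrassmann [Finite σ] : NormedAddCommGroup (Grassmann σ) :=
  NormedAddCommGroup.induced (Grassmann σ)
    (Fin (Module.finrank ℂ (Grassmann σ)) → ℂ)
    (Module.finBasis ℂ (Grassmann σ)).equivFun.toLinearMap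
    (Module.finBasis ℂ (Grassmann σ)).equivFun.injective

instance instNormedSpaceGrassmann [Finite σ] : NormedSpace ℂ (Grassmann σ) :=
  NormedSpace.induced ℂ (Grassmann σ)
    (Fin (Module.finrank ℂ (Grassmann σ)) → ℂ)
    (Module.finBasis ℂ (Grassmann σ)).equivFun.toLinearMap

end General

variable {𝕏 : Type*} [Fintype 𝕏]

/-- The algebra of the fields: `Sum.inl X` labels `ψ̄(X)` and `Sum.inr X` labels `ψ(X)`. -/
abbrev Fields (𝕏 : Type*) : Type _ := Grassmann (𝕏 ⊕ 𝕏)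

/-- The algebra of two independent families of fields; `Sum.inl` labels the first family `φ`,
`Sum.inr` the second one. -/
abbrev TwoFields (𝕏 : Type*) : Type _ := Grassmann ((𝕏 ⊕ 𝕏) ⊕ (𝕏 ⊕ 𝕏))

/-! ### Coefficient functions and norms -/

/-- The coefficient function `v_{m̄,m}(X, Y)` of a Grassmann polynomial
`V = ∑_{m̄,m} ∫ dX dY v_{m̄,m}(X, Y) ψ̄(X₁)⋯ψ̄(X_m̄) ψ(Y₁)⋯ψ(Y_m)`, antisymmetric in the `X` and in
the `Y`: the field-independent term of
`(m̄! m!)⁻¹ δ/δψ(Y_m) ⋯ δ/δψ(Y₁) δ/δψ̄(X_m̄) ⋯ δ/δψ̄(X₁) V`. -/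
def coeff (κ : ℝ) {mb m : ℕ} (X : Fin mb → 𝕏) (Y : Fin m → 𝕏) : Fields 𝕏 →ₗ[ℂ] ℂ :=
  ((mb ! : ℂ)⁻¹ * (m ! : ℂ)⁻¹) •
    (body.toLinearMap ∘ₗ
      ((List.ofFn fun j => gderiv κ (Sum.inr (Y j) : 𝕏 ⊕ 𝕏)).reverse.prod *
        (List.ofFn fun i => gderiv κ (Sum.inl (X i) : 𝕏 ⊕ 𝕏)).reverse.prod))

/-- The Grassmann polynomial with the given coefficient functions,
`∑_{m̄,m} ∫ dX dY v_{m̄,m}(X, Y) ψ̄(X₁)⋯ψ̄(X_m̄) ψ(Y₁)⋯ψ(Y_m)`. -/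
def fieldPolynomial [DecidableEq 𝕏] (κ : ℝ)
    (v : (mb m : ℕ) → (Fin mb → 𝕏) → (Fin m → 𝕏) → ℂ) : Fields 𝕏 :=
  ∑ mb ∈ Finset.range (Fintype.card 𝕏 + 1), ∑ m ∈ Finset.range (Fintype.card 𝕏 + 1),
    ((κ : ℂ) ^ (mb + m)) • ∑ X : Fin mb → 𝕏, ∑ Y : Fin m → 𝕏,
      v mb m X Y • ((List.ofFn fun i => gen (Sum.inl (X i) : 𝕏 ⊕ 𝕏)).prod *
        (List.ofFn fun j => gen (Sum.inr (Y j) : 𝕏 ⊕ 𝕏)).prod)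

/-- The norm `|v| = max_i sup_{X_i} ∫ ∏_{j ≠ i} dX_j |v(X₁, …, X_{m̄+m})|` of a function of
`m̄ + m ≥ 1` variables. -/
def kernelNorm [DecidableEq 𝕏] (κ : ℝ) {mb m : ℕ} (v : (Fin mb → 𝕏) → (Fin m → 𝕏) → ℂ) : ℝ :=
  ⨆ i : Fin mb ⊕ Fin m, ⨆ x : 𝕏,
    κ ^ (mb + m - 1) * ∑ Z : Fin mb ⊕ Fin m → 𝕏 with Z i = x, ‖v (Z ∘ Sum.inl) (Z ∘ Sum.inr)‖

/-- The seminorm `‖V‖_h = ∑_{m̄+m ≥ 1} |v_{m̄,m}| h^{m̄+m}`. Coefficients with `m̄` or `m` larger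
than `card 𝕏` vanish. -/
def hNorm [DecidableEq 𝕏] (κ h : ℝ) (V : Fields 𝕏) : ℝ :=
  ∑ mb ∈ Finset.range (Fintype.card 𝕏 + 1), ∑ m ∈ Finset.range (Fintype.card 𝕏 + 1),
    if 1 ≤ mb + m then
      kernelNorm κ (fun (X : Fin mb → 𝕏) (Y : Fin m → 𝕏) => coeff κ X Y V) * h ^ (mb + m)
    else 0

/-- The norm `|C|` of the propagator. -/
def covNorm (κ : ℝ) (C : 𝕏 → 𝕏 → ℂ) : ℝ :=
  max (⨆ X, κ * ∑ Y, ‖C X Y‖) (⨆ X, κ * ∑ Y, ‖C Y X‖)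

/-- The space of even polynomials `V` with `V(0) = 0`. -/
def evenPart (𝕏 : Type*) [Fintype 𝕏] (κ : ℝ) : Submodule ℂ (Fields 𝕏) where
  carrier := {V | body V = 0 ∧ ∀ (mb m : ℕ), ¬ Even (mb + m) →
    ∀ (X : Fin mb → 𝕏) (Y : Fin m → 𝕏), coeff κ X Y V = 0}
  add_mem' := by
    rintro a b ⟨ha, ha'⟩ ⟨hb, hb'⟩
    refine ⟨by simp [ha, hb], fun mb m hm X Y => ?_⟩
    rw [map_add, ha' mb m hm, hb' mb m hm, add_zero]
  zero_mem' := ⟨map_zero _, fun _ _ _ _ _ => map_zero _⟩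
  smul_mem' := by
    rintro c a ⟨ha, ha'⟩
    refine ⟨by simp [ha], fun mb m hm X Y => ?_⟩
    rw [map_smul, ha' mb m hm, smul_zero]

/-! ### Gaussian integration and the effective action -/

/-- The projection of the generating space of the two families onto that of the first one. -/
def restrictFst : (((𝕏 ⊕ 𝕏) ⊕ (𝕏 ⊕ 𝕏)) → ℂ) →ₗ[ℂ] (((𝕏 ⊕ 𝕏) ⊕ (𝕏 ⊕ 𝕏)) → ℂ) where
  toFun v := Sum.elim (fun s => v (Sum.inl s)) (fun _ => 0)
  map_add' a b := by ext (s | s) <;> simp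
  map_smul' a b := by ext (s | s) <;> simp

/-- In the algebra of the fields `φ̄, φ` and the sources `η̄, η`: the derivative attached to
`∑_X (a(X) ψ̄(X) + b(X) ψ(X))` by `ψ̄(X) ↦ -δ/δη(X)`, `ψ(X) ↦ δ/δη̄(X)`. -/
def sourceDual (κ : ℝ) : (((𝕏 ⊕ 𝕏) ⊕ (𝕏 ⊕ 𝕏)) → ℂ) →ₗ[ℂ]
    Module.Dual ℂ (((𝕏 ⊕ 𝕏) ⊕ (𝕏 ⊕ 𝕏)) → ℂ) :=
  ((κ : ℂ)⁻¹) • ∑ X : 𝕏,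
    ((LinearMap.proj (Sum.inr (Sum.inr X))).smulRight
        (LinearMap.proj (Sum.inr (Sum.inl X)) : Module.Dual ℂ (((𝕏 ⊕ 𝕏) ⊕ (𝕏 ⊕ 𝕏)) → ℂ))
      - (LinearMap.proj (Sum.inr (Sum.inl X))).smulRight
        (LinearMap.proj (Sum.inr (Sum.inr X)) : Module.Dual ℂ (((𝕏 ⊕ 𝕏) ⊕ (𝕏 ⊕ 𝕏)) → ℂ)))

/-- The action of a vector of the generating space of the algebra of `φ̄, φ, ψ̄, ψ` on the algebra
of `φ̄, φ, η̄, η`: `φ` acts by multiplication, `ψ̄(X)` as `-δ/δη(X)`, and `ψ(X)` as `δ/δη̄(X)`. -/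
def sourceAct (κ : ℝ) : (((𝕏 ⊕ 𝕏) ⊕ (𝕏 ⊕ 𝕏)) → ℂ) →ₗ[ℂ] Module.End ℂ (TwoFields 𝕏) :=
  LinearMap.mul ℂ (TwoFields 𝕏) ∘ₗ ExteriorAlgebra.ι ℂ ∘ₗ restrictFst
    + CliffordAlgebra.contractLeft (Q := (0 : QuadraticForm ℂ (((𝕏 ⊕ 𝕏) ⊕ (𝕏 ⊕ 𝕏)) → ℂ)))
        ∘ₗ sourceDual κ

theorem sourceAct_sq (κ : ℝ) (v : ((𝕏 ⊕ 𝕏) ⊕ (𝕏 ⊕ 𝕏)) → ℂ) :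
    sourceAct (𝕏 := 𝕏) κ v * sourceAct κ v = 0 := by
  have h0 : sourceDual κ v (restrictFst v) = 0 := by
    simp [sourceDual, restrictFst]
  refine LinearMap.ext fun x => ?_
  have h1 : (ExteriorAlgebra.ι ℂ (restrictFst v)) * ((ExteriorAlgebra.ι ℂ (restrictFst v)) * x)
      = 0 := by
    rw [← mul_assoc, ExteriorAlgebra.ι_sq_zero, zero_mul]
  have h2 := CliffordAlgebra.contractLeft_ι_mul
    (Q := (0 : QuadraticForm ℂ (((𝕏 ⊕ 𝕏) ⊕ (𝕏 ⊕ 𝕏)) → ℂ))) (sourceDual κ v) (restrictFst v) x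
  have h3 := CliffordAlgebra.contractLeft_contractLeft
    (Q := (0 : QuadraticForm ℂ (((𝕏 ⊕ 𝕏) ⊕ (𝕏 ⊕ 𝕏)) → ℂ))) (sourceDual κ v) x
  rw [h0, zero_smul, zero_sub] at h2
  simp only [sourceAct, Module.End.mul_apply, LinearMap.add_apply, LinearMap.comp_apply,
    LinearMap.mul_apply', mul_add, LinearMap.zero_apply]
  rw [h1, h3]
  erw [h2]
  simp

/-- The substitution `F(φ, ψ) ↦ F(φ, δ/δη)`, that is `ψ̄ ↦ -δ/δη`, `ψ ↦ δ/δη̄`. -/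
def sourceSubst (κ : ℝ) : TwoFields 𝕏 →ₐ[ℂ] Module.End ℂ (TwoFields 𝕏) :=
  ExteriorAlgebra.lift ℂ ⟨sourceAct κ, sourceAct_sq κ⟩

/-- The bilinear form `(η̄, C η) = ∫ dX dY η̄(X) C(X, Y) η(Y)` of the sources. -/
def sourceForm [DecidableEq 𝕏] (κ : ℝ) (C : 𝕏 → 𝕏 → ℂ) : TwoFields 𝕏 :=
  ∑ X, ∑ Y, ((κ : ℂ) ^ 2 * C X Y) •
    (gen (Sum.inr (Sum.inl X)) * gen (Sum.inr (Sum.inr Y)))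

/-- Set the second family of generators equal to zero. -/
def dropSnd : TwoFields 𝕏 →ₐ[ℂ] Fields 𝕏 :=
  ExteriorAlgebra.map (LinearMap.funLeft ℂ ℂ Sum.inl)

/-- The Gaussian integral `∫ dμ_C(ψ) F(φ, ψ)` with covariance `C` over the second family of
fields. It is the linear map, compatible with multiplication by `φ`, with generating function
`∫ dμ_C(ψ) exp((η̄, ψ) + (ψ̄, η)) = exp((η̄, C η))`, i.e.
`∫ dμ_C(ψ) F(φ, ψ) = [F(φ; -δ/δη, δ/δη̄) exp((η̄, C η))]` at `η̄ = η = 0`. -/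
def gaussianIntegral [DecidableEq 𝕏] (κ : ℝ) (C : 𝕏 → 𝕏 → ℂ) : TwoFields 𝕏 →ₗ[ℂ] Fields 𝕏 :=
  dropSnd.toLinearMap ∘ₗ
    (LinearMap.applyₗ (gexp (sourceForm κ C))) ∘ₗ (sourceSubst κ).toLinearMap

/-- The substitution `V(ψ) ↦ V(ψ + φ)`. -/
def shift : Fields 𝕏 →ₐ[ℂ] TwoFields 𝕏 :=
  ExteriorAlgebra.map (LinearMap.funLeft ℂ ℂ (Sum.elim id id))

/-- The convolution `(μ_C * V)(φ) = ∫ dμ_C(ψ) V(ψ + φ)`. -/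
def convolution [DecidableEq 𝕏] (κ : ℝ) (C : 𝕏 → 𝕏 → ℂ) (V : Fields 𝕏) : Fields 𝕏 :=
  gaussianIntegral κ C (shift V)

/-- The normalization `Z`, the value of `μ_C * e^V` at vanishing fields. -/
def normalization [DecidableEq 𝕏] (κ : ℝ) (C : 𝕏 → 𝕏 → ℂ) (V : Fields 𝕏) : ℂ :=
  body (convolution κ C (gexp V))

/-- The effective action `W(V) = log (Z⁻¹ μ_C * e^V)`. -/
def effectiveAction [DecidableEq 𝕏] (κ : ℝ) (C : 𝕏 → 𝕏 → ℂ) (V : Fields 𝕏) : Fields 𝕏 :=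
  glog ((normalization κ C V)⁻¹ • convolution κ C (gexp V))

/-- The order-`p` term `W_p(V)` in the expansion `W(λ V) = ∑_{p ≥ 1} λ^p W_p(V) / p!`. -/
def effectiveActionTerm [DecidableEq 𝕏] (κ : ℝ) (C : 𝕏 → 𝕏 → ℂ) (p : ℕ) (V : Fields 𝕏) :
    Fields 𝕏 :=
  iteratedDeriv p (fun z : ℂ => effectiveAction κ C (z • V)) 0

end GrassmannRG

end

/-! Write `U(λ) = μ_C * e^{λV}`, a polynomial in `λ` by nilpotency. It solves `U' = B U`, where
`B(λ) = (μ_C * V e^{λV}) / (μ_C * e^{λV})` has the coefficients `connectedTerm C V q`. The constant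
term of `U` solves a scalar linear equation, hence is an exponential and never vanishes. Apart from
its constant term, `B` is the derivative of the effective action. So everything follows from
`‖connectedTerm C V q‖_h ≤ (ω' ‖V‖_{h'}) ^ q ‖V‖_{h'}`: integration over `λ` divides by `q + 1` and
gives the logarithmic series, and its tail is dominated by a geometric series.

This bound is obtained without counting trees, by interpolation between replicas of the fields.
Consider the normalized integral of `F e^{λV}`, with `F` in the replicas up to `k` and the
exponential in replica `k + 1`, and multiply the covariance between the two groups by `s`. At `s =
0` the integral factorizes, and the normalization cancels the exponential (`expectation_eq_zero`).
The `s`-derivative contracts one letter of `F` with a new factor `V` and lowers the order in `λ` by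
one (`hasDerivAt_expectation`). Induction on the order then proves `norm_sum_expectation_le`, whose
bound contains `∏ (y + c S(p, k))` over the letters of `F`. In the variable `s` the derivative of
this product is the sum over the letters that may be contracted, so it serves as a majorant in a
differential inequality.

No factorials appear because the interpolated covariances `S(a, b) C` still have a Gram
representation with the same `γ`: `IsInterp.cut` builds unit vectors for `S`, and Gram's inequality
bounds Gaussian expectations of `n` fields by `γ ^ n`. Each field is thus either external, with
weight `h`, or integrated, with weight `γ`, whence `y = h + γ`. The two choices `c = γ` and `c = γ /
2` give the two versions of `h'` and `ω'`.

Norms are handled by duality: `exists_isNormBounded` realizes `‖W‖_h` as the value at `W` of a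
linear functional dominated by the norm on weighted families of monomials, so that the calculus
concerns scalar functions only. -/

noncomputable section

namespace GrassmannRG

/-! ### Contractions, Gaussian convolution and nilpotency in exterior algebras. -/

section Exterior

variable {M N K : Type*} [AddCommGroup M] [Module ℂ M] [AddCommGroup N] [Module ℂ N]
  [AddCommGroup K] [Module ℂ K]

local notation "Λ" => ExteriorAlgebra ℂ
local notation "ι" => ExteriorAlgebra.ι ℂ

/-- Left contraction of the exterior algebra with a linear form. -/
def contr : Module.Dual ℂ M →ₗ[ℂ] Module.End ℂ (Λ M) :=
  CliffordAlgebra.contractLeft (Q := (0 : QuadraticForm ℂ M))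

/-- The grading automorphism of the exterior algebra. -/
def parity : Λ M →ₐ[ℂ] Λ M := CliffordAlgebra.involute (Q := (0 : QuadraticForm ℂ M))

theorem left_induction {P : Λ M → Prop} (h0 : ∀ r : ℂ, P (algebraMap ℂ _ r))
    (hadd : ∀ x y, P x → P y → P (x + y)) (hmul : ∀ x m, P x → P (ι m * x)) : ∀ x, P x :=
  CliffordAlgebra.left_induction (Q := (0 : QuadraticForm ℂ M)) h0 hadd hmul

@[simp] theorem contr_algebraMap (d : Module.Dual ℂ M) (r : ℂ) :
    contr d (algebraMap ℂ (Λ M) r) = 0 := CliffordAlgebra.contractLeft_algebraMap _ d r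

@[simp] theorem contr_one (d : Module.Dual ℂ M) : contr d (1 : Λ M) = 0 :=
  CliffordAlgebra.contractLeft_one _ d

theorem contr_ι_mul (d : Module.Dual ℂ M) (m : M) (x : Λ M) :
    contr d (ι m * x) = d m • x - ι m * contr d x := CliffordAlgebra.contractLeft_ι_mul d m x

@[simp] theorem contr_ι (d : Module.Dual ℂ M) (m : M) :
    contr d (ι m) = algebraMap ℂ (Λ M) (d m) := CliffordAlgebra.contractLeft_ι _ d m

@[simp] theorem parity_ι (m : M) : parity (ι m) = -ι m := CliffordAlgebra.involute_ι m

theorem ι_mul_comm (m : M) (x : Λ M) : ι m * x = parity x * ι m := by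
  induction x using left_induction with
  | h0 r => rw [AlgHom.commutes, Algebra.commutes]
  | hadd x y hx hy => rw [mul_add, hx, hy, map_add, add_mul]
  | hmul x m' hx =>
    have h := ExteriorAlgebra.ι_add_mul_swap (R := ℂ) m m'
    rw [← mul_assoc, eq_neg_of_add_eq_zero_left h, map_mul, parity_ι, mul_assoc (-ι m'), ← hx]
    simp [mul_assoc]

/-- Even elements are central, which makes the usual calculus of exponentials and logarithms
available for them. -/
theorem commute_of_parity {x : Λ M} (hx : parity x = x) (y : Λ M) : Commute x y := by
  induction y using left_induction with
  | h0 r => exact (Algebra.commutes r x).symm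
  | hadd y z hy hz => exact hy.add_right hz
  | hmul y m hy =>
    refine Commute.mul_right ?_ hy
    have := ι_mul_comm m x
    rw [hx] at this
    exact this.symm

theorem contr_mul (d : Module.Dual ℂ M) (x y : Λ M) :
    contr d (x * y) = contr d x * y + parity x * contr d y := by
  induction x using left_induction with
  | h0 r =>
    rw [contr_algebraMap, AlgHom.commutes, ← Algebra.smul_def, map_smul, ← Algebra.smul_def,
      zero_mul, zero_add]
  | hadd x y hx hy => simp only [add_mul, map_add, hx, hy]; abel
  | hmul x m hx =>
    rw [mul_assoc, contr_ι_mul, hx, contr_ι_mul, map_mul, parity_ι, sub_mul, smul_mul_assoc]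
    simp only [mul_add, mul_assoc, neg_mul]
    abel

theorem parity_contr (d : Module.Dual ℂ M) (x : Λ M) : parity (contr d x) = -contr d (parity x) := by
  induction x using left_induction with
  | h0 r => simp
  | hadd x y hx hy => simp only [map_add, hx, hy, neg_add]
  | hmul x m hx =>
    simp only [contr_ι_mul, map_sub, map_smul, map_mul, parity_ι, hx, neg_mul, map_neg]
    simp

theorem contr_map (f : M →ₗ[ℂ] N) (d : Module.Dual ℂ N) (x : Λ M) :
    contr d (ExteriorAlgebra.map f x) = ExteriorAlgebra.map f (contr (d ∘ₗ f) x) := by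
  induction x using left_induction with
  | h0 r => simp
  | hadd x y hx hy => simp only [map_add, hx, hy]
  | hmul x m hx => simp [contr_ι_mul, hx]

/-- The constant term. -/
abbrev ct : Λ M →ₐ[ℂ] ℂ := ExteriorAlgebra.algebraMapInv

@[simp] theorem ct_ι (m : M) : ct (ι m) = 0 := by
  simp [ExteriorAlgebra.algebraMapInv]

@[simp] theorem ct_algebraMap (r : ℂ) : ct (algebraMap ℂ (Λ M) r) = r :=
  ExteriorAlgebra.algebraMap_leftInverse M r

theorem map_zero_eq (x : Λ M) :
    ExteriorAlgebra.map (0 : M →ₗ[ℂ] N) x = algebraMap ℂ (Λ N) (ct x) := by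
  induction x using left_induction with
  | h0 r => simp
  | hadd x y hx hy => simp only [map_add, hx, hy]
  | hmul x m hx => simp

theorem ct_map (f : M →ₗ[ℂ] N) (x : Λ M) : ct (ExteriorAlgebra.map f x) = ct x := by
  induction x using left_induction with
  | h0 r => simp
  | hadd x y hx hy => simp only [map_add, hx, hy]
  | hmul x m hx => simp

/-! ### Wick maps -/

/-- Gaussian convolution on the exterior algebra: the linear map with
`wick A (m x) = m (wick A x) + (A m)⌋(wick A x)` for an alternating form `A`. -/
def wick (A : LinearMap.BilinForm ℂ M) : Module.End ℂ (Λ M) := by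
  classical
  exact if h : A.IsAlt then
    -- An alternating form has zero quadratic form, so the change of form maps the exterior algebra
    -- to itself. `changeForm` subtracts the contraction with its form, hence the sign.
    CliffordAlgebra.changeForm (Q := (0 : QuadraticForm ℂ M)) (Q' := 0) (B := -A)
      (by ext x; simp [h.self_eq_zero x]) else 0

variable {A : LinearMap.BilinForm ℂ M}

@[simp] theorem wick_algebraMap (hA : A.IsAlt) (r : ℂ) :
    wick A (algebraMap ℂ (Λ M) r) = algebraMap ℂ (Λ M) r := by
  rw [wick, dif_pos hA]
  exact CliffordAlgebra.changeForm_algebraMap _ r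

@[simp] theorem wick_one (hA : A.IsAlt) : wick A (1 : Λ M) = 1 := by
  simpa using wick_algebraMap hA 1

theorem wick_ι_mul (hA : A.IsAlt) (m : M) (x : Λ M) :
    wick A (ι m * x) = ι m * wick A x + contr (A m) (wick A x) := by
  rw [wick, dif_pos hA]
  refine (CliffordAlgebra.changeForm_ι_mul _ m x).trans ?_
  rw [LinearMap.neg_apply, map_neg, LinearMap.neg_apply, sub_neg_eq_add]
  rfl

theorem wick_contr (hA : A.IsAlt) (d : Module.Dual ℂ M) (x : Λ M) :
    wick A (contr d x) = contr d (wick A x) := by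
  rw [wick, dif_pos hA]
  exact CliffordAlgebra.changeForm_contractLeft _ d x

theorem parity_wick (hA : A.IsAlt) (x : Λ M) : parity (wick A x) = wick A (parity x) := by
  induction x using left_induction with
  | h0 r => simp [hA]
  | hadd x y hx hy => simp only [map_add, hx, hy]
  | hmul x m hx =>
    simp only [wick_ι_mul hA, map_add, map_mul, parity_ι, parity_contr, hx, neg_mul, map_neg]
    abel

theorem isAlt_compl₁₂ {B : LinearMap.BilinForm ℂ N} (hB : B.IsAlt) (f : M →ₗ[ℂ] N) :
    LinearMap.IsAlt (B.compl₁₂ f f : LinearMap.BilinForm ℂ M) := fun x => by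
  simp [hB.self_eq_zero]

theorem wick_map {B : LinearMap.BilinForm ℂ N} (hB : B.IsAlt) (f : M →ₗ[ℂ] N) (x : Λ M) :
    wick B (ExteriorAlgebra.map f x) = ExteriorAlgebra.map f (wick (B.compl₁₂ f f) x) := by
  have hA : LinearMap.IsAlt (B.compl₁₂ f f : LinearMap.BilinForm ℂ M) := isAlt_compl₁₂ hB f
  induction x using left_induction with
  | h0 r => rw [wick_algebraMap hA, AlgHom.commutes, wick_algebraMap hB]
  | hadd x y hx hy => simp only [map_add, hx, hy]
  | hmul x m hx =>
    rw [map_mul, ExteriorAlgebra.map_apply_ι, wick_ι_mul hB, hx, wick_ι_mul hA, map_add, map_mul,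
      ExteriorAlgebra.map_apply_ι, contr_map]
    rfl

/-! ### Words -/

/-- The product of a list of vectors. -/
def word (l : List M) : Λ M := (l.map (ι)).prod

@[simp] theorem word_nil : word ([] : List M) = 1 := rfl

@[simp] theorem word_cons (m : M) (l : List M) : word (m :: l) = ι m * word l := by simp [word]

@[simp] theorem word_append (l l' : List M) : word (l ++ l') = word l * word l' := by simp [word]

@[simp] theorem parity_word (l : List M) : parity (word l) = (-1 : ℂ) ^ l.length • word l := by
  induction l with
  | nil => simp
  | cons m l ih => simp [ih, pow_succ]

theorem map_word (f : M →ₗ[ℂ] N) (l : List M) :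
    ExteriorAlgebra.map f (word l) = word (l.map f) := by
  induction l with
  | nil => simp
  | cons m l ih => simp [ih]

theorem ct_word_of_ne_nil {l : List M} (hl : l ≠ []) : ct (word l) = 0 := by
  cases l with
  | nil => exact absurd rfl hl
  | cons m l => simp

theorem contr_word (d : Module.Dual ℂ M) (l : List M) :
    contr d (word l) = ∑ i : Fin l.length, ((-1 : ℂ) ^ (i : ℕ) * d l[(i : ℕ)]) • word (l.eraseIdx i) := by
  induction l with
  | nil => simp
  | cons m l ih =>
    rw [word_cons, contr_ι_mul, ih]
    simp only [List.length_cons]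
    rw [Fin.sum_univ_succ, Finset.mul_sum, sub_eq_add_neg, ← Finset.sum_neg_distrib]
    congr 1
    · simp
    · refine Finset.sum_congr rfl fun i _ => ?_
      simp [pow_succ]

theorem ι_mul_word_eraseIdx (l : List M) (i : Fin l.length) :
    ι l[(i : ℕ)] * word (l.eraseIdx i) = (-1 : ℂ) ^ (i : ℕ) • word l := by
  induction l with
  | nil => exact i.elim0
  | cons m l ih =>
    refine Fin.cases ?_ (fun j => ?_) i
    · simp
    · have h := ExteriorAlgebra.ι_add_mul_swap (R := ℂ) l[(j : ℕ)] m
      simp only [Fin.val_succ, List.getElem_cons_succ, List.eraseIdx_cons_succ,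
        word_cons]
      rw [← mul_assoc, eq_neg_of_add_eq_zero_left h]
      rw [neg_mul, mul_assoc, ih j]
      simp [pow_succ]

theorem contr_word_of_forall (d : Module.Dual ℂ M) (l : List M) (h : ∀ m ∈ l, d m = 0) :
    contr d (word l) = 0 := by
  rw [contr_word]
  exact Finset.sum_eq_zero fun i _ => by rw [h _ (List.getElem_mem _)]; simp

/-- Gaussian integrals of uncoupled factors factorize: the letters of the word can be contracted
among themselves only. -/
theorem wick_word_mul_of_contr_eq_zero (hA : A.IsAlt) (l : List M) (H : Λ M)
    (h : ∀ m ∈ l, contr (A m) (wick A H) = 0) :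
    wick A (word l * H) = wick A (word l) * wick A H := by
  induction l with
  | nil => simp [hA]
  | cons m l ih =>
    rw [word_cons, mul_assoc, wick_ι_mul hA, ih fun m' hm' => h m' (List.mem_cons_of_mem _ hm'),
      wick_ι_mul hA, contr_mul, h m List.mem_cons_self]
    simp [add_mul, mul_assoc]

theorem wick_word_of_forall (hA : A.IsAlt) (l : List M) (h : ∀ m ∈ l, ∀ m' ∈ l, A m m' = 0) :
    wick A (word l) = word l := by
  induction l with
  | nil => simp [hA]
  | cons m l ih =>
    rw [word_cons, wick_ι_mul hA, ih fun a ha b hb =>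
      h a (List.mem_cons_of_mem _ ha) b (List.mem_cons_of_mem _ hb), contr_word_of_forall, add_zero]
    exact fun a ha => h m List.mem_cons_self a (List.mem_cons_of_mem _ ha)

/-- The derivative of a Wick map with respect to a parameter multiplying a form that couples the
letters of a word to the following factor. -/
theorem hasDerivAt_wick_word_mul {A B : LinearMap.BilinForm ℂ M} (hA : A.IsAlt) (hB : B.IsAlt)
    (H : Λ M) (hH : ∀ s : ℝ, wick (A + (s : ℂ) • B) H = wick A H) (s : ℝ) (l : List M)
    (hl : ∀ m ∈ l, ∀ m' ∈ l, B m m' = 0) (T : Λ M →ₗ[ℂ] ℂ) :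
    HasDerivAt (fun s : ℝ => T (wick (A + (s : ℂ) • B) (word l * H)))
      (∑ i : Fin l.length, (-1 : ℂ) ^ (l.length - 1 - i) *
        T (wick (A + (s : ℂ) • B) (word (l.eraseIdx i) * contr (B l[(i : ℕ)]) H))) s := by
  have hAB : ∀ s : ℝ, (A + (s : ℂ) • B).IsAlt := fun s x => by
    simp [hA.self_eq_zero, hB.self_eq_zero]
  induction l generalizing T with
  | nil =>
    simp only [word_nil, one_mul, hH]
    simpa using hasDerivAt_const s (T (wick A H))
  | cons m l ih =>
    have hl' : ∀ m ∈ l, ∀ m' ∈ l, B m m' = 0 := fun a ha b hb =>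
      hl a (List.mem_cons_of_mem _ ha) b (List.mem_cons_of_mem _ hb)
    -- The recursion for the first letter replaces `T` by its compositions with the multiplication
    -- by `m` and with the contractions by `A m` and `B m`. The last one carries the explicit factor
    -- `s`, whose derivative is the term of index `0`.
    have h1 := ih hl' (T ∘ₗ LinearMap.mulLeft ℂ (ι m))
    have h2 := ih hl' (T ∘ₗ contr (A m))
    have h3 := ih hl' (T ∘ₗ contr (B m))
    have hs : HasDerivAt (fun s : ℝ => (s : ℂ)) 1 s := Complex.ofRealCLM.hasDerivAt
    have h4 := (h1.add h2).add (hs.mul h3)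
    refine (h4.congr_deriv ?_).congr_of_eventuallyEq (Filter.Eventually.of_forall fun t => ?_)
    · simp only [List.length_cons]
      rw [Fin.sum_univ_succ]
      simp only [Fin.val_zero, Fin.val_succ, List.getElem_cons_zero,
        List.eraseIdx_cons_zero, List.getElem_cons_succ, List.eraseIdx_cons_succ, word_cons,
        mul_assoc, wick_ι_mul (hAB _), map_add, LinearMap.add_apply, LinearMap.smul_apply,
        map_smul, smul_eq_mul, LinearMap.comp_apply, LinearMap.mulLeft_apply]
      -- The contraction with `B m` kills the remaining letters and reaches `H` after passing all of
      -- them; this is the sign of the term of index `0`.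
      have h5 : contr (B m) (word l * H) = (-1 : ℂ) ^ l.length • (word l * contr (B m) H) := by
        rw [contr_mul, contr_word_of_forall, parity_word, zero_mul, zero_add, smul_mul_assoc]
        exact fun a ha => hl m List.mem_cons_self a (List.mem_cons_of_mem _ ha)
      rw [← wick_contr (hAB s) (B m), h5]
      simp only [map_smul, smul_eq_mul, one_mul]
      rw [Nat.add_sub_cancel, Nat.sub_zero]
      have h6 : ∀ i : Fin l.length, l.length - (↑i + 1) = l.length - 1 - ↑i := fun i => by omega
      simp only [h6, mul_add, Finset.sum_add_distrib]
      rw [Finset.mul_sum]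
      have h7 : ∀ x y z : ℂ, x * (y * z) = y * (x * z) := fun x y z => by ring
      simp only [h7 (s : ℂ)]
      ring
    · simp only [word_cons, mul_assoc, wick_ι_mul (hAB _), map_add, LinearMap.add_apply,
        LinearMap.smul_apply, map_smul, smul_eq_mul, LinearMap.comp_apply, LinearMap.mulLeft_apply,
        Pi.add_apply, Pi.mul_apply]
      ring

/-! ### Nilpotency -/

theorem word_eq_zero_of_finrank_lt [Module.Finite ℂ M] (l : List M)
    (hl : Module.finrank ℂ M < l.length) : word l = 0 := by
  have h : ExteriorAlgebra.ιMulti ℂ l.length (fun i => l[(i : ℕ)]) = 0 := by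
    apply AlternatingMap.map_linearDependent
    intro h
    have := h.fintype_card_le_finrank
    simp at this
    omega
  rw [ExteriorAlgebra.ιMulti_apply] at h
  rw [← h, word]
  congr 1
  apply List.ext_getElem <;> simp

/-- The span of the multiples of words of length `n`. -/
def wordIdeal (M : Type*) [AddCommGroup M] [Module ℂ M] (n : ℕ) : Submodule ℂ (Λ M) :=
  Submodule.span ℂ {x | ∃ (l : List M) (y : Λ M), l.length = n ∧ x = word l * y}

theorem mem_wordIdeal_one {x : Λ M} (hx : ct x = 0) : x ∈ wordIdeal M 1 := by
  have : ∀ x : Λ M, x - algebraMap ℂ _ (ct x) ∈ wordIdeal M 1 := by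
    intro x
    induction x using left_induction with
    | h0 r => simp
    | hadd x y hx hy =>
      have := Submodule.add_mem _ hx hy
      convert this using 1
      simp only [map_add]; abel
    | hmul x m hx =>
      simp only [map_mul, ct_ι, zero_mul, map_zero, sub_zero]
      exact Submodule.subset_span ⟨[m], x, rfl, by simp⟩
  simpa [hx] using this x

theorem mul_mem_wordIdeal {n : ℕ} {x y : Λ M} (hx : x ∈ wordIdeal M n) (hy : ct y = 0) :
    x * y ∈ wordIdeal M (n + 1) := by
  induction hx using Submodule.span_induction with
  | zero => simp
  | add a b _ _ ha hb => rw [add_mul]; exact Submodule.add_mem _ ha hb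
  | smul c a _ ha => rw [smul_mul_assoc]; exact Submodule.smul_mem _ _ ha
  | mem a ha =>
    obtain ⟨l, z, hl, rfl⟩ := ha
    have hzy : z * y ∈ wordIdeal M 1 := mem_wordIdeal_one (by simp [hy])
    rw [mul_assoc]
    generalize z * y = b at hzy
    induction hzy using Submodule.span_induction with
    | zero => simp
    | add a b _ _ ha hb => rw [mul_add]; exact Submodule.add_mem _ ha hb
    | smul c a _ ha => rw [mul_smul_comm]; exact Submodule.smul_mem _ _ ha
    | mem a ha =>
      obtain ⟨l', w, hl', rfl⟩ := ha
      exact Submodule.subset_span ⟨l ++ l', w, by simp [hl, hl'], by simp [mul_assoc]⟩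

theorem wordIdeal_eq_bot [Module.Finite ℂ M] {n : ℕ} (hn : Module.finrank ℂ M < n) :
    wordIdeal M n = ⊥ := by
  rw [wordIdeal, Submodule.span_eq_bot]
  rintro x ⟨l, y, hl, rfl⟩
  rw [word_eq_zero_of_finrank_lt l (by omega), zero_mul]

theorem pow_mem_wordIdeal {x : Λ M} (hx : ct x = 0) (n : ℕ) : x ^ n ∈ wordIdeal M n := by
  induction n with
  | zero => exact Submodule.subset_span ⟨[], 1, rfl, by simp⟩
  | succ n ih => rw [pow_succ]; exact mul_mem_wordIdeal ih hx

/-- This product is a combination of multiples of words with more letters than the dimension. It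
justifies cutting the exponential and logarithmic series at the number of generators: the boundary
term is always met by one more factor without constant term. -/
theorem pow_finrank_mul_eq_zero [Module.Finite ℂ M] {x y : Λ M} (hx : ct x = 0) (hy : ct y = 0) :
    x ^ Module.finrank ℂ M * y = 0 := by
  have := mul_mem_wordIdeal (pow_mem_wordIdeal hx (Module.finrank ℂ M)) hy
  rwa [wordIdeal_eq_bot (Nat.lt_succ_self _), Submodule.mem_bot] at this

theorem pow_eq_zero_of_finrank_lt [Module.Finite ℂ M] {x : Λ M} (hx : ct x = 0) {n : ℕ}
    (hn : Module.finrank ℂ M < n) : x ^ n = 0 := by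
  have := pow_mem_wordIdeal hx n
  rwa [wordIdeal_eq_bot hn, Submodule.mem_bot] at this

theorem contr_pow_succ {V : Λ M} (hV : parity V = V) (d : Module.Dual ℂ M) (n : ℕ) :
    contr d (V ^ (n + 1)) = ((n + 1 : ℕ) : ℂ) • (contr d V * V ^ n) := by
  induction n with
  | zero => simp
  | succ n ih =>
    rw [pow_succ', contr_mul, ih, hV, mul_smul_comm, ← mul_assoc,
      (commute_of_parity hV (contr d V)).eq, mul_assoc, ← pow_succ']
    push_cast
    module

theorem contr_gexp {σ : Type*} [Fintype σ] {V : Grassmann σ} (hV : parity V = V)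
    (hV0 : ct V = 0) (d : Module.Dual ℂ (σ → ℂ)) (hd : ct (contr d V) = 0) :
    contr d (gexp V) = contr d V * gexp V := by
  rw [gexp, map_sum, Finset.sum_range_succ', Finset.sum_range_succ, mul_add, Finset.mul_sum]
  -- The truncated exponential on the right has one top term without partner on the left, and this
  -- term is killed by the factor `contr d V`.
  have h0 : contr d V * ((((Fintype.card σ)! : ℕ) : ℂ)⁻¹ • V ^ Fintype.card σ) = 0 := by
    have := pow_finrank_mul_eq_zero hV0 hd
    rw [Module.finrank_fintype_fun_eq_card] at this
    rw [mul_smul_comm, ← ((commute_of_parity hV (contr d V)).pow_left _).eq, this, smul_zero]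
  rw [h0]
  simp only [pow_zero, map_smul, contr_one, smul_zero]
  congr 1
  refine Finset.sum_congr rfl fun k _ => ?_
  rw [contr_pow_succ hV, mul_smul_comm, smul_smul, Nat.factorial_succ]
  congr 1
  have : ((k + 1 : ℕ) : ℂ) ≠ 0 := by exact_mod_cast Nat.succ_ne_zero k
  have h2 : ((k ! : ℕ) : ℂ) ≠ 0 := by exact_mod_cast Nat.factorial_ne_zero k
  push_cast at this ⊢
  field_simp

end Exterior

/-! ### Gram's inequality and the boundedness of Gaussian expectations. -/

section Gram

variable {H : Type*} [NormedAddCommGroup H] [InnerProductSpace ℂ H]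

/-- Hadamard's inequality: a change of orthonormal basis has determinant of modulus one, and in the
Gram–Schmidt basis of `F` the matrix is triangular with diagonal entries at most `‖F i‖`. -/
theorem norm_orthonormalBasis_det_le {n : ℕ} [FiniteDimensional ℂ H]
    (h : Module.finrank ℂ H = Fintype.card (Fin n)) (e : OrthonormalBasis (Fin n) ℂ H)
    (F : Fin n → H) : ‖e.toBasis.det F‖ ≤ ∏ i, ‖F i‖ := by
  set b := InnerProductSpace.gramSchmidtOrthonormalBasis h F with hb
  have h1 : e.toBasis.det F = e.toBasis.det b * b.toBasis.det F := by
    rw [Module.Basis.det_apply, Module.Basis.det_apply, Module.Basis.det_apply, ← Matrix.det_mul,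
      ← OrthonormalBasis.coe_toBasis b, Module.Basis.toMatrix_mul_toMatrix]
  rw [h1, norm_mul, e.det_to_matrix_orthonormalBasis b, one_mul,
    InnerProductSpace.gramSchmidtOrthonormalBasis_det, norm_prod]
  refine Finset.prod_le_prod (fun _ _ => norm_nonneg _) fun i _ => ?_
  refine (norm_inner_le_norm _ _).trans ?_
  rw [OrthonormalBasis.norm_eq_one, one_mul]

/-- **Gram's inequality** for determinants of inner products. -/
theorem norm_det_inner_le {n : ℕ} (F G : Fin n → H) :
    ‖(Matrix.of fun i j => (inner ℂ (F i) (G j) : ℂ)).det‖ ≤ (∏ i, ‖F i‖) * ∏ i, ‖G i‖ := by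
  by_cases hG : LinearIndependent ℂ G
  -- Projecting `F` to the span of `G` does not change the inner products. In an orthonormal basis
  -- of the span the matrix is a product of two square matrices, and Hadamard's inequality applies
  -- to each. If `G` is dependent, the determinant vanishes.
  · let W := Submodule.span ℂ (Set.range G)
    have hW : Module.finrank ℂ W = Fintype.card (Fin n) := finrank_span_eq_card hG
    have hfin : FiniteDimensional ℂ W := FiniteDimensional.span_of_finite ℂ (Set.finite_range G)
    let e : OrthonormalBasis (Fin n) ℂ W :=
      (stdOrthonormalBasis ℂ W).reindex (finCongr (hW.trans (Fintype.card_fin n)))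
    let F' : Fin n → W := fun i => W.orthogonalProjectionOnto (F i)
    let G' : Fin n → W := fun i => ⟨G i, Submodule.subset_span ⟨i, rfl⟩⟩
    have h1 : (Matrix.of fun i j => (inner ℂ (F i) (G j) : ℂ)) =
        (e.toBasis.toMatrix F').conjTranspose * e.toBasis.toMatrix G' := by
      ext i j
      have h2 : (inner ℂ (F i) (G j) : ℂ) = inner ℂ (F' i) (G' j) := by
        rw [Submodule.inner_orthogonalProjectionOnto_eq_of_mem_right]
      rw [Matrix.of_apply, h2, ← e.sum_inner_mul_inner, Matrix.mul_apply]
      refine Finset.sum_congr rfl fun k _ => ?_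
      simp [Module.Basis.toMatrix_apply, e.repr_apply_apply]
    rw [h1, Matrix.det_mul, Matrix.det_conjTranspose, norm_mul, norm_star,
      ← Module.Basis.det_apply, ← Module.Basis.det_apply]
    refine mul_le_mul ((norm_orthonormalBasis_det_le hW e F').trans ?_)
      ((norm_orthonormalBasis_det_le hW e G').trans (le_of_eq rfl)) (norm_nonneg _)
      (Finset.prod_nonneg fun _ _ => norm_nonneg _)
    exact Finset.prod_le_prod (fun _ _ => norm_nonneg _)
      fun i _ => Submodule.norm_orthogonalProjectionOnto_apply_le W (F i)
  · rw [Fintype.not_linearIndependent_iff] at hG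
    obtain ⟨c, hc, i, hi⟩ := hG
    have : (Matrix.of fun i j => (inner ℂ (F i) (G j) : ℂ)).det = 0 := by
      rw [← Matrix.exists_mulVec_eq_zero_iff]
      refine ⟨c, fun h => hi (by simp [h]), ?_⟩
      ext i
      have := congrArg (inner ℂ (F i)) hc
      rw [inner_sum, inner_zero_right] at this
      rw [Pi.zero_apply, ← this]
      simp [Matrix.mulVec, dotProduct, inner_smul_right, mul_comm]
    rw [this, norm_zero]
    positivity

variable {M α : Type*} [AddCommGroup M] [Module ℂ M]

theorem exists_word_sort (e : α → M) (p : α → Bool) (l : List α) :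
    ∃ ε : ℂ, ‖ε‖ = 1 ∧ word (l.map e) =
      ε • (word ((l.filter fun a => !p a).map e) * word ((l.filter p).map e)) := by
  induction l with
  | nil => exact ⟨1, by simp, by simp⟩
  | cons a l ih =>
    obtain ⟨ε, hε, h⟩ := ih
    cases hp : p a with
    | false => exact ⟨ε, hε, by simp [hp, h, mul_assoc]⟩
    | true =>
      refine ⟨ε * (-1) ^ (l.filter fun a => !p a).length, by simp [hε], ?_⟩
      simp only [List.map_cons, word_cons, h, List.filter_cons, hp]
      rw [mul_smul_comm, ← mul_assoc, ι_mul_comm, parity_word]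
      simp [mul_smul, mul_assoc]

theorem eraseIdx_ofFn {n : ℕ} (Q : Fin (n + 1) → α) (j : Fin (n + 1)) :
    (List.ofFn Q).eraseIdx j = List.ofFn fun i => Q (j.succAbove i) := by
  induction n with
  | zero =>
    obtain rfl : j = 0 := Fin.fin_one_eq_zero j
    simp
  | succ n ih =>
    refine Fin.cases ?_ (fun k => ?_) j
    · rw [List.ofFn_succ]; simp
    · rw [List.ofFn_succ, Fin.val_succ, List.eraseIdx_cons_succ, ih, List.ofFn_succ]
      simp

variable {A : LinearMap.BilinForm ℂ M}

/-- Contracting the first letter of `P` with all letters of `Q` is the Laplace expansion along the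
first row; the uncontracted letter has no constant term. The sign depends on `n` only, so it is
chosen before `P` and `Q`, and all minors carry the same sign in the induction. -/
theorem exists_ct_wick_word_mul_word (hA : A.IsAlt) (e : α → M) (u : α → H) (n : ℕ) :
    ∃ ε : ℂ, ‖ε‖ = 1 ∧ ∀ (m : ℕ) (P : Fin n → α) (Q : Fin m → α),
      (∀ i j, A (e (P i)) (e (P j)) = 0) → (∀ i j, A (e (Q i)) (e (Q j)) = 0) →
      (∀ i j, A (e (P i)) (e (Q j)) = inner ℂ (u (P i)) (u (Q j))) →
      ct (wick A (word ((List.ofFn P).map e) * word ((List.ofFn Q).map e))) =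
        if h : n = m then
          ε * (Matrix.of fun i j => (inner ℂ (u (P i)) (u (Q (Fin.cast h j))) : ℂ)).det
        else 0 := by
  induction n with
  | zero =>
    refine ⟨1, by simp, fun m P Q hPP hQQ hPQ => ?_⟩
    rw [List.ofFn_zero, List.map_nil, word_nil, one_mul, wick_word_of_forall hA]
    · split_ifs with h
      · subst h; simp
      · apply ct_word_of_ne_nil
        cases m with
        | zero => exact absurd rfl h
        | succ m => simp [List.ofFn_succ]
    · intro a ha b hb
      simp only [List.map_ofFn, List.mem_ofFn, Function.comp_apply] at ha hb
      obtain ⟨i, rfl⟩ := ha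
      obtain ⟨j, rfl⟩ := hb
      exact hQQ i j
  | succ n ih =>
    obtain ⟨ε, hε, ih⟩ := ih
    refine ⟨(-1) ^ n * ε, by simp [hε], fun m P Q hPP hQQ hPQ => ?_⟩
    have key : ct (wick A (word ((List.ofFn P).map e) * word ((List.ofFn Q).map e))) =
        (-1 : ℂ) ^ n * ∑ j : Fin m, (-1 : ℂ) ^ (j : ℕ) * inner ℂ (u (P 0)) (u (Q j)) *
          ct (wick A (word ((List.ofFn fun i => P i.succ).map e) *
            word (((List.ofFn Q).eraseIdx j).map e))) := by
      rw [List.ofFn_succ, List.map_cons, word_cons, mul_assoc, wick_ι_mul hA, map_add, map_mul,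
        ct_ι, zero_mul, zero_add, ← wick_contr hA, contr_mul, contr_word_of_forall, zero_mul,
        zero_add, parity_word, contr_word]
      · simp only [List.length_map, List.length_ofFn]
        rw [smul_mul_assoc, map_smul, map_smul, smul_eq_mul, Finset.mul_sum, map_sum, map_sum]
        congr 1
        refine Finset.sum_bij' (fun i _ => Fin.cast (by simp) i) (fun i _ => Fin.cast (by simp) i)
          (by simp) (by simp) (by simp) (by simp) fun i _ => ?_
        rw [mul_smul_comm, map_smul, map_smul, smul_eq_mul, List.eraseIdx_map]
        simp [hPQ]
        left; rfl
      · intro a ha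
        simp only [List.map_ofFn, List.mem_ofFn, Function.comp_apply] at ha
        obtain ⟨i, rfl⟩ := ha
        exact hPP _ _
    rw [key]
    cases m with
    | zero => simp
    | succ m =>
      have h0 : ∀ j : Fin (m + 1), _ := fun j =>
        ih m (fun i => P i.succ) (fun i => Q (j.succAbove i)) (fun i j => hPP _ _)
          (fun i j => hQQ _ _) (fun i j => hPQ _ _)
      simp only [eraseIdx_ofFn, h0]
      by_cases h : n = m
      · subst h
        simp only [dite_true, Fin.cast_refl, id_eq]
        rw [Matrix.det_succ_row_zero, mul_assoc, Finset.mul_sum (a := ε)]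
        congr 1
        refine Finset.sum_congr rfl fun j _ => ?_
        have : (Matrix.of fun i j => (inner ℂ (u (P i)) (u (Q j)) : ℂ)).submatrix Fin.succ
            j.succAbove = Matrix.of fun i k => (inner ℂ (u (P i.succ)) (u (Q (j.succAbove k))) : ℂ) :=
          rfl
        rw [this, Matrix.of_apply]
        ring
      · simp [h]

/-- Gaussian expectations of words are bounded if the covariance has a Gram representation. -/
theorem norm_ct_wick_word_le (hA : A.IsAlt) (e : α → M) (p : α → Bool) (u : α → H) {γ : ℝ}
    (hγ : 0 ≤ γ) (hu : ∀ a, ‖u a‖ ≤ γ)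
    (hAu : ∀ a b, p a = false → p b = true → A (e a) (e b) = inner ℂ (u a) (u b))
    (hA0 : ∀ a b, p a = p b → A (e a) (e b) = 0) (l : List α) :
    ‖ct (wick A (word (l.map e)))‖ ≤ γ ^ l.length := by
  obtain ⟨δ, hδ, hl⟩ := exists_word_sort e p l
  set P := l.filter fun a => !p a with hP
  set Q := l.filter p with hQ
  have hlen : l.length = P.length + Q.length := by
    rw [hP, hQ, add_comm]
    simpa using List.length_eq_length_filter_add (l := l) p
  have hPp : ∀ i : Fin P.length, p (P.get i) = false := fun i => by
    have : P.get i ∈ P := List.get_mem _ _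
    simpa using (List.mem_filter.mp this).2
  have hQp : ∀ i : Fin Q.length, p (Q.get i) = true := fun i => by
    have : Q.get i ∈ Q := List.get_mem _ _
    simpa using (List.mem_filter.mp this).2
  obtain ⟨ε, hε, h⟩ := exists_ct_wick_word_mul_word hA e u P.length
  have h := h Q.length P.get Q.get (fun i j => hA0 _ _ (by rw [hPp, hPp]))
    (fun i j => hA0 _ _ (by rw [hQp, hQp])) (fun i j => hAu _ _ (hPp i) (hQp j))
  rw [List.ofFn_get, List.ofFn_get] at h
  rw [hl, map_smul, map_smul, smul_eq_mul, norm_mul, hδ, one_mul, h, hlen, pow_add]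
  split_ifs with hPQ
  · rw [norm_mul, hε, one_mul]
    refine (norm_det_inner_le (fun i => u (P.get i)) fun i => u (Q.get (Fin.cast hPQ i))).trans ?_
    refine mul_le_mul ?_ ?_ (Finset.prod_nonneg fun _ _ => norm_nonneg _) (by positivity)
    · refine (Finset.prod_le_prod (fun _ _ => norm_nonneg _) fun i _ => hu _).trans ?_
      simp
    · refine (Finset.prod_le_prod (fun _ _ => norm_nonneg _) fun i _ => hu _).trans ?_
      simp [hPQ]
  · rw [norm_zero]; positivity

end Gram

/-! ### Identification of the convolution with `μ_C` with a Wick map. -/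

section Convolution

variable {𝕏 : Type*}

/-- The antisymmetric covariance `∫ dμ_C(ψ) ψ_z ψ_{z'}` of two field components. -/
def cov (C : 𝕏 → 𝕏 → ℂ) : 𝕏 ⊕ 𝕏 → 𝕏 ⊕ 𝕏 → ℂ
  | Sum.inr X, Sum.inl Y => C X Y
  | Sum.inl Y, Sum.inr X => -C X Y
  | Sum.inl _, Sum.inl _ => 0
  | Sum.inr _, Sum.inr _ => 0

theorem cov_swap (C : 𝕏 → 𝕏 → ℂ) (z w : 𝕏 ⊕ 𝕏) : cov C z w = -cov C w z := by
  rcases z with X | X <;> rcases w with Y | Y <;> simp [cov]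

theorem map_gexp_of_eq_zero {σ τ : Type*} [Fintype σ] (f : (σ → ℂ) →ₗ[ℂ] (τ → ℂ)) {V : Grassmann σ}
    (h : ExteriorAlgebra.map f V = 0) : ExteriorAlgebra.map f (gexp V) = 1 := by
  rw [gexp, map_sum, Finset.sum_range_succ']
  simp [h]

variable [Fintype 𝕏]

/-- The linear form attached to a field, in the algebra with sources. -/
def dualOf (κ : ℝ) (v : 𝕏 ⊕ 𝕏 → ℂ) : Module.Dual ℂ ((𝕏 ⊕ 𝕏) ⊕ (𝕏 ⊕ 𝕏) → ℂ) :=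
  sourceDual κ (v ∘ Sum.elim id id)

theorem dualOf_apply (κ : ℝ) (v : 𝕏 ⊕ 𝕏 → ℂ) (w : (𝕏 ⊕ 𝕏) ⊕ (𝕏 ⊕ 𝕏) → ℂ) :
    dualOf κ v w = (κ : ℂ)⁻¹ * ∑ X, (v (Sum.inr X) * w (Sum.inr (Sum.inl X)) -
      v (Sum.inl X) * w (Sum.inr (Sum.inr X))) := by
  simp [dualOf, sourceDual, LinearMap.sum_apply]

variable [DecidableEq 𝕏]

/-- The bilinear form on the generators given by `cov`. -/
def covForm (C : 𝕏 → 𝕏 → ℂ) : LinearMap.BilinForm ℂ (𝕏 ⊕ 𝕏 → ℂ) :=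
  Matrix.toLinearMap₂' ℂ (Matrix.of (cov C))

@[simp] theorem covForm_single (C : 𝕏 → 𝕏 → ℂ) (z w : 𝕏 ⊕ 𝕏) :
    covForm C (Pi.single z 1) (Pi.single w 1) = cov C z w := by
  rw [covForm, Matrix.toLinearMap₂'_apply', Matrix.mulVec_single_one,
    single_one_dotProduct, Matrix.col_apply, Matrix.of_apply]

theorem covForm_apply (C : 𝕏 → 𝕏 → ℂ) (v w : 𝕏 ⊕ 𝕏 → ℂ) :
    covForm C v w =
      ∑ X, ∑ Y, C X Y * (v (Sum.inr X) * w (Sum.inl Y) - w (Sum.inr X) * v (Sum.inl Y)) := by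
  rw [covForm, Matrix.toLinearMap₂'_apply']
  simp only [dotProduct, Matrix.mulVec, Fintype.sum_sum_type, Matrix.of_apply, cov, zero_mul,
    Finset.sum_const_zero, zero_add, add_zero, Finset.mul_sum]
  rw [Finset.sum_comm, ← Finset.sum_add_distrib]
  refine Finset.sum_congr rfl fun X _ => ?_
  rw [← Finset.sum_add_distrib]
  exact Finset.sum_congr rfl fun Y _ => by ring

theorem covForm_isAlt (C : 𝕏 → 𝕏 → ℂ) : (covForm C).IsAlt := fun v => by
  rw [covForm_apply]
  simp

theorem contr_sourceForm (κ : ℝ) (C : 𝕏 → 𝕏 → ℂ)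
    (d : Module.Dual ℂ ((𝕏 ⊕ 𝕏) ⊕ (𝕏 ⊕ 𝕏) → ℂ)) :
    contr d (sourceForm κ C) = ExteriorAlgebra.ι ℂ (∑ X, ∑ Y, ((κ : ℂ) ^ 2 * C X Y) •
      (d (Pi.single (Sum.inr (Sum.inl X)) 1) • Pi.single (Sum.inr (Sum.inr Y)) (1 : ℂ) -
        d (Pi.single (Sum.inr (Sum.inr Y)) 1) • Pi.single (Sum.inr (Sum.inl X)) (1 : ℂ))) := by
  simp only [sourceForm, gen, map_sum, map_smul, contr_ι_mul, contr_ι, map_sub]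
  refine Finset.sum_congr rfl fun X _ => Finset.sum_congr rfl fun Y _ => ?_
  rw [← Algebra.commutes, ← Algebra.smul_def]

theorem parity_sourceForm (κ : ℝ) (C : 𝕏 → 𝕏 → ℂ) :
    parity (sourceForm κ C) = sourceForm κ C := by
  simp [sourceForm, gen]

theorem ct_sourceForm (κ : ℝ) (C : 𝕏 → 𝕏 → ℂ) : ct (sourceForm κ C) = 0 := by
  simp [sourceForm, gen]

/-- The sum of a field and of its contraction with the source form. -/
def fieldPlusSource (κ : ℝ) (C : 𝕏 → 𝕏 → ℂ) :
    (𝕏 ⊕ 𝕏 → ℂ) →ₗ[ℂ] ((𝕏 ⊕ 𝕏) ⊕ (𝕏 ⊕ 𝕏) → ℂ) where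
  toFun v := Sum.elim v (Sum.elim (fun X => ∑ Y, (κ : ℂ) * C X Y * v (Sum.inl Y))
    (fun Y => ∑ X, (κ : ℂ) * C X Y * v (Sum.inr X)))
  map_add' a b := by
    ext (s | (s | s)) <;> simp [mul_add, Finset.sum_add_distrib]
  map_smul' a b := by
    ext (s | (s | s)) <;> simp [Finset.mul_sum, mul_left_comm]

theorem contr_dualOf_sourceForm {κ : ℝ} (hκ : 0 < κ) (C : 𝕏 → 𝕏 → ℂ) (v : 𝕏 ⊕ 𝕏 → ℂ) :
    contr (dualOf κ v) (sourceForm κ C) =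
      ExteriorAlgebra.ι ℂ (fieldPlusSource κ C v - Sum.elim v 0) := by
  have hκ' : (κ : ℂ) ≠ 0 := by exact_mod_cast hκ.ne'
  have h1 : ∀ X, dualOf κ v (Pi.single (Sum.inr (Sum.inl X)) 1) = (κ : ℂ)⁻¹ * v (Sum.inr X) := by
    intro X
    simp [dualOf_apply, Pi.single_apply]
  have h2 : ∀ X, dualOf κ v (Pi.single (Sum.inr (Sum.inr X)) 1) = -((κ : ℂ)⁻¹ * v (Sum.inl X)) := by
    intro X
    simp [dualOf_apply, Pi.single_apply]
  rw [contr_sourceForm]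
  congr 1
  ext s
  simp only [h1, h2, fieldPlusSource, Finset.sum_apply, Pi.smul_apply, Pi.sub_apply,
    Pi.single_apply, smul_eq_mul, LinearMap.coe_mk, AddHom.coe_mk]
  rcases s with s | (s | s)
  · simp
  · simp only [Sum.inr.injEq, Sum.inl.injEq, reduceCtorEq, if_false, mul_zero, mul_ite, mul_one,
      zero_sub, sub_zero, mul_neg, Sum.elim_inr, Sum.elim_inl, Pi.zero_apply]
    rw [Finset.sum_eq_single s (fun X _ hX => by simp [hX.symm]) (by simp)]
    refine Finset.sum_congr rfl fun Y _ => ?_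
    simp
    field_simp
  · simp only [Sum.inr.injEq, reduceCtorEq, if_false, mul_zero, mul_ite, mul_one,
      sub_zero, Sum.elim_inr, Pi.zero_apply, Finset.sum_ite_eq, Finset.mem_univ, if_true]
    refine Finset.sum_congr rfl fun Y _ => ?_
    field_simp

theorem dualOf_fieldPlusSource {κ : ℝ} (hκ : 0 < κ) (C : 𝕏 → 𝕏 → ℂ) (v w : 𝕏 ⊕ 𝕏 → ℂ) :
    dualOf κ v (fieldPlusSource κ C w) = covForm C v w := by
  have hκ' : (κ : ℂ) ≠ 0 := by exact_mod_cast hκ.ne'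
  rw [dualOf_apply, covForm_apply]
  simp only [fieldPlusSource, LinearMap.coe_mk, AddHom.coe_mk, Sum.elim_inr, Sum.elim_inl]
  rw [Finset.sum_sub_distrib, mul_sub, Finset.mul_sum, Finset.mul_sum]
  simp only [mul_sub, Finset.sum_sub_distrib]
  congr 1
  · refine Finset.sum_congr rfl fun X _ => ?_
    rw [Finset.mul_sum, Finset.mul_sum]
    exact Finset.sum_congr rfl fun Y _ => by field_simp
  · rw [Finset.sum_comm]
    refine Finset.sum_congr rfl fun X _ => ?_
    rw [Finset.mul_sum, Finset.mul_sum]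
    exact Finset.sum_congr rfl fun Y _ => by field_simp

/-- A field acts as `φ` plus a derivative with respect to the sources. The derivative of the
exponential multiplies by a source term, which adds up with `φ` to `fieldPlusSource`; the derivative
of the fields treated before produces the covariance. This is the recursion defining `wick`. -/
theorem sourceSubst_shift {κ : ℝ} (hκ : 0 < κ) (C : 𝕏 → 𝕏 → ℂ) (V : Fields 𝕏) :
    sourceSubst κ (shift V) (gexp (sourceForm κ C)) =
      ExteriorAlgebra.map (fieldPlusSource κ C) (wick (covForm C) V) * gexp (sourceForm κ C) := by
  have hA := covForm_isAlt C
  induction V using left_induction with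
  | h0 r => simp [wick_algebraMap hA, Algebra.smul_def]
  | hadd x y hx hy => simp only [map_add, LinearMap.add_apply, hx, hy, add_mul]
  | hmul x v hx =>
    have h1 : sourceSubst (𝕏 := 𝕏) κ (shift (ExteriorAlgebra.ι ℂ v)) =
        LinearMap.mulLeft ℂ (ExteriorAlgebra.ι ℂ (Sum.elim v 0)) + contr (dualOf κ v) := by
      rw [shift, ExteriorAlgebra.map_apply_ι, sourceSubst, ExteriorAlgebra.lift_ι_apply]
      rfl
    have h2 : contr (dualOf κ v) (gexp (sourceForm κ C)) =
        ExteriorAlgebra.ι ℂ (fieldPlusSource κ C v - Sum.elim v 0) * gexp (sourceForm κ C) := by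
      rw [contr_gexp (parity_sourceForm κ C) (ct_sourceForm κ C), contr_dualOf_sourceForm hκ]
      rw [contr_dualOf_sourceForm hκ, ct_ι]
    have h3 : dualOf κ v ∘ₗ fieldPlusSource κ C = covForm C v :=
      LinearMap.ext fun w => dualOf_fieldPlusSource hκ C v w
    rw [map_mul, map_mul, Module.End.mul_apply, hx, h1, LinearMap.add_apply,
      LinearMap.mulLeft_apply, contr_mul, h2, contr_map, h3, wick_ι_mul hA, map_add, map_mul,
      ExteriorAlgebra.map_apply_ι, ← mul_assoc (parity _), ← ι_mul_comm, map_sub]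
    simp only [mul_assoc, add_mul, sub_mul]
    abel

/-- At vanishing sources the exponential becomes `1` and `fieldPlusSource` becomes the identity. -/
theorem convolution_eq_wick {κ : ℝ} (hκ : 0 < κ) (C : 𝕏 → 𝕏 → ℂ) (V : Fields 𝕏) :
    convolution κ C V = wick (covForm C) V := by
  have h : convolution κ C V = dropSnd (sourceSubst κ (shift V) (gexp (sourceForm κ C))) := rfl
  rw [h, sourceSubst_shift hκ, map_mul]
  have h1 : dropSnd (gexp (sourceForm κ C)) = 1 := by
    apply map_gexp_of_eq_zero
    simp only [sourceForm, gen, map_sum, map_smul, map_mul, ExteriorAlgebra.map_apply_ι]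
    refine Finset.sum_eq_zero fun X _ => Finset.sum_eq_zero fun Y _ => ?_
    have : LinearMap.funLeft ℂ ℂ (Sum.inl : 𝕏 ⊕ 𝕏 → (𝕏 ⊕ 𝕏) ⊕ (𝕏 ⊕ 𝕏))
        (Pi.single (Sum.inr (Sum.inl X)) 1) = 0 := by
      ext s; simp [LinearMap.funLeft_apply]
    rw [this]; simp
  have h2 : LinearMap.funLeft ℂ ℂ (Sum.inl : 𝕏 ⊕ 𝕏 → (𝕏 ⊕ 𝕏) ⊕ (𝕏 ⊕ 𝕏)) ∘ₗ fieldPlusSource κ C =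
      LinearMap.id := rfl
  rw [h1, mul_one, dropSnd, ← AlgHom.comp_apply, ExteriorAlgebra.map_comp_map, h2,
    ExteriorAlgebra.map_id, AlgHom.id_apply]

end Convolution

/-! ### Iterated derivatives of monomials. -/

section Coefficients

variable {σ : Type*}

/-- Iterated contraction with the coordinate functions of the letters of a list. -/
def derivs : List σ → Module.End ℂ (Grassmann σ)
  | [] => LinearMap.id
  | z :: l => derivs l ∘ₗ contr (LinearMap.proj z)

theorem derivs_append (l l' : List σ) : derivs (l ++ l') = derivs l' ∘ₗ derivs l := by
  induction l with
  | nil => rfl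
  | cons z l ih => simp [derivs, ih, LinearMap.comp_assoc]

theorem ofFn_cons {𝕏 : Type*} {n : ℕ} (e : 𝕏 → σ) (x : 𝕏) (X : Fin n → 𝕏) :
    (List.ofFn fun i => e ((Fin.cons x X : Fin (n + 1) → 𝕏) i)) = e x :: List.ofFn fun i => e (X i) := by
  simp [List.ofFn_succ]

theorem sum_fin_succ_fun {𝕏 : Type*} [Fintype 𝕏] {β : Type*} [AddCommMonoid β] {n : ℕ} (F : (Fin (n + 1) → 𝕏) → β) :
    ∑ X, F X = ∑ x, ∑ X : Fin n → 𝕏, F (Fin.cons x X) := by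
  rw [← (Fin.consEquiv fun _ => 𝕏).sum_comp, Fintype.sum_prod_type]
  rfl

theorem reverse_prod_gderiv (κ : ℝ) (l : List σ) :
    (l.map fun z => gderiv κ z).reverse.prod = ((κ : ℂ)⁻¹) ^ l.length • derivs l := by
  induction l with
  | nil => simp [derivs]; rfl
  | cons z l ih =>
    rw [List.map_cons, List.reverse_cons, List.prod_append, ih, List.prod_singleton, gderiv,
      smul_mul_smul_comm, List.length_cons, pow_succ]
    rfl

variable [DecidableEq σ]

/-- The product of a list of generators. -/
def gword (l : List σ) : Grassmann σ := word (l.map fun z => Pi.single z (1 : ℂ))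

@[simp] theorem gword_nil : gword ([] : List σ) = 1 := rfl

@[simp] theorem gword_cons (z : σ) (l : List σ) : gword (z :: l) = gen z * gword l := by
  simp [gword, gen]

@[simp] theorem gword_append (l l' : List σ) : gword (l ++ l') = gword l * gword l' := by
  simp [gword]

theorem prod_ofFn_gen {n : ℕ} (z : Fin n → σ) :
    (List.ofFn fun i => gen (z i)).prod = gword (List.ofFn z) := by
  rw [gword, word, List.map_map, List.map_ofFn]
  rfl

theorem contr_proj_gword (z : σ) (l : List σ) :
    contr (LinearMap.proj z) (gword l) =
      ∑ j : Fin l.length, ((-1 : ℂ) ^ (j : ℕ) * if l[(j : ℕ)] = z then 1 else 0) •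
        gword (l.eraseIdx j) := by
  rw [gword, contr_word]
  refine Finset.sum_bij' (fun i _ => Fin.cast (by simp) i) (fun i _ => Fin.cast (by simp) i)
    (by simp) (by simp) (by simp) (by simp) fun i _ => ?_
  rw [List.eraseIdx_map]
  simp [gword, Pi.single_apply, eq_comm]

theorem contr_proj_gword_of_notMem {z : σ} {l : List σ} (h : z ∉ l) :
    contr (LinearMap.proj z) (gword l) = 0 := by
  rw [contr_proj_gword]
  refine Finset.sum_eq_zero fun j _ => ?_
  rw [if_neg, mul_zero, zero_smul]
  exact fun hj => h (hj ▸ List.getElem_mem _)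

theorem parity_gword (l : List σ) : parity (gword l) = (-1 : ℂ) ^ l.length • gword l := by
  simp [gword]

theorem gen_mul_gword_eraseIdx (l : List σ) (j : Fin l.length) :
    gen l[(j : ℕ)] * gword (l.eraseIdx j) = (-1 : ℂ) ^ (j : ℕ) • gword l := by
  have := ι_mul_word_eraseIdx (l.map fun z => Pi.single z (1 : ℂ)) (Fin.cast (by simp) j)
  rw [List.eraseIdx_map] at this
  simpa [gen, gword] using this

/-- Iterated derivative of a Grassmann polynomial at zero. -/
def pairing (l : List σ) (x : Grassmann σ) : ℂ := ct (derivs l x)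

theorem pairing_cons_gword (z : σ) (l w : List σ) :
    pairing (z :: l) (gword w) = ∑ j : Fin w.length,
      ((-1 : ℂ) ^ (j : ℕ) * if w[(j : ℕ)] = z then 1 else 0) * pairing l (gword (w.eraseIdx j)) := by
  rw [pairing, derivs, LinearMap.comp_apply, contr_proj_gword, map_sum, map_sum]
  simp only [pairing, map_smul, smul_eq_mul]

theorem pairing_nil_gword (w : List σ) : pairing [] (gword w) = if w = [] then 1 else 0 := by
  cases w with
  | nil => simp [pairing, derivs]
  | cons z w => simp [pairing, derivs, gen]

theorem pairing_gword_of_length_ne (l w : List σ) (h : l.length ≠ w.length) :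
    pairing l (gword w) = 0 := by
  induction l generalizing w with
  | nil =>
    rw [pairing_nil_gword, if_neg]
    rintro rfl
    exact h rfl
  | cons z l ih =>
    rw [pairing_cons_gword]
    refine Finset.sum_eq_zero fun j _ => ?_
    rw [ih, mul_zero]
    rw [List.length_eraseIdx_of_lt j.2]
    have := j.2
    simp only [List.length_cons] at h
    omega

theorem pairing_append_gword_mul (l l' w w' : List σ) (h1 : ∀ z ∈ l, z ∉ w') (h2 : ∀ z ∈ l', z ∉ w) :
    pairing (l ++ l') (gword w * gword w') = pairing l (gword w) * pairing l' (gword w') := by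
  induction l generalizing w with
  | nil =>
    rw [pairing_nil_gword, List.nil_append]
    split_ifs with hw
    · rw [hw]; simp
    -- Letters of `w` are left over. The derivatives in `l'` pass them up to a sign, so they survive
    -- and there is no constant term.
    · have : ∀ y, ∃ c : ℂ, derivs l' (gword w * y) = c • (gword w * derivs l' y) := by
        clear h1
        induction l' with
        | nil => exact fun y => ⟨1, by simp [derivs]⟩
        | cons z l' ih =>
          intro y
          obtain ⟨c, hc⟩ := ih (fun z hz => h2 z (List.mem_cons_of_mem _ hz))
            (contr (LinearMap.proj z) y)
          refine ⟨(-1) ^ w.length * c, ?_⟩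
          rw [derivs, LinearMap.comp_apply, contr_mul,
            contr_proj_gword_of_notMem (h2 z List.mem_cons_self), zero_mul, zero_add, parity_gword,
            smul_mul_assoc, map_smul, hc, smul_smul]
          rfl
      obtain ⟨c, hc⟩ := this (gword w')
      rw [pairing, hc, map_smul, map_mul, gword, ct_word_of_ne_nil (by simpa using hw)]
      simp
  | cons z l ih =>
    have h3 : pairing (z :: l ++ l') (gword w * gword w') =
        pairing (l ++ l') (contr (LinearMap.proj z) (gword w) * gword w') := by
      rw [pairing, List.cons_append, derivs, LinearMap.comp_apply, contr_mul,
        contr_proj_gword_of_notMem (h1 z List.mem_cons_self), mul_zero, add_zero]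
      rfl
    rw [h3, pairing_cons_gword, contr_proj_gword, Finset.sum_mul, Finset.sum_mul]
    simp only [pairing, map_sum]
    refine Finset.sum_congr rfl fun j _ => ?_
    rw [smul_mul_assoc, map_smul, map_smul, smul_eq_mul, mul_assoc _ _ (ct (derivs l' _))]
    congr 1
    exact ih _ (fun z hz => h1 z (List.mem_cons_of_mem _ hz))
      fun z hz hz' => h2 z hz (List.mem_of_mem_eraseIdx hz')

section Injective

variable {𝕏 : Type*} [DecidableEq 𝕏]

theorem norm_pairing_cons_le {e : 𝕏 → σ} (he : Function.Injective e) (x : 𝕏) (l : List σ)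
    (w : List 𝕏) : ‖pairing (e x :: l) (gword (w.map e))‖ ≤
      ∑ j : Fin w.length, (if w[(j : ℕ)] = x then 1 else 0) *
        ‖pairing l (gword ((w.eraseIdx j).map e))‖ := by
  rw [pairing_cons_gword]
  refine (norm_sum_le _ _).trans (le_of_eq ?_)
  refine Finset.sum_bij' (fun i _ => Fin.cast (by simp) i) (fun i _ => Fin.cast (by simp) i)
    (by simp) (by simp) (by simp) (by simp) fun i _ => ?_
  rw [List.eraseIdx_map, norm_mul, norm_mul]
  simp only [List.getElem_map, he.eq_iff, norm_pow, norm_neg, norm_one, one_pow, one_mul,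
    Fin.val_cast]
  split_ifs <;> simp

variable [Fintype 𝕏]

/-- Each derivative hits one of the remaining letters, so at most `n (n - 1) ⋯ 1` choices
contribute, each with modulus one. The normalization of `coeff` compensates this factorial. -/
theorem sum_norm_pairing_le {e : 𝕏 → σ} (he : Function.Injective e) (n : ℕ) (w : List 𝕏)
    (hw : w.length = n) :
    ∑ X : Fin n → 𝕏, ‖pairing (List.ofFn fun i => e (X i)) (gword (w.map e))‖ ≤ (n ! : ℝ) := by
  induction n generalizing w with
  | zero =>
    rw [List.length_eq_zero_iff] at hw
    subst hw
    simp [pairing, derivs]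
  | succ n ih =>
    rw [sum_fin_succ_fun]
    simp only [ofFn_cons]
    have h1 : ∀ x, ∑ X : Fin n → 𝕏, ‖pairing (e x :: List.ofFn fun i => e (X i)) (gword (w.map e))‖
        ≤ ∑ j : Fin w.length, (if w[(j : ℕ)] = x then 1 else 0) * (n ! : ℝ) := by
      intro x
      refine (Finset.sum_le_sum fun X _ => norm_pairing_cons_le he x _ w).trans ?_
      rw [Finset.sum_comm]
      refine Finset.sum_le_sum fun j _ => ?_
      rw [← Finset.mul_sum]
      refine mul_le_mul_of_nonneg_left (ih _ ?_) (by split_ifs <;> simp)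
      rw [List.length_eraseIdx_of_lt j.2]
      omega
    refine (Finset.sum_le_sum fun x _ => h1 x).trans ?_
    rw [Finset.sum_comm]
    simp [hw, Nat.factorial_succ]

theorem count_eq_sum {α : Type*} [DecidableEq α] (x : α) (w : List α) :
    (w.count x : ℝ) = ∑ j : Fin w.length, if w[(j : ℕ)] = x then 1 else 0 := by
  induction w with
  | nil => simp
  | cons y w ih =>
    rw [List.count_cons, Nat.cast_add, ih]
    simp only [List.length_cons]
    rw [Fin.sum_univ_succ, add_comm]
    congr 1
    by_cases h : y = x <;> simp [h]

/-- The derivative with the prescribed letter `x` can hit only the occurrences of `x` in `w`; the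
other `n - 1` derivatives hit the remaining letters in any order. -/
theorem sum_norm_pairing_slice_le {e : 𝕏 → σ} (he : Function.Injective e) (n : ℕ) (w : List 𝕏)
    (hw : w.length = n) (i : Fin n) (x : 𝕏) :
    ∑ X : Fin n → 𝕏 with X i = x, ‖pairing (List.ofFn fun i => e (X i)) (gword (w.map e))‖
      ≤ ((n - 1)! : ℝ) * w.count x := by
  induction n generalizing w with
  | zero => exact i.elim0
  | succ n ih =>
    rw [Finset.sum_filter, sum_fin_succ_fun]
    simp only [ofFn_cons]
    refine Fin.cases ?_ (fun i => ?_) i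
    · simp only [Fin.cons_zero]
      rw [Finset.sum_eq_single x (fun y _ hy => by simp [hy]) (by simp)]
      simp only [if_true]
      refine (Finset.sum_le_sum fun X _ => norm_pairing_cons_le he x _ w).trans ?_
      rw [Finset.sum_comm, count_eq_sum, Finset.mul_sum]
      refine Finset.sum_le_sum fun j _ => ?_
      rw [← Finset.mul_sum, mul_comm]
      refine mul_le_mul_of_nonneg_right (sum_norm_pairing_le he n _ ?_) (by split_ifs <;> simp)
      rw [List.length_eraseIdx_of_lt j.2]
      omega
    · simp only [Fin.cons_succ]
      cases n with
      | zero => exact i.elim0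
      | succ n =>
      have h1 : ∀ y, ∑ X : Fin (n + 1) → 𝕏, (if X i = x then
          ‖pairing (e y :: List.ofFn fun i => e (X i)) (gword (w.map e))‖ else 0)
          ≤ ∑ j : Fin w.length, (if w[(j : ℕ)] = y then 1 else 0) *
            ((n ! : ℝ) * (w.eraseIdx j).count x) := by
        intro y
        have : ∀ X : Fin (n + 1) → 𝕏, (if X i = x then
            ‖pairing (e y :: List.ofFn fun i => e (X i)) (gword (w.map e))‖ else 0) ≤
            ∑ j : Fin w.length, (if w[(j : ℕ)] = y then 1 else 0) * (if X i = x then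
              ‖pairing (List.ofFn fun i => e (X i)) (gword ((w.eraseIdx j).map e))‖ else 0) := by
          intro X
          split_ifs
          · exact norm_pairing_cons_le he y _ w
          · simp
        refine (Finset.sum_le_sum fun X _ => this X).trans ?_
        rw [Finset.sum_comm]
        refine Finset.sum_le_sum fun j _ => ?_
        rw [← Finset.mul_sum, ← Finset.sum_filter]
        refine mul_le_mul_of_nonneg_left (ih _ ?_ i) (by split_ifs <;> simp)
        rw [List.length_eraseIdx_of_lt j.2]
        omega
      refine (Finset.sum_le_sum fun x _ => h1 x).trans ?_
      rw [Finset.sum_comm]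
      simp only [← Finset.sum_mul, Finset.sum_ite_eq, Finset.mem_univ, if_true, one_mul]
      rw [← Finset.mul_sum]
      have h2 : ∀ j : Fin w.length, ((w.eraseIdx j).count x : ℝ) =
          w.count x - if w[(j : ℕ)] = x then 1 else 0 := by
        intro j
        have hp := (List.getElem_cons_eraseIdx_perm j.2).count_eq x
        rw [List.count_cons] at hp
        rw [← hp]
        simp
      simp only [h2, Finset.sum_sub_distrib, ← count_eq_sum]
      rw [Finset.sum_const, Finset.card_univ, Fintype.card_fin, hw, Nat.add_sub_cancel,
        Nat.factorial_succ, nsmul_eq_mul]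
      push_cast
      apply le_of_eq
      ring

/-- All orderings of the letters contribute the same monomial: the sign of the pairing cancels the
sign from reordering. This recovers a monomial from its antisymmetrized coefficients. -/
theorem sum_pairing_smul_gword (e : 𝕏 → σ) (he : Function.Injective e) (n : ℕ) (w : List 𝕏)
    (hw : w.length = n) :
    ∑ X : Fin n → 𝕏, pairing (List.ofFn fun i => e (X i)) (gword (w.map e)) •
      gword (List.ofFn fun i => e (X i)) = (n ! : ℂ) • gword (w.map e) := by
  induction n generalizing w with
  | zero =>
    rw [List.length_eq_zero_iff] at hw
    subst hw
    simp [pairing, derivs]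
  | succ n ih =>
    rw [sum_fin_succ_fun]
    simp only [ofFn_cons, pairing_cons_gword, gword_cons]
    have h1 : ∀ x, ∀ j : Fin (w.map e).length,
        ∑ X : Fin n → 𝕏, (((-1 : ℂ) ^ (j : ℕ) * if (w.map e)[(j : ℕ)] = e x then 1 else 0) *
          pairing (List.ofFn fun i => e (X i)) (gword ((w.map e).eraseIdx j))) •
            (gen (e x) * gword (List.ofFn fun i => e (X i))) =
        (if (w.map e)[(j : ℕ)] = e x then 1 else 0 : ℂ) • ((n ! : ℂ) • gword (w.map e)) := by
      intro x j
      have := ih (w.eraseIdx j) (by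
        rw [List.length_eraseIdx_of_lt (by simpa using j.2)]; omega)
      simp only [mul_smul, ← mul_smul_comm, ← Finset.smul_sum, ← Finset.mul_sum]
      rw [List.eraseIdx_map, this]
      split_ifs with hj
      · rw [← hj]
        simp only [one_smul, mul_smul_comm]
        rw [← List.eraseIdx_map, gen_mul_gword_eraseIdx, smul_smul, smul_smul, mul_right_comm,
          ← mul_pow]
        simp
      · simp
    simp only [Finset.sum_smul]
    rw [Finset.sum_congr rfl fun x _ => Finset.sum_comm]
    simp only [h1]
    rw [Finset.sum_comm]
    simp only [← Finset.sum_smul, List.getElem_map, he.eq_iff, Finset.sum_ite_eq, Finset.mem_univ,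
      if_true]
    simp [hw, Nat.factorial_succ, ← mul_smul]

end Injective

end Coefficients

/-! ### Sorting monomials into `ψ̄` and `ψ` factors, and the coefficient representation. -/

section FieldPolynomial

variable {𝕏 : Type*}

/-- The letters of a word labelling fields `ψ̄`. -/
def lefts (l : List (𝕏 ⊕ 𝕏)) : List 𝕏 := l.filterMap Sum.getLeft?

/-- The letters of a word labelling fields `ψ`. -/
def rights (l : List (𝕏 ⊕ 𝕏)) : List 𝕏 := l.filterMap Sum.getRight?

@[simp] theorem lefts_inl (x : 𝕏) (l : List (𝕏 ⊕ 𝕏)) : lefts (Sum.inl x :: l) = x :: lefts l := rfl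

@[simp] theorem lefts_inr (x : 𝕏) (l : List (𝕏 ⊕ 𝕏)) : lefts (Sum.inr x :: l) = lefts l := rfl

@[simp] theorem rights_inl (x : 𝕏) (l : List (𝕏 ⊕ 𝕏)) : rights (Sum.inl x :: l) = rights l := rfl

@[simp] theorem rights_inr (x : 𝕏) (l : List (𝕏 ⊕ 𝕏)) :
    rights (Sum.inr x :: l) = x :: rights l := rfl

theorem length_lefts (l : List (𝕏 ⊕ 𝕏)) : (lefts l).length = (l.map Sum.isLeft).count true := by
  induction l with
  | nil => rfl
  | cons z l ih => rcases z with y | y <;> simp [ih]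

theorem length_rights (l : List (𝕏 ⊕ 𝕏)) : (rights l).length = (l.map Sum.isLeft).count false := by
  induction l with
  | nil => rfl
  | cons z l ih => rcases z with y | y <;> simp [ih]

theorem count_lefts [DecidableEq 𝕏] (x : 𝕏) (l : List (𝕏 ⊕ 𝕏)) :
    (lefts l).count x = l.countP fun w => w = Sum.inl x := by
  induction l with
  | nil => rfl
  | cons z l ih => rcases z with y | y <;> simp [ih, List.count_cons, List.countP_cons]

theorem count_rights [DecidableEq 𝕏] (x : 𝕏) (l : List (𝕏 ⊕ 𝕏)) :
    (rights l).count x = l.countP fun w => w = Sum.inr x := by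
  induction l with
  | nil => rfl
  | cons z l ih => rcases z with y | y <;> simp [ih, List.count_cons, List.countP_cons]

theorem exists_gword_sort [DecidableEq 𝕏] (l : List (𝕏 ⊕ 𝕏)) : ∃ ε : ℂ, ‖ε‖ = 1 ∧
    gword l = ε • (gword ((lefts l).map Sum.inl) * gword ((rights l).map Sum.inr)) := by
  induction l with
  | nil => exact ⟨1, by simp, by simp [lefts, rights]⟩
  | cons z l ih =>
    obtain ⟨ε, hε, h⟩ := ih
    rcases z with x | x
    · exact ⟨ε, hε, by simp [h, mul_assoc]⟩
    · refine ⟨ε * (-1) ^ (lefts l).length, by simp [hε], ?_⟩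
      have h1 : lefts (Sum.inr x :: l) = lefts l := rfl
      have h2 : rights (Sum.inr x :: l) = x :: rights l := rfl
      rw [gword_cons, h, h1, h2, List.map_cons, gword_cons, mul_smul_comm, ← mul_assoc, gen,
        ι_mul_comm, parity_gword, List.length_map, smul_mul_assoc, smul_mul_assoc, smul_smul,
        mul_assoc]

theorem pairing_sorted [DecidableEq 𝕏] {mb m : ℕ} (X : Fin mb → 𝕏) (Y : Fin m → 𝕏) (p q : List 𝕏) :
    pairing ((List.ofFn fun i => (Sum.inl (X i) : 𝕏 ⊕ 𝕏)) ++
        List.ofFn fun j => (Sum.inr (Y j) : 𝕏 ⊕ 𝕏))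
      (gword (p.map Sum.inl) * gword (q.map Sum.inr)) =
    pairing (List.ofFn fun i => (Sum.inl (X i) : 𝕏 ⊕ 𝕏)) (gword (p.map Sum.inl)) *
      pairing (List.ofFn fun j => (Sum.inr (Y j) : 𝕏 ⊕ 𝕏)) (gword (q.map Sum.inr)) := by
  apply pairing_append_gword_mul
  · intro z hz hz'
    simp only [List.mem_ofFn, List.mem_map] at hz hz'
    obtain ⟨i, rfl⟩ := hz
    simp at hz'
  · intro z hz hz'
    simp only [List.mem_ofFn, List.mem_map] at hz hz'
    obtain ⟨i, rfl⟩ := hz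
    simp at hz'

theorem mem_span_gword {σ : Type*} [Fintype σ] [DecidableEq σ] (x : Grassmann σ) :
    x ∈ Submodule.span ℂ (Set.range (gword (σ := σ))) := by
  induction x using left_induction with
  | h0 r =>
    rw [Algebra.algebraMap_eq_smul_one]
    exact Submodule.smul_mem _ _ (Submodule.subset_span ⟨[], rfl⟩)
  | hadd x y hx hy => exact Submodule.add_mem _ hx hy
  | hmul x m hx =>
    have hm : m = ∑ z, m z • Pi.single z (1 : ℂ) := by
      ext z; simp [Finset.sum_apply, Pi.single_apply]
    rw [hm, map_sum, Finset.sum_mul]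
    refine Submodule.sum_mem _ fun z _ => ?_
    rw [map_smul, smul_mul_assoc]
    refine Submodule.smul_mem _ _ ?_
    induction hx using Submodule.span_induction with
    | mem x h =>
      obtain ⟨l, rfl⟩ := h
      exact Submodule.subset_span ⟨z :: l, by simp [gen]⟩
    | zero => simp
    | add x y _ _ hx hy => rw [mul_add]; exact Submodule.add_mem _ hx hy
    | smul a x _ hx => rw [mul_smul_comm]; exact Submodule.smul_mem _ _ hx

/-- Fields of one kind span an image of `𝕏 → ℂ`, so nilpotency applies with `card 𝕏` instead of the
number of all generators. This is why `fieldPolynomial` may stop at `card 𝕏` in each degree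
separately. -/
theorem gword_map_eq_zero [Fintype 𝕏] [DecidableEq 𝕏] {σ : Type*} [DecidableEq σ] (e : 𝕏 → σ) (p : List 𝕏)
    (hp : Fintype.card 𝕏 < p.length) : gword (p.map e) = 0 := by
  have h : word (p.map fun x => Pi.single x (1 : ℂ)) = 0 := by
    apply word_eq_zero_of_finrank_lt
    rw [Module.finrank_fintype_fun_eq_card]
    simpa using hp
  have := congrArg (ExteriorAlgebra.map (Fintype.linearCombination ℂ
    fun x : 𝕏 => (Pi.single (e x) (1 : ℂ) : σ → ℂ))) h
  rw [map_word, map_zero] at this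
  rw [gword, ← this, List.map_map, List.map_map]
  congr 1
  refine List.map_congr_left fun x _ => ?_
  simp [Fintype.linearCombination_apply_single]

variable [Fintype 𝕏]

theorem coeff_eq_pairing (κ : ℝ) {mb m : ℕ} (X : Fin mb → 𝕏) (Y : Fin m → 𝕏) (V : Fields 𝕏) :
    coeff κ X Y V = ((mb ! : ℂ)⁻¹ * (m ! : ℂ)⁻¹) * (κ : ℂ)⁻¹ ^ (mb + m) *
      pairing ((List.ofFn fun i => (Sum.inl (X i) : 𝕏 ⊕ 𝕏)) ++
        List.ofFn fun j => (Sum.inr (Y j) : 𝕏 ⊕ 𝕏)) V := by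
  have h1 : (List.ofFn fun i => gderiv κ (Sum.inl (X i) : 𝕏 ⊕ 𝕏)).reverse.prod =
      (κ : ℂ)⁻¹ ^ mb • derivs (List.ofFn fun i => (Sum.inl (X i) : 𝕏 ⊕ 𝕏)) := by
    have := reverse_prod_gderiv κ (List.ofFn fun i => (Sum.inl (X i) : 𝕏 ⊕ 𝕏))
    rw [List.map_ofFn, List.length_ofFn] at this
    exact this
  have h2 : (List.ofFn fun j => gderiv κ (Sum.inr (Y j) : 𝕏 ⊕ 𝕏)).reverse.prod =
      (κ : ℂ)⁻¹ ^ m • derivs (List.ofFn fun j => (Sum.inr (Y j) : 𝕏 ⊕ 𝕏)) := by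
    have := reverse_prod_gderiv κ (List.ofFn fun j => (Sum.inr (Y j) : 𝕏 ⊕ 𝕏))
    rw [List.map_ofFn, List.length_ofFn] at this
    exact this
  rw [coeff, h1, h2, smul_mul_smul_comm, pairing, derivs_append]
  simp only [LinearMap.smul_apply, LinearMap.comp_apply, smul_eq_mul, map_smul,
    AlgHom.toLinearMap_apply, Module.End.mul_apply]
  rw [← mul_assoc, pow_add, mul_comm ((κ : ℂ)⁻¹ ^ m)]
  rfl

variable [DecidableEq 𝕏]

/-- A Grassmann polynomial is determined by its coefficient functions. -/
theorem eq_fieldPolynomial {κ : ℝ} (hκ : 0 < κ) (V : Fields 𝕏) :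
    V = fieldPolynomial κ (fun _ _ X Y => coeff κ X Y V) := by
  have hκ' : (κ : ℂ) ≠ 0 := by exact_mod_cast hκ.ne'
  have hV := mem_span_gword V
  induction hV using Submodule.span_induction with
  | zero => simp [fieldPolynomial]
  | add x y _ _ hx hy =>
    conv_lhs => rw [hx, hy]
    simp only [fieldPolynomial, map_add, add_smul, Finset.sum_add_distrib, smul_add]
  | smul a x _ hx =>
    conv_lhs => rw [hx]
    simp only [fieldPolynomial, map_smul, Finset.smul_sum, smul_smul, smul_eq_mul]
    simp only [mul_left_comm a]
  | mem x h =>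
    obtain ⟨l, rfl⟩ := h
    obtain ⟨ε, -, h⟩ := exists_gword_sort l
    rw [h]
    generalize lefts l = p
    generalize rights l = q
    by_cases hp : Fintype.card 𝕏 < p.length
    · rw [gword_map_eq_zero _ p hp]; simp [fieldPolynomial]
    by_cases hq : Fintype.card 𝕏 < q.length
    · rw [gword_map_eq_zero _ q hq]; simp [fieldPolynomial]
    simp only [fieldPolynomial, map_smul, coeff_eq_pairing, pairing_sorted, prod_ofFn_gen]
    rw [Finset.sum_eq_single p.length, Finset.sum_eq_single q.length]
    · have h1 := sum_pairing_smul_gword (Sum.inl : 𝕏 → 𝕏 ⊕ 𝕏) Sum.inl_injective p.length p rfl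
      have h2 := sum_pairing_smul_gword (Sum.inr : 𝕏 → 𝕏 ⊕ 𝕏) Sum.inr_injective q.length q rfl
      have h3 := congrArg₂ (· * ·) h1 h2
      simp only [Finset.sum_mul_sum, smul_mul_smul_comm] at h3
      simp only [smul_eq_mul, mul_smul _ _ (gword _ * gword _), ← Finset.smul_sum] at h3 ⊢
      rw [h3]
      simp only [smul_smul]
      congr 1
      have hp' : ((p.length ! : ℕ) : ℂ) ≠ 0 := by exact_mod_cast Nat.factorial_ne_zero _
      have hq' : ((q.length ! : ℕ) : ℂ) ≠ 0 := by exact_mod_cast Nat.factorial_ne_zero _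
      simp only [inv_pow]
      field_simp
    · intro m _ hm
      simp only [smul_eq_zero, pow_eq_zero_iff', hκ']
      right
      refine Finset.sum_eq_zero fun X _ => Finset.sum_eq_zero fun Y _ => ?_
      rw [pairing_gword_of_length_ne (List.ofFn fun j => (Sum.inr (Y j) : 𝕏 ⊕ 𝕏)) _ (by simpa using hm)]
      simp
    · intro h; simp at h; omega
    · intro m _ hm
      refine Finset.sum_eq_zero fun m' _ => ?_
      simp only [smul_eq_zero, pow_eq_zero_iff', hκ']
      right
      refine Finset.sum_eq_zero fun X _ => Finset.sum_eq_zero fun Y _ => ?_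
      rw [pairing_gword_of_length_ne (List.ofFn fun j => (Sum.inl (X j) : 𝕏 ⊕ 𝕏)) _ (by simpa using hm)]
      simp
    · intro h; simp at h; omega

end FieldPolynomial

/-! ### Coefficients of single monomials. -/

section Norms

universe u

variable {𝕏 : Type u} [Fintype 𝕏] [DecidableEq 𝕏]

/-- The weighted family of words `l` with weights `a` has norm at most `N`: for each position and
each letter, the total weight of the words having this letter at this position is at most `N`. -/
def Spread {Ω α : Type*} [Fintype Ω] [DecidableEq α] (a : Ω → ℂ) (l : Ω → List α) (N : ℝ) : Prop :=
  ∀ (i : ℕ) (z : α), ∑ ω, (if (l ω)[i]? = some z then ‖a ω‖ else 0) ≤ N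

/-- A functional on Grassmann polynomials, without field-independent part, that is dominated by the
`h`-norm. -/
structure IsNormBounded (κ h : ℝ) (ℓ : Fields 𝕏 →ₗ[ℂ] ℂ) : Prop where
  map_one : ℓ 1 = 0
  bound : ∀ (Ω : Type u) [Fintype Ω] (a : Ω → ℂ) (l : Ω → List (𝕏 ⊕ 𝕏)) (t : List Bool) (N : ℝ),
    (∀ ω, (l ω).map Sum.isLeft = t) → t ≠ [] → 0 ≤ N → Spread a l (κ * N) →
      ‖∑ ω, a ω * ℓ (gword (l ω))‖ ≤ N * h ^ t.length

/-- The factorials of the pairings cancel those in `coeff`, except for the prescribed letter: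
antisymmetrization averages over the positions at which this letter may stand in the monomial. -/
theorem sum_coeff_slice_le {κ : ℝ} (hκ : 0 < κ) {mb m : ℕ} (i : Fin mb ⊕ Fin m) (x : 𝕏)
    (l : List (𝕏 ⊕ 𝕏)) (hl : (lefts l).length = mb) (hr : (rights l).length = m) :
    ∑ Z : Fin mb ⊕ Fin m → 𝕏 with Z i = x, ‖coeff κ (Z ∘ Sum.inl) (Z ∘ Sum.inr) (gword l)‖ ≤
      κ⁻¹ ^ (mb + m) * (Sum.elim (fun _ => (mb : ℝ)⁻¹ * l.countP fun w => w = Sum.inl x)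
        (fun _ => (m : ℝ)⁻¹ * l.countP fun w => w = Sum.inr x) i) := by
  obtain ⟨ε, hε, h⟩ := exists_gword_sort l
  have h0 : ∀ Z : Fin mb ⊕ Fin m → 𝕏, ‖coeff κ (Z ∘ Sum.inl) (Z ∘ Sum.inr) (gword l)‖ =
      ((mb ! : ℝ)⁻¹ * (m ! : ℝ)⁻¹) * κ⁻¹ ^ (mb + m) *
      (‖pairing (List.ofFn fun i => (Sum.inl (Z (Sum.inl i)) : 𝕏 ⊕ 𝕏))
          (gword ((lefts l).map Sum.inl))‖ *
        ‖pairing (List.ofFn fun j => (Sum.inr (Z (Sum.inr j)) : 𝕏 ⊕ 𝕏))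
          (gword ((rights l).map Sum.inr))‖) := by
    intro Z
    rw [h, map_smul, coeff_eq_pairing, norm_smul, hε, one_mul, norm_mul, ← norm_mul (pairing _ _)]
    simp only [Function.comp_apply]
    rw [pairing_sorted]
    congr 1
    simp [abs_of_pos hκ]
  simp only [h0]
  rw [← Finset.mul_sum, Finset.sum_filter, ← (Equiv.sumArrowEquivProdArrow _ _ _).symm.sum_comp,
    Fintype.sum_prod_type]
  have hmb : (0 : ℝ) < (mb ! : ℝ) := by exact_mod_cast Nat.factorial_pos _
  have hm : (0 : ℝ) < (m ! : ℝ) := by exact_mod_cast Nat.factorial_pos _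
  rcases i with i | i
  · have h1 := sum_norm_pairing_slice_le (Sum.inl_injective : Function.Injective
      (Sum.inl : 𝕏 → 𝕏 ⊕ 𝕏)) mb (lefts l) hl i x
    have h2 := sum_norm_pairing_le (Sum.inr_injective : Function.Injective
      (Sum.inr : 𝕏 → 𝕏 ⊕ 𝕏)) m (rights l) hr
    have h3 := mul_le_mul h1 h2 (Finset.sum_nonneg fun _ _ => norm_nonneg _) (by positivity)
    rw [Finset.sum_filter, Finset.sum_mul_sum] at h3
    simp only [ite_mul, zero_mul] at h3
    refine (mul_le_mul_of_nonneg_left h3 (by positivity)).trans (le_of_eq ?_)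
    have hmb0 : mb ≠ 0 := fun h => by subst h; exact i.elim0
    rw [count_lefts, ← Nat.mul_factorial_pred hmb0]
    have : (mb : ℝ) ≠ 0 := by exact_mod_cast hmb0
    have : ((mb - 1)! : ℝ) ≠ 0 := by exact_mod_cast Nat.factorial_ne_zero _
    push_cast
    simp only [Sum.elim_inl]
    field_simp
  · have h1 := sum_norm_pairing_slice_le (Sum.inr_injective : Function.Injective
      (Sum.inr : 𝕏 → 𝕏 ⊕ 𝕏)) m (rights l) hr i x
    have h2 := sum_norm_pairing_le (Sum.inl_injective : Function.Injective
      (Sum.inl : 𝕏 → 𝕏 ⊕ 𝕏)) mb (lefts l) hl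
    have h3 := mul_le_mul h2 h1 (Finset.sum_nonneg fun _ _ => norm_nonneg _) (by positivity)
    rw [Finset.sum_filter, Finset.sum_mul_sum] at h3
    simp only [mul_ite, mul_zero] at h3
    refine (mul_le_mul_of_nonneg_left h3 (by positivity)).trans (le_of_eq ?_)
    have hm0 : m ≠ 0 := fun h => by subst h; exact i.elim0
    rw [count_rights, ← Nat.mul_factorial_pred hm0]
    have : (m : ℝ) ≠ 0 := by exact_mod_cast hm0
    have : ((m - 1)! : ℝ) ≠ 0 := by exact_mod_cast Nat.factorial_ne_zero _
    push_cast
    simp only [Sum.elim_inr]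
    field_simp

theorem coeff_gword_of_ne (κ : ℝ) {mb m : ℕ} (X : Fin mb → 𝕏) (Y : Fin m → 𝕏) (l : List (𝕏 ⊕ 𝕏))
    (h : ¬((lefts l).length = mb ∧ (rights l).length = m)) : coeff κ X Y (gword l) = 0 := by
  obtain ⟨ε, -, hl⟩ := exists_gword_sort l
  rw [hl, map_smul, coeff_eq_pairing, pairing_sorted]
  by_cases h1 : (lefts l).length = mb
  · rw [pairing_gword_of_length_ne (List.ofFn fun j => (Sum.inr (Y j) : 𝕏 ⊕ 𝕏))]
    · simp
    · simp only [List.length_ofFn, List.length_map]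
      exact fun h2 => h ⟨h1, h2.symm⟩
  · rw [pairing_gword_of_length_ne (List.ofFn fun j => (Sum.inl (X j) : 𝕏 ⊕ 𝕏))]
    · simp
    · simp only [List.length_ofFn, List.length_map]
      exact fun h2 => h1 h2.symm

end Norms

/-! ### Duality: the `h`-norm as the value of a linear functional. -/

section NormFunctional

universe u

theorem countP_eq_sum_filter {α : Type*} [DecidableEq α] (z : α) (b : Bool) (p : α → Bool)
    (hz : p z = b) (l : List α) :
    ((l.countP fun w => w = z : ℕ) : ℝ) =
      ∑ j ∈ (Finset.range l.length).filter (fun j => (l.map p)[j]? = some b),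
        if l[j]? = some z then 1 else 0 := by
  rw [Finset.sum_filter]
  have h1 : ∀ j : ℕ, (if (l.map p)[j]? = some b then (if l[j]? = some z then (1 : ℝ) else 0) else 0) =
      if l[j]? = some z then 1 else 0 := by
    intro j
    split_ifs with h h' h' <;> try rfl
    rw [List.getElem?_map, h'] at h
    simp [hz] at h
  simp only [h1]
  induction l with
  | nil => simp
  | cons y l ih =>
    rw [List.length_cons, Finset.sum_range_succ', List.countP_cons]
    push_cast
    rw [ih]
    · simp
    · intro j
      have := h1 (j + 1)
      simpa using this

theorem card_filter_getElem? (t : List Bool) (b : Bool) :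
    ((Finset.range t.length).filter (fun j => t[j]? = some b)).card = t.count b := by
  induction t with
  | nil => simp
  | cons y l ih =>
    rw [Finset.card_filter, List.length_cons, Finset.sum_range_succ', List.count_cons, ← ih,
      Finset.card_filter]
    simp

/-- An average over the positions of the given kind is at most the worst position, and each position
is controlled by `Spread`. Hence antisymmetrization does not increase the norm of a family of
monomials. -/
theorem sum_norm_mul_countP_le {𝕏 : Type*} [DecidableEq 𝕏] {Ω : Type*} [Fintype Ω] (a : Ω → ℂ) (l : Ω → List (𝕏 ⊕ 𝕏))
    (t : List Bool) {N : ℝ} (ht : ∀ ω, (l ω).map Sum.isLeft = t) (hN : Spread a l N) (z : 𝕏 ⊕ 𝕏)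
    (n : ℕ) (hn : t.count z.isLeft = n) (hn0 : n ≠ 0) :
    ∑ ω, ‖a ω‖ * ((n : ℝ)⁻¹ * ((l ω).countP fun w => w = z : ℕ)) ≤ N := by
  have hl : ∀ ω, (l ω).length = t.length := fun ω => by rw [← ht ω, List.length_map]
  have hn1 : (0 : ℝ) < n := by exact_mod_cast Nat.pos_of_ne_zero hn0
  simp only [countP_eq_sum_filter z z.isLeft Sum.isLeft rfl, ht, hl, ← mul_assoc, mul_comm _ (n : ℝ)⁻¹]
  simp only [mul_assoc, ← Finset.mul_sum]
  rw [inv_mul_le_iff₀ hn1]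
  simp only [Finset.mul_sum]
  rw [Finset.sum_comm]
  refine (Finset.sum_le_card_nsmul _ _ N fun j _ => ?_).trans (le_of_eq ?_)
  · simpa using hN j z
  · rw [card_filter_getElem?, hn, nsmul_eq_mul]

variable {𝕏 : Type u} [Fintype 𝕏] [DecidableEq 𝕏]

/-- The sum of moduli becomes linear in the polynomial once the phases are frozen to those of the
coefficients of `W`. Families of monomials of any other bidegree are annihilated. -/
theorem exists_slice_functional {κ : ℝ} (hκ : 0 < κ) {mb m : ℕ} (hn : 1 ≤ mb + m)
    (i : Fin mb ⊕ Fin m) (x : 𝕏) (W : Fields 𝕏) :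
    ∃ ℓ : Fields 𝕏 →ₗ[ℂ] ℂ,
      ℓ W = ((κ ^ (mb + m - 1) * ∑ Z : Fin mb ⊕ Fin m → 𝕏 with Z i = x,
        ‖coeff κ (Z ∘ Sum.inl) (Z ∘ Sum.inr) W‖ : ℝ) : ℂ) ∧
      ∀ (Ω : Type u) [Fintype Ω] (a : Ω → ℂ) (l : Ω → List (𝕏 ⊕ 𝕏)) (t : List Bool) (N : ℝ),
        (∀ ω, (l ω).map Sum.isLeft = t) → Spread a l (κ * N) →
          ‖∑ ω, a ω * ℓ (gword (l ω))‖ ≤ if t.count true = mb ∧ t.count false = m then N else 0 := by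
  -- The phase `θ` is the conjugate of `c` divided by its modulus.
  have hθ : ∀ c : ℂ, ∃ θ : ℂ, ‖θ‖ ≤ 1 ∧ θ * c = ‖c‖ := by
    intro c
    by_cases hc : c = 0
    · exact ⟨0, by simp, by simp [hc]⟩
    · refine ⟨(starRingEnd ℂ) c / ‖c‖, ?_, ?_⟩
      · rw [norm_div, RCLike.norm_conj, Complex.norm_real, norm_norm, div_self (norm_ne_zero_iff.2 hc)]
      · have : (‖c‖ : ℂ) ≠ 0 := by exact_mod_cast norm_ne_zero_iff.2 hc
        rw [div_mul_eq_mul_div, Complex.conj_mul', pow_two, mul_div_assoc, div_self this, mul_one]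
  choose θ hθ1 hθ2 using hθ
  let ℓ : Fields 𝕏 →ₗ[ℂ] ℂ := (κ : ℂ) ^ (mb + m - 1) • ∑ Z : Fin mb ⊕ Fin m → 𝕏 with Z i = x,
    θ (coeff κ (Z ∘ Sum.inl) (Z ∘ Sum.inr) W) • coeff κ (Z ∘ Sum.inl) (Z ∘ Sum.inr)
  have hℓ : ∀ V, ℓ V = (κ : ℂ) ^ (mb + m - 1) * ∑ Z : Fin mb ⊕ Fin m → 𝕏 with Z i = x,
      θ (coeff κ (Z ∘ Sum.inl) (Z ∘ Sum.inr) W) * coeff κ (Z ∘ Sum.inl) (Z ∘ Sum.inr) V := by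
    intro V
    simp [ℓ, LinearMap.sum_apply]
  refine ⟨ℓ, ?_, ?_⟩
  · rw [hℓ]
    simp only [hθ2]
    push_cast
    rfl
  · intro Ω _ a l t N ht hN
    have hle : ∀ ω, ‖ℓ (gword (l ω))‖ ≤ κ ^ (mb + m - 1) *
        ∑ Z : Fin mb ⊕ Fin m → 𝕏 with Z i = x,
          ‖coeff κ (Z ∘ Sum.inl) (Z ∘ Sum.inr) (gword (l ω))‖ := by
      intro ω
      rw [hℓ, norm_mul, norm_pow, Complex.norm_real, Real.norm_of_nonneg hκ.le]
      refine mul_le_mul_of_nonneg_left ?_ (by positivity)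
      refine (norm_sum_le _ _).trans (Finset.sum_le_sum fun Z _ => ?_)
      rw [norm_mul]
      exact mul_le_of_le_one_left (norm_nonneg _) (hθ1 _)
    have hL : ∀ ω, (lefts (l ω)).length = t.count true := fun ω => by rw [length_lefts, ht]
    have hR : ∀ ω, (rights (l ω)).length = t.count false := fun ω => by rw [length_rights, ht]
    split_ifs with h
    · have h1 : ∀ ω, ‖a ω * ℓ (gword (l ω))‖ ≤ κ⁻¹ * (‖a ω‖ *
          (Sum.elim (fun _ => (mb : ℝ)⁻¹ * ((l ω).countP fun w => w = Sum.inl x : ℕ))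
          (fun _ => (m : ℝ)⁻¹ * ((l ω).countP fun w => w = Sum.inr x : ℕ)) i)) := by
        intro ω
        rw [norm_mul, mul_left_comm]
        refine mul_le_mul_of_nonneg_left ((hle ω).trans ?_) (norm_nonneg _)
        refine (mul_le_mul_of_nonneg_left (sum_coeff_slice_le hκ i x (l ω) ((hL ω).trans h.1)
          ((hR ω).trans h.2)) (by positivity)).trans (le_of_eq ?_)
        obtain ⟨k, hk⟩ := Nat.exists_eq_add_of_le hn
        rw [hk, ← mul_assoc, Nat.add_sub_cancel_left, pow_add, pow_one, mul_left_comm, ← mul_pow,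
          mul_inv_cancel₀ hκ.ne', one_pow, mul_one]
      refine (norm_sum_le _ _).trans ((Finset.sum_le_sum fun ω _ => h1 ω).trans ?_)
      rw [← Finset.mul_sum, inv_mul_le_iff₀ hκ]
      rcases i with i | i
      · exact sum_norm_mul_countP_le a l t ht hN (Sum.inl x) mb h.1
          (fun h => by subst h; exact i.elim0)
      · exact sum_norm_mul_countP_le a l t ht hN (Sum.inr x) m h.2
          (fun h => by subst h; exact i.elim0)
    · have h0 : ∀ ω, ℓ (gword (l ω)) = 0 := fun ω => by
        rw [hℓ, Finset.sum_eq_zero, mul_zero]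
        intro Z _
        rw [coeff_gword_of_ne, mul_zero]
        rw [hL, hR]; exact h
      simp [h0]

theorem kernelNorm_nonneg {κ : ℝ} (hκ : 0 ≤ κ) {mb m : ℕ} (v : (Fin mb → 𝕏) → (Fin m → 𝕏) → ℂ) :
    0 ≤ kernelNorm κ v :=
  Real.iSup_nonneg fun _ => Real.iSup_nonneg fun _ => by positivity

theorem slice_le_kernelNorm {κ : ℝ} {mb m : ℕ} (v : (Fin mb → 𝕏) → (Fin m → 𝕏) → ℂ)
    (i : Fin mb ⊕ Fin m) (x : 𝕏) :
    κ ^ (mb + m - 1) * ∑ Z : Fin mb ⊕ Fin m → 𝕏 with Z i = x,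
      ‖v (Z ∘ Sum.inl) (Z ∘ Sum.inr)‖ ≤ kernelNorm κ v :=
  (le_ciSup (f := fun x => κ ^ (mb + m - 1) * ∑ Z : Fin mb ⊕ Fin m → 𝕏 with Z i = x,
    ‖v (Z ∘ Sum.inl) (Z ∘ Sum.inr)‖) (Set.finite_range _).bddAbove x).trans
    (le_ciSup (f := fun i => ⨆ x, κ ^ (mb + m - 1) * ∑ Z : Fin mb ⊕ Fin m → 𝕏 with Z i = x,
      ‖v (Z ∘ Sum.inl) (Z ∘ Sum.inr)‖) (Set.finite_range _).bddAbove i)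

theorem exists_kernelNorm_eq (κ : ℝ) [Nonempty 𝕏] {mb m : ℕ} (hn : 1 ≤ mb + m)
    (v : (Fin mb → 𝕏) → (Fin m → 𝕏) → ℂ) :
    ∃ (i : Fin mb ⊕ Fin m) (x : 𝕏), kernelNorm κ v =
      κ ^ (mb + m - 1) * ∑ Z : Fin mb ⊕ Fin m → 𝕏 with Z i = x,
        ‖v (Z ∘ Sum.inl) (Z ∘ Sum.inr)‖ := by
  have : Nonempty (Fin mb ⊕ Fin m) := by
    rcases Nat.eq_zero_or_pos mb with h | h
    · exact ⟨Sum.inr ⟨0, by omega⟩⟩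
    · exact ⟨Sum.inl ⟨0, h⟩⟩
  obtain ⟨i, hi⟩ := exists_eq_ciSup_of_finite (f := fun i : Fin mb ⊕ Fin m => ⨆ x,
    κ ^ (mb + m - 1) * ∑ Z : Fin mb ⊕ Fin m → 𝕏 with Z i = x, ‖v (Z ∘ Sum.inl) (Z ∘ Sum.inr)‖)
  obtain ⟨x, hx⟩ := exists_eq_ciSup_of_finite (f := fun x : 𝕏 =>
    κ ^ (mb + m - 1) * ∑ Z : Fin mb ⊕ Fin m → 𝕏 with Z i = x, ‖v (Z ∘ Sum.inl) (Z ∘ Sum.inr)‖)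
  exact ⟨i, x, by rw [kernelNorm, ← hi, ← hx]⟩

theorem hNorm_nonneg {κ h : ℝ} (hκ : 0 ≤ κ) (hh : 0 ≤ h) (V : Fields 𝕏) : 0 ≤ hNorm κ h V := by
  refine Finset.sum_nonneg fun mb _ => Finset.sum_nonneg fun m _ => ?_
  split_ifs
  · exact mul_nonneg (kernelNorm_nonneg hκ _) (by positivity)
  · exact le_rfl

/-- The `h`-norm of a Grassmann polynomial is the value of a norm-bounded functional. -/
theorem exists_isNormBounded {κ h : ℝ} (hκ : 0 < κ) (hh : 0 ≤ h) (W : Fields 𝕏) :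
    ∃ ℓ : Fields 𝕏 →ₗ[ℂ] ℂ, ℓ W = (hNorm κ h W : ℂ) ∧ IsNormBounded κ h ℓ := by
  cases isEmpty_or_nonempty 𝕏 with
  | inl hX =>
    refine ⟨0, ?_, ⟨by simp, ?_⟩⟩
    · have : hNorm κ h W = 0 := by
        simp [hNorm, kernelNorm]
      simp [this]
    · intro Ω _ a l t N ht ht0 hN0 hN
      simp only [LinearMap.zero_apply, mul_zero, Finset.sum_const_zero, norm_zero]
      positivity
  | inr hX =>
    have h1 : ∀ mb m : ℕ, ∃ ℓ : Fields 𝕏 →ₗ[ℂ] ℂ, 1 ≤ mb + m →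
        ℓ W = (kernelNorm κ (fun (X : Fin mb → 𝕏) (Y : Fin m → 𝕏) => coeff κ X Y W) : ℂ) ∧
        ∀ (Ω : Type u) [Fintype Ω] (a : Ω → ℂ) (l : Ω → List (𝕏 ⊕ 𝕏)) (t : List Bool) (N : ℝ),
        (∀ ω, (l ω).map Sum.isLeft = t) → Spread a l (κ * N) →
          ‖∑ ω, a ω * ℓ (gword (l ω))‖ ≤
            if t.count true = mb ∧ t.count false = m then N else 0 := by
      intro mb m
      by_cases hn : 1 ≤ mb + m
      · obtain ⟨i, x, hix⟩ := exists_kernelNorm_eq κ hn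
          fun (X : Fin mb → 𝕏) (Y : Fin m → 𝕏) => coeff κ X Y W
        obtain ⟨ℓ, hℓ⟩ := exists_slice_functional hκ hn i x W
        exact ⟨ℓ, fun _ => by rw [hix]; exact hℓ⟩
      · exact ⟨0, fun h => absurd h hn⟩
    choose ℓ hℓ using h1
    refine ⟨∑ mb ∈ Finset.range (Fintype.card 𝕏 + 1), ∑ m ∈ Finset.range (Fintype.card 𝕏 + 1),
      if 1 ≤ mb + m then ((h : ℂ) ^ (mb + m)) • ℓ mb m else 0, ?_, ⟨?_, ?_⟩⟩
    · simp only [LinearMap.sum_apply, hNorm]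
      push_cast
      refine Finset.sum_congr rfl fun mb _ => Finset.sum_congr rfl fun m _ => ?_
      split_ifs with hn
      · rw [LinearMap.smul_apply, (hℓ mb m hn).1, smul_eq_mul, mul_comm]
        push_cast
        rfl
      · simp
    · simp only [LinearMap.sum_apply]
      refine Finset.sum_eq_zero fun mb _ => Finset.sum_eq_zero fun m _ => ?_
      split_ifs with hn
      -- The constant `1` is the empty monomial. It has no letters, so its spread is trivial, and
      -- its bidegree differs from `(mb, m)`.
      · have := (hℓ mb m hn).2 PUnit (fun _ => 1) (fun _ => []) [] κ⁻¹ (by simp)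
          (fun i z => by simp [hκ.ne'])
        rw [if_neg (by simp; omega)] at this
        have h2 : ℓ mb m 1 = 0 := by simpa using this
        rw [LinearMap.smul_apply, h2, smul_zero]
      · simp
    · intro Ω _ a l t N ht ht0 hN0 hN
      have hlen : t.length = t.count true + t.count false := by
        rw [List.count_true_add_count_false]
      -- A family with the pattern `t` is seen in one bidegree only, so the sum over bidegrees in
      -- the norm costs nothing.
      have h2 : ∀ mb m, ‖∑ ω, a ω * ((if 1 ≤ mb + m then ((h : ℂ) ^ (mb + m)) • ℓ mb m else 0 :
          Fields 𝕏 →ₗ[ℂ] ℂ) (gword (l ω)))‖ ≤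
          if mb = t.count true then (if m = t.count false then N * h ^ t.length else 0) else 0 := by
        intro mb m
        by_cases hn : 1 ≤ mb + m
        · simp only [if_pos hn, LinearMap.smul_apply, smul_eq_mul, mul_left_comm (a _)]
          rw [← Finset.mul_sum, norm_mul, norm_pow, Complex.norm_real, Real.norm_of_nonneg hh]
          refine (mul_le_mul_of_nonneg_left ((hℓ mb m hn).2 Ω a l t N ht hN) (by positivity)).trans
            (le_of_eq ?_)
          by_cases h3 : t.count true = mb
          · by_cases h4 : t.count false = m
            · rw [if_pos ⟨h3, h4⟩, if_pos h3.symm, if_pos h4.symm, hlen, h3, h4, mul_comm]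
            · rw [if_neg (fun h => h4 h.2), if_pos h3.symm, if_neg (Ne.symm h4), mul_zero]
          · rw [if_neg (fun h => h3 h.1), if_neg (Ne.symm h3), mul_zero]
        · have : t.length ≠ 0 := by simpa using ht0
          simp only [if_neg hn, LinearMap.zero_apply, mul_zero, Finset.sum_const_zero, norm_zero]
          split_ifs with h3 h4
          · omega
          · exact le_rfl
          · exact le_rfl
      simp only [LinearMap.sum_apply, Finset.mul_sum]
      rw [Finset.sum_comm]
      refine (norm_sum_le _ _).trans ((Finset.sum_le_sum
        (g := fun mb => ∑ m ∈ Finset.range (Fintype.card 𝕏 + 1),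
          if mb = t.count true then (if m = t.count false then N * h ^ t.length else 0) else 0)
        fun mb _ => ?_).trans ?_)
      · rw [Finset.sum_comm]
        exact (norm_sum_le _ _).trans (Finset.sum_le_sum fun m _ => h2 mb m)
      · have h3 : 0 ≤ N * h ^ t.length := by positivity
        have h4 : ∀ mb : ℕ, (∑ m ∈ Finset.range (Fintype.card 𝕏 + 1), if mb = t.count true then
            (if m = t.count false then N * h ^ t.length else 0) else 0) =
            if mb = t.count true then (∑ m ∈ Finset.range (Fintype.card 𝕏 + 1),
              if m = t.count false then N * h ^ t.length else 0) else 0 := by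
          intro mb
          split_ifs
          · rfl
          · simp
        simp only [h4, Finset.sum_ite_eq']
        split_ifs
        · exact le_rfl
        · exact h3
        · exact h3

end NormFunctional

/-! ### Replicas of the fields and normalized expectations as power series in `λ`. -/

section Replicas

variable {𝕏 : Type*}

/-- The space of generators of countably many replicas of the fields. -/
abbrev Replicas (𝕏 : Type*) : Type _ := (ℕ × (𝕏 ⊕ 𝕏)) →₀ ℂ

/-- The covariance of the replicas: fields of the replicas `a` and `b` have covariance
`S a b • C`. -/
def replicaForm (C : 𝕏 → 𝕏 → ℂ) (S : ℕ → ℕ → ℝ) : LinearMap.BilinForm ℂ (Replicas 𝕏) :=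
  Finsupp.linearCombination ℂ fun p => Finsupp.linearCombination ℂ fun q =>
    (S p.1 q.1 : ℂ) * cov C p.2 q.2

theorem replicaForm_single (C : 𝕏 → 𝕏 → ℂ) (S : ℕ → ℕ → ℝ) (p q : ℕ × (𝕏 ⊕ 𝕏)) :
    replicaForm C S (Finsupp.single p 1) (Finsupp.single q 1) =
      (S p.1 q.1 : ℂ) * cov C p.2 q.2 := by
  simp [replicaForm]

theorem replicaForm_ext {A B : LinearMap.BilinForm ℂ (Replicas 𝕏)}
    (h : ∀ p q, A (Finsupp.single p 1) (Finsupp.single q 1) =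
      B (Finsupp.single p 1) (Finsupp.single q 1)) : A = B := by
  refine Finsupp.lhom_ext' fun p => LinearMap.ext_ring ?_
  refine Finsupp.lhom_ext' fun q => LinearMap.ext_ring ?_
  simpa using h p q

theorem replicaForm_isAlt (C : 𝕏 → 𝕏 → ℂ) {S : ℕ → ℕ → ℝ} (hS : ∀ a b, S a b = S b a) :
    (replicaForm C S).IsAlt := by
  have h : replicaForm C S = -(replicaForm C S).flip := by
    refine replicaForm_ext fun p q => ?_
    rw [LinearMap.neg_apply, LinearMap.neg_apply, LinearMap.BilinForm.flip_apply, replicaForm_single,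
      replicaForm_single, cov_swap, hS]
    ring
  intro x
  have h1 := congrArg (fun A : LinearMap.BilinForm ℂ (Replicas 𝕏) => A x x) h
  simpa [self_eq_neg] using h1

theorem replicaForm_add_smul (C : 𝕏 → 𝕏 → ℂ) (S S' : ℕ → ℕ → ℝ) (s : ℝ) :
    replicaForm C (fun a b => S a b + s * S' a b) =
      replicaForm C S + (s : ℂ) • replicaForm C S' := by
  refine replicaForm_ext fun p q => ?_
  simp only [LinearMap.add_apply, LinearMap.smul_apply, replicaForm_single, smul_eq_mul]
  push_cast
  ring

/-- The identification of all replicas with labels at least `k`. -/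
def glue (k : ℕ) : Replicas 𝕏 →ₗ[ℂ] Replicas 𝕏 :=
  Finsupp.linearCombination ℂ fun p => Finsupp.single (min p.1 k, p.2) (1 : ℂ)

theorem glue_single (k : ℕ) (p : ℕ × (𝕏 ⊕ 𝕏)) :
    glue k (Finsupp.single p (1 : ℂ)) = Finsupp.single (min p.1 k, p.2) (1 : ℂ) := by
  simp [glue]

theorem replicas_ext {N : Type*} [AddCommMonoid N] [Module ℂ N] {f g : Replicas 𝕏 →ₗ[ℂ] N}
    (h : ∀ p, f (Finsupp.single p 1) = g (Finsupp.single p 1)) : f = g :=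
  Finsupp.lhom_ext' fun p => LinearMap.ext_ring (by simpa using h p)

theorem replicaForm_compl₁₂_glue (C : 𝕏 → 𝕏 → ℂ) {S : ℕ → ℕ → ℝ} {k : ℕ}
    (hS : ∀ a b, S (min a k) (min b k) = S a b) :
    (replicaForm C S).compl₁₂ (glue k) (glue k) = replicaForm C S :=
  replicaForm_ext fun p q => by
    simp [glue_single, replicaForm_single, hS]

/-- The product of the replica fields with the given labels. -/
def replicaWord (l : List (ℕ × (𝕏 ⊕ 𝕏))) : ExteriorAlgebra ℂ (Replicas 𝕏) :=
  word (l.map fun p => Finsupp.single p 1)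

theorem map_glue_replicaWord {k : ℕ} (l : List (ℕ × (𝕏 ⊕ 𝕏))) (hl : ∀ p ∈ l, p.1 ≤ k) :
    ExteriorAlgebra.map (glue k) (replicaWord l) = replicaWord l := by
  rw [replicaWord, map_word, List.map_map]
  congr 1
  refine List.map_congr_left fun p hp => ?_
  simp [glue_single, hl p hp]

/-- The matrix `S` with the entries between the labels up to `k` and the labels beyond `k`
multiplied by `s`. -/
def cut (k : ℕ) (S : ℕ → ℕ → ℝ) (s : ℝ) (a b : ℕ) : ℝ :=
  if a ≤ k ↔ b ≤ k then S a b else s * S a b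

theorem replicaForm_cut (C : 𝕏 → 𝕏 → ℂ) (k : ℕ) (S : ℕ → ℕ → ℝ) (s : ℝ) :
    replicaForm C (cut k S s) = replicaForm C (cut k S 0) +
      (s : ℂ) • replicaForm C (fun a b => if a ≤ k ↔ b ≤ k then 0 else S a b) := by
  rw [← replicaForm_add_smul]
  congr 1
  ext a b
  simp only [cut]
  split_ifs <;> simp

variable [DecidableEq 𝕏]

/-- The identification of all replicas. -/
def collapse : Replicas 𝕏 →ₗ[ℂ] (𝕏 ⊕ 𝕏 → ℂ) :=
  Finsupp.linearCombination ℂ fun p => Pi.single p.2 (1 : ℂ)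

theorem collapse_single (p : ℕ × (𝕏 ⊕ 𝕏)) :
    collapse (Finsupp.single p (1 : ℂ)) = Pi.single p.2 (1 : ℂ) := by
  simp [collapse]

theorem collapse_comp_glue (k : ℕ) :
    (collapse ∘ₗ glue k : Replicas 𝕏 →ₗ[ℂ] (𝕏 ⊕ 𝕏 → ℂ)) = collapse :=
  replicas_ext fun p => by simp [glue_single, collapse_single]

theorem map_collapse_glue (k : ℕ) (x : ExteriorAlgebra ℂ (Replicas 𝕏)) :
    ExteriorAlgebra.map collapse (ExteriorAlgebra.map (glue k) x) =
      ExteriorAlgebra.map collapse x := by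
  rw [← AlgHom.comp_apply, ExteriorAlgebra.map_comp_map, collapse_comp_glue]

variable [Fintype 𝕏]

/-- The inclusion of the fields as the replica `j`. -/
def replicate (j : ℕ) : (𝕏 ⊕ 𝕏 → ℂ) →ₗ[ℂ] Replicas 𝕏 :=
  ∑ z, (LinearMap.proj z).smulRight (Finsupp.single (j, z) (1 : ℂ))

theorem replicate_single (j : ℕ) (z : 𝕏 ⊕ 𝕏) :
    replicate j (Pi.single z (1 : ℂ)) = Finsupp.single (j, z) 1 := by
  rw [replicate, LinearMap.sum_apply, Finset.sum_eq_single z]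
  · simp
  · intro w _ hw
    simp [Pi.single_eq_of_ne hw]
  · simp

theorem fields_ext {N : Type*} [AddCommMonoid N] [Module ℂ N] {f g : (𝕏 ⊕ 𝕏 → ℂ) →ₗ[ℂ] N}
    (h : ∀ z, f (Pi.single z 1) = g (Pi.single z 1)) : f = g :=
  LinearMap.pi_ext' fun z => LinearMap.ext_ring (by simpa using h z)

theorem collapse_comp_replicate (j : ℕ) :
    (collapse ∘ₗ replicate j : (𝕏 ⊕ 𝕏 → ℂ) →ₗ[ℂ] (𝕏 ⊕ 𝕏 → ℂ)) = LinearMap.id :=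
  fields_ext fun z => by simp [replicate_single, collapse_single]

theorem glue_comp_replicate (k j : ℕ) :
    (glue k ∘ₗ replicate j : (𝕏 ⊕ 𝕏 → ℂ) →ₗ[ℂ] Replicas 𝕏) = replicate (min j k) :=
  fields_ext fun z => by simp [replicate_single, glue_single]

theorem replicaForm_apply_comp_replicate (C : 𝕏 → 𝕏 → ℂ) (S : ℕ → ℕ → ℝ) (p : ℕ × (𝕏 ⊕ 𝕏))
    (j : ℕ) : (replicaForm C S (Finsupp.single p 1)) ∘ₗ replicate j =
      (S p.1 j : ℂ) • covForm C (Pi.single p.2 1) :=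
  fields_ext fun z => by
    simp [replicate_single, replicaForm_single]

theorem replicaForm_compl₁₂_replicate (C : 𝕏 → 𝕏 → ℂ) (S : ℕ → ℕ → ℝ) (j : ℕ) :
    (replicaForm C S).compl₁₂ (replicate j) (replicate j) = (S j j : ℂ) • covForm C :=
  fields_ext fun z => fields_ext fun w => by
    simp [replicate_single, replicaForm_single]

theorem covForm_compl₁₂_collapse (C : 𝕏 → 𝕏 → ℂ) :
    (covForm C).compl₁₂ collapse collapse = replicaForm C fun _ _ => 1 :=
  replicaForm_ext fun p q => by
    simp [collapse_single, replicaForm_single]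

theorem map_replicate_gword (j : ℕ) (l : List (𝕏 ⊕ 𝕏)) :
    ExteriorAlgebra.map (replicate j) (gword l) = replicaWord (l.map fun z => (j, z)) := by
  rw [gword, map_word, replicaWord, List.map_map, List.map_map]
  congr 2
  ext1 z
  exact replicate_single j z

theorem map_collapse_replicate (j : ℕ) (x : Fields 𝕏) :
    ExteriorAlgebra.map collapse (ExteriorAlgebra.map (replicate j) x) = x := by
  rw [← AlgHom.comp_apply, ExteriorAlgebra.map_comp_map, collapse_comp_replicate,
    ExteriorAlgebra.map_id, AlgHom.id_apply]

theorem map_glue_replicate (k j : ℕ) (x : Fields 𝕏) :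
    ExteriorAlgebra.map (glue k) (ExteriorAlgebra.map (replicate j) x) =
      ExteriorAlgebra.map (replicate (min j k)) x := by
  rw [← AlgHom.comp_apply, ExteriorAlgebra.map_comp_map, glue_comp_replicate]

/-! ### The expansion coefficients -/

/-- The coefficients of `λ` in `μ_C * exp (λ V)`. -/
def momentSeries (C : 𝕏 → 𝕏 → ℂ) (V : Fields 𝕏) : PowerSeries (Fields 𝕏) :=
  PowerSeries.mk fun n => wick (covForm C) ((n ! : ℂ)⁻¹ • V ^ n)

theorem constantCoeff_momentSeries (C : 𝕏 → 𝕏 → ℂ) (V : Fields 𝕏) :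
    PowerSeries.constantCoeff (momentSeries C V) = ((1 : (Fields 𝕏)ˣ) : Fields 𝕏) := by
  rw [← PowerSeries.coeff_zero_eq_constantCoeff_apply, momentSeries, PowerSeries.coeff_mk]
  simp [wick_one (covForm_isAlt C)]

/-- The coefficients of `λ` in `1 / μ_C * exp (λ V)`. -/
def momentInv (C : 𝕏 → 𝕏 → ℂ) (V : Fields 𝕏) : PowerSeries (Fields 𝕏) :=
  PowerSeries.invOfUnit (momentSeries C V) 1

theorem momentSeries_mul_inv (C : 𝕏 → 𝕏 → ℂ) (V : Fields 𝕏) :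
    momentSeries C V * momentInv C V = 1 :=
  PowerSeries.mul_invOfUnit _ _ (constantCoeff_momentSeries C V)

theorem momentInv_mul_series (C : 𝕏 → 𝕏 → ℂ) (V : Fields 𝕏) :
    momentInv C V * momentSeries C V = 1 :=
  PowerSeries.invOfUnit_mul _ _ (constantCoeff_momentSeries C V)

theorem coeff_zero_momentInv (C : 𝕏 → 𝕏 → ℂ) (V : Fields 𝕏) :
    PowerSeries.coeff 0 (momentInv C V) = 1 := by
  rw [PowerSeries.coeff_zero_eq_constantCoeff_apply, momentInv,
    PowerSeries.constantCoeff_invOfUnit]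
  simp

/-- The Gaussian integral of `F exp (λ V)`, where `V` depends on the replica `k`. -/
def insertionSeries (C : 𝕏 → 𝕏 → ℂ) (V : Fields 𝕏) (S : ℕ → ℕ → ℝ) (k : ℕ)
    (F : ExteriorAlgebra ℂ (Replicas 𝕏)) : PowerSeries (Fields 𝕏) :=
  PowerSeries.mk fun q => ExteriorAlgebra.map collapse
    (wick (replicaForm C S) (F * ExteriorAlgebra.map (replicate k) ((q ! : ℂ)⁻¹ • V ^ q)))

/-- The coefficients of the normalized Gaussian integral of `F exp (λ V)`. -/
def expectation (C : 𝕏 → 𝕏 → ℂ) (V : Fields 𝕏) (S : ℕ → ℕ → ℝ) (k n : ℕ) :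
    ExteriorAlgebra ℂ (Replicas 𝕏) →ₗ[ℂ] Fields 𝕏 where
  toFun F := PowerSeries.coeff n (insertionSeries C V S k F * momentInv C V)
  map_add' F G := by
    simp [PowerSeries.coeff_mul, insertionSeries, add_mul, Finset.sum_add_distrib]
  map_smul' c F := by
    simp only [PowerSeries.coeff_mul, insertionSeries, Finset.smul_sum, PowerSeries.coeff_mk,
      smul_mul_assoc, map_smul, RingHom.id_apply]

theorem expectation_apply (C : 𝕏 → 𝕏 → ℂ) (V : Fields 𝕏) (S : ℕ → ℕ → ℝ) (k n : ℕ)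
    (F : ExteriorAlgebra ℂ (Replicas 𝕏)) : expectation C V S k n F =
      PowerSeries.coeff n (insertionSeries C V S k F * momentInv C V) := rfl

theorem expectation_zero (C : 𝕏 → 𝕏 → ℂ) (V : Fields 𝕏) (S : ℕ → ℕ → ℝ) (k : ℕ)
    (F : ExteriorAlgebra ℂ (Replicas 𝕏)) : expectation C V S k 0 F =
      ExteriorAlgebra.map collapse (wick (replicaForm C S) F) := by
  rw [expectation_apply, PowerSeries.coeff_mul]
  simp [insertionSeries, coeff_zero_momentInv]

/-- For such `S` the labels from `k` on are indistinguishable, so the exponential may be moved to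
any replica beyond `k`. This supplies a fresh replica for the next interpolation. -/
theorem expectation_glue (C : 𝕏 → 𝕏 → ℂ) (V : Fields 𝕏) {S : ℕ → ℕ → ℝ}
    (hsymm : ∀ a b, S a b = S b a) {k : ℕ} (hS : ∀ a b, S (min a k) (min b k) = S a b) (n : ℕ)
    (F : ExteriorAlgebra ℂ (Replicas 𝕏)) (hF : ExteriorAlgebra.map (glue k) F = F) {j : ℕ}
    (hj : k ≤ j) : expectation C V S j n F = expectation C V S k n F := by
  rw [expectation_apply, expectation_apply]
  congr 2
  ext1 q
  simp only [insertionSeries, PowerSeries.coeff_mk]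
  have h := map_glue_replicate k j ((q ! : ℂ)⁻¹ • V ^ q)
  rw [min_eq_right hj] at h
  rw [← h]
  nth_rw 2 [← hF]
  rw [← map_mul, wick_map (replicaForm_isAlt C hsymm), replicaForm_compl₁₂_glue C hS,
    map_collapse_glue]

/-- When the word is uncoupled from the replica of the exponential, the integral is the integral of
the word times `μ_C * e^{λV}`. The denominator cancels the second factor, and nothing of positive
order in `λ` is left. -/
theorem expectation_eq_zero (C : 𝕏 → 𝕏 → ℂ) (V : Fields 𝕏) {S : ℕ → ℕ → ℝ}
    (hsymm : ∀ a b, S a b = S b a) {j : ℕ} (hj : S j j = 1) (l : List (ℕ × (𝕏 ⊕ 𝕏)))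
    (hl : ∀ p ∈ l, S p.1 j = 0) (n : ℕ) :
    expectation C V S j (n + 1) (replicaWord l) = 0 := by
  have hA := replicaForm_isAlt C hsymm
  have h : insertionSeries C V S j (replicaWord l) =
      PowerSeries.C (ExteriorAlgebra.map collapse (wick (replicaForm C S) (replicaWord l))) *
        momentSeries C V := by
    ext1 q
    simp only [insertionSeries, PowerSeries.coeff_mk, momentSeries, PowerSeries.coeff_C_mul]
    rw [replicaWord, wick_word_mul_of_contr_eq_zero hA, map_mul, wick_map hA,
      replicaForm_compl₁₂_replicate, hj, Complex.ofReal_one, one_smul, map_collapse_replicate]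
    intro m hm
    obtain ⟨p, hp, rfl⟩ := List.mem_map.1 hm
    rw [← wick_contr hA, contr_map, replicaForm_apply_comp_replicate, hl p hp]
    simp
  rw [expectation_apply, h, mul_assoc, momentSeries_mul_inv, mul_one]
  simp

/-- The parameter couples the letters of the word to the exponential. Differentiation contracts one
letter with `e^{λV}`, which brings down a derivative of `λV`: the order in `λ` drops by one and the
word acquires the other letters of a new `V`. -/
theorem hasDerivAt_expectation (C : 𝕏 → 𝕏 → ℂ) {V : Fields 𝕏} (hV : parity V = V)
    {S : ℕ → ℕ → ℝ} (hsymm : ∀ a b, S a b = S b a) (k n : ℕ) (l : List (ℕ × (𝕏 ⊕ 𝕏)))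
    (hl : ∀ p ∈ l, p.1 ≤ k) (T : Fields 𝕏 →ₗ[ℂ] ℂ) (s : ℝ) :
    HasDerivAt (fun s : ℝ => T (expectation C V (cut k S s) (k + 1) (n + 1) (replicaWord l)))
      (∑ i : Fin l.length, (-1 : ℂ) ^ (l.length - 1 - i) * ((S l[(i : ℕ)].1 (k + 1) : ℂ) *
        T (expectation C V (cut k S s) (k + 1) n (replicaWord (l.eraseIdx i) *
          ExteriorAlgebra.map (replicate (k + 1))
            (contr (covForm C (Pi.single l[(i : ℕ)].2 1)) V))))) s := by
  have hsymm' : ∀ a b, cut k S 0 a b = cut k S 0 b a := fun a b => by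
    simp only [cut]
    rw [hsymm a b]
    exact if_congr Iff.comm rfl rfl
  set S1 : ℕ → ℕ → ℝ := fun a b => if a ≤ k ↔ b ≤ k then 0 else S a b with hS1
  have hsymm1 : ∀ a b, S1 a b = S1 b a := fun a b => by
    simp only [hS1]
    rw [hsymm a b]
    exact if_congr Iff.comm rfl rfl
  obtain ⟨A, hA0⟩ : ∃ A, A = replicaForm C (cut k S 0) := ⟨_, rfl⟩
  have hcut : ∀ s : ℝ, replicaForm C (cut k S s) = A + (s : ℂ) • replicaForm C S1 := fun s => by
    rw [replicaForm_cut, hA0]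
  have hA : A.IsAlt := hA0 ▸ replicaForm_isAlt C hsymm'
  have hB := replicaForm_isAlt C hsymm1
  simp only [expectation_apply, PowerSeries.coeff_mul, insertionSeries, PowerSeries.coeff_mk,
    hcut, map_sum]
  have key : ∀ (W : Fields 𝕏) (r : ℕ), HasDerivAt (fun s : ℝ => T (ExteriorAlgebra.map collapse
      (wick (A + (s : ℂ) • replicaForm C S1) (replicaWord l *
        ExteriorAlgebra.map (replicate (k + 1)) W)) *
          PowerSeries.coeff r (momentInv C V)))
      (∑ i : Fin l.length, (-1 : ℂ) ^ (l.length - 1 - i) * T (ExteriorAlgebra.map collapse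
        (wick (A + (s : ℂ) • replicaForm C S1)
          (replicaWord (l.eraseIdx i) * ExteriorAlgebra.map (replicate (k + 1))
            ((S l[(i : ℕ)].1 (k + 1) : ℂ) • contr (covForm C (Pi.single l[(i : ℕ)].2 1))
              W))) * PowerSeries.coeff r (momentInv C V))) s := by
    intro W r
    have h := hasDerivAt_wick_word_mul hA hB
      (ExteriorAlgebra.map (replicate (k + 1)) W) ?_ s
      (l.map fun p => Finsupp.single p 1) ?_
      (T ∘ₗ LinearMap.mulRight ℂ (PowerSeries.coeff r (momentInv C V)) ∘ₗ
        (ExteriorAlgebra.map (collapse (𝕏 := 𝕏))).toLinearMap)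
    · refine h.congr_deriv ?_
      rw [← Fin.sum_congr' _ (List.length_map (as := l)
        fun p : ℕ × (𝕏 ⊕ 𝕏) => Finsupp.single p (1 : ℂ)).symm]
      refine Finset.sum_congr rfl fun i _ => ?_
      simp only [List.length_map, Fin.val_cast, List.getElem_map, List.eraseIdx_map,
        LinearMap.comp_apply, LinearMap.mulRight_apply, AlgHom.toLinearMap_apply, contr_map,
        replicaForm_apply_comp_replicate, replicaWord, hS1, hl _ (List.getElem_mem _)]
      simp
    · intro s
      have hs : (A + (s : ℂ) • replicaForm C S1).IsAlt := fun x => by simp [hA x, hB x]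
      rw [wick_map hs, wick_map hA]
      congr 3
      -- The exponential lives in the single replica `k + 1`, whose covariance with itself does not
      -- involve the parameter.
      rw [← hcut, hA0, replicaForm_compl₁₂_replicate, replicaForm_compl₁₂_replicate]
      simp [cut]
    · intro m hm m' hm'
      obtain ⟨p, hp, rfl⟩ := List.mem_map.1 hm
      obtain ⟨p', hp', rfl⟩ := List.mem_map.1 hm'
      simp [replicaForm_single, hS1, hl p hp, hl p' hp']
  have h := HasDerivAt.fun_sum fun (p : ℕ × ℕ)
    (_ : p ∈ Finset.HasAntidiagonal.antidiagonal (n + 1)) =>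
      key ((p.1 ! : ℂ)⁻¹ • V ^ p.1) p.2
  refine h.congr_deriv ?_
  -- The zeroth power of `V` has no derivative; the shift of the other powers is the drop in the
  -- order.
  rw [Finset.Nat.sum_antidiagonal_succ, Finset.sum_eq_zero, zero_add, Finset.sum_comm]
  · refine Finset.sum_congr rfl fun i _ => ?_
    simp only [Finset.mul_sum]
    refine Finset.sum_congr rfl fun p _ => ?_
    congr 1
    have h1 : contr (covForm C (Pi.single l[(i : ℕ)].2 1)) (((p.1 + 1)! : ℂ)⁻¹ • V ^ (p.1 + 1)) =
        contr (covForm C (Pi.single l[(i : ℕ)].2 1)) V * ((p.1 ! : ℂ)⁻¹ • V ^ p.1) := by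
      rw [map_smul, contr_pow_succ hV, smul_smul, mul_smul_comm, Nat.factorial_succ]
      congr 1
      have : ((p.1 + 1 : ℕ) : ℂ) ≠ 0 := Nat.cast_ne_zero.2 (Nat.succ_ne_zero p.1)
      push_cast at this ⊢
      field_simp
    simp only [h1, map_smul, map_mul (ExteriorAlgebra.map (replicate (k + 1))), mul_smul_comm,
      smul_mul_assoc, smul_eq_mul, mul_assoc (replicaWord (l.eraseIdx i))]
  · intro i _
    simp [contr_one]

end Replicas

/-! ### Gram matrices interpolating between coupled and uncoupled replicas. -/

section Interpolation

/-- The matrices interpolating between the covariances of the replicas: Gram matrices of unit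
vectors with nonnegative entries, for which the labels beyond `k` are equivalent to `k`. -/
structure IsInterp (k : ℕ) (S : ℕ → ℕ → ℝ) : Prop where
  diag : ∀ a, S a a = 1
  nonneg : ∀ a b, 0 ≤ S a b
  stable : ∀ a b, S (min a k) (min b k) = S a b
  gram : ∃ (N : ℕ) (u : ℕ → Fin N → ℝ), ∀ a b, S a b = ∑ i, u a i * u b i

theorem IsInterp.symm {k : ℕ} {S : ℕ → ℕ → ℝ} (hS : IsInterp k S) (a b : ℕ) : S a b = S b a := by
  obtain ⟨N, u, hu⟩ := hS.gram
  rw [hu, hu]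
  exact Finset.sum_congr rfl fun i _ => mul_comm _ _

theorem isInterp_one (k : ℕ) : IsInterp k fun _ _ => 1 :=
  ⟨fun _ => rfl, fun _ _ => zero_le_one, fun _ _ => rfl, 1, fun _ _ => 1, fun _ _ => by simp⟩

/-- The vectors up to `k` are kept, and all later ones, which may be taken equal to `u k`, are
replaced by `s u k + √(1 - s²) e` with a new unit vector `e` orthogonal to the old ones. These are
again unit vectors, and only the inner products across the cut acquire the factor `s`. -/
theorem IsInterp.cut {k : ℕ} {S : ℕ → ℕ → ℝ} (hS : IsInterp k S) {s : ℝ} (h0 : 0 ≤ s)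
    (h1 : s ≤ 1) : IsInterp (k + 1) (cut k S s) := by
  refine ⟨fun a => ?_, fun a b => ?_, fun a b => ?_, ?_⟩
  · simp [GrassmannRG.cut, hS.diag]
  · have := hS.nonneg a b
    simp only [GrassmannRG.cut]
    split_ifs <;> positivity
  · have h : ∀ a, min a (k + 1) ≤ k ↔ a ≤ k := fun a => by omega
    have h' : S (min a (k + 1)) (min b (k + 1)) = S a b := by
      rw [← hS.stable, min_assoc, min_assoc, min_eq_right (Nat.le_succ k), hS.stable]
    simp only [GrassmannRG.cut, h, h']
  · obtain ⟨N, u, hu⟩ := hS.gram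
    refine ⟨N + 1, fun a => if a ≤ k then Fin.cons 0 (u a) else
      Fin.cons (√(1 - s ^ 2)) (fun i => s * u k i), fun a b => ?_⟩
    have hs : 0 ≤ 1 - s ^ 2 := by nlinarith
    rw [Fin.sum_univ_succ]
    by_cases ha : a ≤ k <;> by_cases hb : b ≤ k
    · simp [GrassmannRG.cut, ha, hb, hu]
    · rw [GrassmannRG.cut, ← hS.stable, min_eq_left ha, min_eq_right (by omega), hu]
      simp [ha, hb, Finset.mul_sum, mul_left_comm]
    · rw [GrassmannRG.cut, ← hS.stable, min_eq_left hb, min_eq_right (by omega), hu]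
      simp [ha, hb, Finset.mul_sum, mul_assoc]
    · rw [GrassmannRG.cut, ← hS.stable, min_eq_right (by omega), min_eq_right (by omega), hS.diag]
      simp only [ha, hb, if_true, if_false, Fin.cons_zero, Fin.cons_succ, iff_self,
        Real.mul_self_sqrt hs]
      have : ∑ i, s * u k i * (s * u k i) = s ^ 2 * S k k := by
        rw [hu, Finset.mul_sum]
        exact Finset.sum_congr rfl fun i _ => by ring
      rw [this, hS.diag]
      ring

theorem cut_one (k : ℕ) (S : ℕ → ℕ → ℝ) : cut k S 1 = S := by
  ext a b
  simp [cut]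

theorem cut_zero_of_lt {k : ℕ} (S : ℕ → ℕ → ℝ) {a b : ℕ} (ha : a ≤ k) (hb : k < b) :
    cut k S 0 a b = 0 := by
  simp [cut, ha, not_le.2 hb]

theorem cut_of_lt {k : ℕ} (S : ℕ → ℕ → ℝ) (s : ℝ) {a b : ℕ} (ha : a ≤ k) (hb : k < b) :
    cut k S s a b = s * S a b := by
  simp [cut, ha, not_le.2 hb]

end Interpolation

/-! ### Gram bound for the interpolated covariances. -/

section GramBound

variable {𝕏 : Type*} {H : Type*} [NormedAddCommGroup H] [InnerProductSpace ℂ H]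

/-- The covariance `S(a, b) C(X, Y)` is the inner product of `u a ⊗ f X` and `u b ⊗ g Y`, realized
in a finite sum of copies of `H`. As `S` has unit diagonal, the tensor factor does not change the
norms, so `γ` is independent of the interpolation. -/
theorem norm_ct_wick_replicaWord_le (C : 𝕏 → 𝕏 → ℂ) (f g : 𝕏 → H) {γ : ℝ}
    (hC : ∀ X Y, C X Y = inner ℂ (f X) (g Y)) (hγ : 0 ≤ γ) (hf : ∀ X, ‖f X‖ ≤ γ)
    (hg : ∀ X, ‖g X‖ ≤ γ) {k : ℕ} {S : ℕ → ℕ → ℝ} (hS : IsInterp k S)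
    (l : List (ℕ × (𝕏 ⊕ 𝕏))) :
    ‖ct (wick (replicaForm C S) (replicaWord l))‖ ≤ γ ^ l.length := by
  obtain ⟨N, u, hu⟩ := hS.gram
  refine norm_ct_wick_word_le (H := PiLp 2 fun _ : Fin N => H) (replicaForm_isAlt C hS.symm) _
    (fun p => p.2.isLeft)
    (fun p => WithLp.toLp 2 fun i => (u p.1 i : ℂ) • Sum.elim g f p.2) hγ ?_ ?_ ?_ l
  · intro p
    have hfg : ‖Sum.elim g f p.2‖ ≤ γ := by
      rcases p.2 with X | X
      · exact hg X
      · exact hf X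
    rw [← pow_le_pow_iff_left₀ (norm_nonneg _) hγ two_ne_zero, PiLp.norm_sq_eq_of_L2]
    calc ∑ i, ‖(u p.1 i : ℂ) • Sum.elim g f p.2‖ ^ 2
        = (∑ i, u p.1 i * u p.1 i) * ‖Sum.elim g f p.2‖ ^ 2 := by
          rw [Finset.sum_mul]
          refine Finset.sum_congr rfl fun i _ => ?_
          rw [norm_smul, mul_pow, Complex.norm_real, Real.norm_eq_abs, sq_abs, sq (u p.1 i)]
      _ = ‖Sum.elim g f p.2‖ ^ 2 := by rw [← hu, hS.diag, one_mul]
      _ ≤ γ ^ 2 := pow_le_pow_left₀ (norm_nonneg _) hfg 2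
  · rintro ⟨a, X | X⟩ ⟨b, Y | Y⟩ h h' <;> simp at h h'
    rw [replicaForm_single, PiLp.inner_apply]
    simp only [cov, hC, hu, Sum.elim_inl, Sum.elim_inr, inner_smul_left, inner_smul_right,
      Complex.conj_ofReal]
    push_cast
    rw [Finset.sum_mul]
    exact Finset.sum_congr rfl fun i _ => by ring
  · rintro ⟨a, X | X⟩ ⟨b, Y | Y⟩ h <;> simp at h <;> simp [replicaForm_single, cov]

end GramBound

/-! ### Norms of contracted families of monomials. -/

section SpreadLemmas

variable {Ω Ω' α : Type*} [Fintype Ω] [Fintype Ω'] [DecidableEq α]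

theorem Spread.eraseIdx {a : Ω → ℂ} {l : Ω → List α} {N : ℝ} (h : Spread a l N) (i : ℕ) :
    Spread a (fun ω => (l ω).eraseIdx i) N := by
  intro p z
  simp only [List.getElem?_eraseIdx]
  by_cases hp : p < i
  · simpa [hp] using h p z
  · simpa [hp] using h (p + 1) z

theorem Spread.mul_right {a : Ω → ℂ} {l : Ω → List α} {N : ℝ} (h : Spread a l N) {c : Ω → ℂ}
    {K : ℝ} (hK : 0 ≤ K) (hc : ∀ ω, ‖c ω‖ ≤ K) : Spread (fun ω => a ω * c ω) l (N * K) := by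
  intro p z
  refine (Finset.sum_le_sum fun ω _ => ?_).trans
    ((Finset.sum_mul _ _ _).symm.le.trans (mul_le_mul_of_nonneg_right (h p z) hK))
  split_ifs
  · rw [norm_mul]
    exact mul_le_mul_of_nonneg_left (hc ω) (norm_nonneg _)
  · simp

theorem Spread.sum_mul_le [Fintype α] {b : Ω → ℂ} {l : Ω → List α} {N k : ℝ} (h : Spread b l N)
    (hN : 0 ≤ N) {j : ℕ} {w : Ω → α} (hw : ∀ ω, (l ω)[j]? = some (w ω)) (K : α → ℝ)
    (hK0 : ∀ z, 0 ≤ K z) (hK : ∑ z, K z ≤ k) : ∑ ω, ‖b ω‖ * K (w ω) ≤ N * k := by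
  calc ∑ ω, ‖b ω‖ * K (w ω) = ∑ z, (∑ ω, if (l ω)[j]? = some z then ‖b ω‖ else 0) * K z := by
        simp only [Finset.sum_mul]
        rw [Finset.sum_comm]
        refine Finset.sum_congr rfl fun ω _ => ?_
        simp [hw]
    _ ≤ ∑ z, N * K z := Finset.sum_le_sum fun z _ => mul_le_mul_of_nonneg_right (h j z) (hK0 z)
    _ = N * ∑ z, K z := (Finset.mul_sum _ _ _).symm
    _ ≤ N * k := mul_le_mul_of_nonneg_left hK hN

theorem Spread.sum_le [Fintype α] {a : Ω → ℂ} {l : Ω → List α} {N : ℝ} (h : Spread a l N)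
    (hN : 0 ≤ N) (hl : ∀ ω, l ω ≠ []) : ∑ ω, ‖a ω‖ ≤ N * Fintype.card α := by
  have hw : ∀ ω, ∃ w, (l ω)[0]? = some w := fun ω => by
    obtain ⟨x, l', h⟩ := List.exists_cons_of_ne_nil (hl ω)
    exact ⟨x, by simp [h]⟩
  choose w hw using hw
  simpa using h.sum_mul_le hN hw (fun _ => 1) (fun _ => zero_le_one) le_rfl

/-- The prescribed letter stands in one of the two words. With that word fixed, the sum over the
other word is controlled through its contracted letter, first by its own spread and then by the row
or column sum of `K`; the sum over the word with the prescribed letter comes last. -/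
theorem Spread.contract [Fintype α] {a : Ω → ℂ} {l : Ω → List α} {N : ℝ} (ha : Spread a l N)
    {b : Ω' → ℂ} {l' : Ω' → List α} {N' : ℝ} (hb : Spread b l' N') (hN : 0 ≤ N) (hN' : 0 ≤ N')
    {n i j : ℕ} (hn : ∀ ω, (l ω).length = n) {w : Ω → α} (hw : ∀ ω, (l ω)[i]? = some (w ω))
    {w' : Ω' → α} (hw' : ∀ ω, (l' ω)[j]? = some (w' ω)) (K : α → α → ℂ) {k : ℝ} (hk : 0 ≤ k)
    (hK : ∀ z, ∑ z', ‖K z z'‖ ≤ k) (hK' : ∀ z', ∑ z, ‖K z z'‖ ≤ k) :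
    Spread (fun p : Ω × Ω' => a p.1 * b p.2 * K (w p.1) (w' p.2))
      (fun p => (l p.1).eraseIdx i ++ (l' p.2).eraseIdx j) (N * N' * k) := by
  intro p z
  rw [Fintype.sum_prod_type]
  by_cases hp : p < (n - 1)
  · have hlen : ∀ ω, p < ((l ω).eraseIdx i).length := fun ω => by
      have hi : i < (l ω).length := (List.getElem?_eq_some_iff.1 (hw ω)).1
      rw [List.length_eraseIdx_of_lt hi, hn]
      exact hp
    simp only [List.getElem?_append_left (hlen _)]
    have h1 := ha.eraseIdx i p z
    calc _ = ∑ ω, (if ((l ω).eraseIdx i)[p]? = some z then ‖a ω‖ else 0) *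
          ∑ ω', ‖b ω'‖ * ‖K (w ω) (w' ω')‖ := by
          refine Finset.sum_congr rfl fun ω _ => ?_
          split_ifs <;> simp [Finset.mul_sum, mul_assoc]
      _ ≤ ∑ ω, (if ((l ω).eraseIdx i)[p]? = some z then ‖a ω‖ else 0) * (N' * k) := by
          refine Finset.sum_le_sum fun ω _ => mul_le_mul_of_nonneg_left
            (hb.sum_mul_le hN' hw' (fun z' => ‖K (w ω) z'‖) (fun _ => norm_nonneg _) (hK _)) ?_
          split_ifs <;> positivity
      _ ≤ N * (N' * k) := by
          rw [← Finset.sum_mul]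
          exact mul_le_mul_of_nonneg_right h1 (by positivity)
      _ = N * N' * k := by ring
  · have hlen : ∀ ω, ((l ω).eraseIdx i).length ≤ p := fun ω => by
      have hi : i < (l ω).length := (List.getElem?_eq_some_iff.1 (hw ω)).1
      rw [List.length_eraseIdx_of_lt hi, hn]
      omega
    have hlen' : ∀ ω, ((l ω).eraseIdx i).length = n - 1 := fun ω => by
      have hi : i < (l ω).length := (List.getElem?_eq_some_iff.1 (hw ω)).1
      rw [List.length_eraseIdx_of_lt hi, hn]
    simp only [List.getElem?_append_right (hlen _), hlen']
    have h1 := hb.eraseIdx j (p - (n - 1)) z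
    rw [Finset.sum_comm]
    calc _ = ∑ ω', (if ((l' ω').eraseIdx j)[p - (n - 1)]? = some z then ‖b ω'‖ else 0) *
          ∑ ω, ‖a ω‖ * ‖K (w ω) (w' ω')‖ := by
          refine Finset.sum_congr rfl fun ω' _ => ?_
          split_ifs <;> simp [Finset.mul_sum, mul_assoc, mul_left_comm]
      _ ≤ ∑ ω', (if ((l' ω').eraseIdx j)[p - (n - 1)]? = some z then ‖b ω'‖ else 0) * (N * k) := by
          refine Finset.sum_le_sum fun ω' _ => mul_le_mul_of_nonneg_left
            (ha.sum_mul_le hN hw (fun z => ‖K z (w' ω')‖) (fun _ => norm_nonneg _) (hK' _)) ?_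
          split_ifs <;> positivity
      _ ≤ N' * (N * k) := by
          rw [← Finset.sum_mul]
          exact mul_le_mul_of_nonneg_right h1 (by positivity)
      _ = N * N' * k := by ring

end SpreadLemmas

/-! ### Splitting each field into an integrated and an external part. -/

section Expansion

variable {M N : Type*} [AddCommGroup M] [Module ℂ M] [AddCommGroup N] [Module ℂ N]

/-- The form `A` on the first factor of `M × N`. -/
def fstForm (N : Type*) [AddCommGroup N] [Module ℂ N] (A : LinearMap.BilinForm ℂ M) :
    LinearMap.BilinForm ℂ (M × N) :=
  A.compl₁₂ (LinearMap.fst ℂ M N) (LinearMap.fst ℂ M N)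

theorem fstForm_isAlt {A : LinearMap.BilinForm ℂ M} (hA : A.IsAlt) : (fstForm N A).IsAlt :=
  isAlt_compl₁₂ hA _

/-- Doubling of the space: each letter becomes the sum of an integrated copy in `M` and an external
copy in `N`. Only the first is seen by the form, and only the second is kept by the final
projection. -/
theorem map_wick_eq {A : LinearMap.BilinForm ℂ M} (hA : A.IsAlt) (Φ : M →ₗ[ℂ] N)
    (x : ExteriorAlgebra ℂ M) : ExteriorAlgebra.map Φ (wick A x) =
      ExteriorAlgebra.map (LinearMap.snd ℂ M N)
        (wick (fstForm N A) (ExteriorAlgebra.map (LinearMap.prod LinearMap.id Φ) x)) := by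
  rw [wick_map (fstForm_isAlt hA), ← AlgHom.comp_apply (ExteriorAlgebra.map _),
    ExteriorAlgebra.map_comp_map]
  rfl

theorem map_snd_wick_mul {A : LinearMap.BilinForm ℂ M} (hA : A.IsAlt) (I : List M) (J : List N) :
    ExteriorAlgebra.map (LinearMap.snd ℂ M N) (wick (fstForm N A)
      (word (I.map (LinearMap.inl ℂ M N)) * word (J.map (LinearMap.inr ℂ M N)))) =
      ct (wick A (word I)) • word J := by
  have hB := fstForm_isAlt (N := N) hA
  have hJ : wick (fstForm N A) (word (J.map (LinearMap.inr ℂ M N))) =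
      word (J.map (LinearMap.inr ℂ M N)) := by
    refine wick_word_of_forall hB _ fun m hm m' _ => ?_
    obtain ⟨n, -, rfl⟩ := List.mem_map.1 hm
    simp [fstForm]
  rw [wick_word_mul_of_contr_eq_zero hB, hJ, map_mul, ← map_word, wick_map hB,
    ← AlgHom.comp_apply, ExteriorAlgebra.map_comp_map, LinearMap.snd_comp_inl, map_zero_eq,
    map_word, List.map_map, ← Algebra.smul_def]
  · congr 2
    simp
  · intro m _
    rw [hJ]
    refine contr_word_of_forall _ _ fun m' hm' => ?_
    obtain ⟨n, -, rfl⟩ := List.mem_map.1 hm'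
    simp [fstForm]

/-- One step of the expansion: the next letter joins the integrated letters `I`, after passing the
external letters `J`, or it joins `J`. -/
theorem word_mul_word_mul_cons (I : List M) (J : List N) (m : M) (n : N) (r : List (M × N)) :
    word (I.map (LinearMap.inl ℂ M N)) * word (J.map (LinearMap.inr ℂ M N)) *
        word ((m, n) :: r) =
      (-1 : ℂ) ^ J.length • (word ((I ++ [m]).map (LinearMap.inl ℂ M N)) *
        word (J.map (LinearMap.inr ℂ M N)) * word r) +
      word (I.map (LinearMap.inl ℂ M N)) * word ((J ++ [n]).map (LinearMap.inr ℂ M N)) *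
        word r := by
  have h : ((m, n) : M × N) = LinearMap.inl ℂ M N m + LinearMap.inr ℂ M N n := by simp
  have h1 := ι_mul_comm (LinearMap.inl ℂ M N m) (word (J.map (LinearMap.inr ℂ M N)))
  rw [parity_word, List.length_map, smul_mul_assoc] at h1
  have h2 : word (J.map (LinearMap.inr ℂ M N)) * ExteriorAlgebra.ι ℂ (LinearMap.inl ℂ M N m) =
      (-1 : ℂ) ^ J.length • (ExteriorAlgebra.ι ℂ (LinearMap.inl ℂ M N m) *
        word (J.map (LinearMap.inr ℂ M N))) := by
    rw [h1, smul_smul, ← pow_add, Even.neg_one_pow ⟨_, rfl⟩, one_smul]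
  rw [word_cons, h, map_add, add_mul, mul_add]
  congr 1
  · rw [mul_assoc, ← mul_assoc (word (J.map _)), h2, List.map_append, word_append]
    simp [mul_assoc]
  · simp [mul_assoc]

end Expansion

/-! ### Functionals bounded after Gaussian integration. -/

section GaussianBound

universe u

variable {𝕏 : Type u} [Fintype 𝕏] [DecidableEq 𝕏]

/-- A functional on Grassmann polynomials that, after integration over Gaussian replicas, is
bounded by `M y ^ n` on families of monomials of degree `n` and norm at most `1`. -/
def IsGaussBounded (κ : ℝ) (C : 𝕏 → 𝕏 → ℂ) (M y : ℝ) (ℓ : Fields 𝕏 →ₗ[ℂ] ℂ) : Prop :=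
  ∀ (k : ℕ) (S : ℕ → ℕ → ℝ), IsInterp k S → ∀ (Ω : Type u) [Fintype Ω] (a : Ω → ℂ)
    (l : Ω → List (ℕ × (𝕏 ⊕ 𝕏))) (t : List Bool) (N : ℝ),
    (∀ ω, (l ω).map (fun p => p.2.isLeft) = t) → t ≠ [] → 0 ≤ N →
    Spread a (fun ω => (l ω).map Prod.snd) (κ * N) →
      ‖∑ ω, a ω * ℓ (ExteriorAlgebra.map collapse (wick (replicaForm C S) (replicaWord (l ω))))‖ ≤
        M * N * y ^ t.length

/-- The constant grows with the number of points. It serves only to make the series for the constant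
terms converge and does not enter the final norm estimates. -/
theorem isGaussBounded_ct {κ : ℝ} (hκ : 0 ≤ κ) {C : 𝕏 → 𝕏 → ℂ} {γ y : ℝ} (hγ : 0 ≤ γ)
    (hy : γ ≤ y) (hC : ∀ (k : ℕ) (S : ℕ → ℕ → ℝ), IsInterp k S → ∀ l,
      ‖ct (wick (replicaForm C S) (replicaWord l))‖ ≤ γ ^ l.length) :
    IsGaussBounded κ C (κ * Fintype.card (𝕏 ⊕ 𝕏)) y (ct : Fields 𝕏 →ₐ[ℂ] ℂ).toLinearMap := by
  intro k S hS Ω _ a l t N ht ht0 hN hsp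
  have hlen : ∀ ω, (l ω).length = t.length := fun ω => by rw [← ht ω, List.length_map]
  refine (norm_sum_le _ _).trans ?_
  calc _ ≤ ∑ ω, ‖a ω‖ * y ^ t.length := by
        refine Finset.sum_le_sum fun ω _ => ?_
        rw [norm_mul, AlgHom.toLinearMap_apply, ct_map]
        refine mul_le_mul_of_nonneg_left ((hC k S hS _).trans ?_) (norm_nonneg _)
        rw [hlen]
        exact pow_le_pow_left₀ hγ hy _
    _ = (∑ ω, ‖a ω‖) * y ^ t.length := (Finset.sum_mul _ _ _).symm
    _ ≤ (κ * N * Fintype.card (𝕏 ⊕ 𝕏)) * y ^ t.length := by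
        have : 0 ≤ y := hγ.trans hy
        refine mul_le_mul_of_nonneg_right (hsp.sum_le (by positivity) fun ω h => ht0 ?_)
          (by positivity)
        rw [← ht ω, List.map_eq_nil_iff.1 h]
        rfl
    _ = _ := by ring

/-- Every remaining letter is either integrated, with factor `γ` from the Gram bound, or external,
with factor `h`; this binomial sum is `(h + γ) ^ tr.length`. Integrated letters are erased from the
words, which preserves the spread. -/
theorem norm_sum_expansion_le {κ h γ : ℝ} (hh : 0 ≤ h) (hγ : 0 ≤ γ)
    {ℓ : Fields 𝕏 →ₗ[ℂ] ℂ} (hℓ : IsNormBounded κ h ℓ) {A : LinearMap.BilinForm ℂ (Replicas 𝕏)}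
    (hA : A.IsAlt) (hC : ∀ l, ‖ct (wick A (replicaWord l))‖ ≤ γ ^ l.length) {N : ℝ} (hN : 0 ≤ N)
    {Ω : Type u} [Fintype Ω] (tr : List Bool) (a : Ω → ℂ) (I J r : Ω → List (ℕ × (𝕏 ⊕ 𝕏))) (n : ℕ)
    (t : List Bool) (hI : ∀ ω, (I ω).length = n)
    (hJ : ∀ ω, (J ω).map (fun p => p.2.isLeft) = t)
    (hr : ∀ ω, (r ω).map (fun p => p.2.isLeft) = tr)
    (hsp : Spread a (fun ω => (J ω ++ r ω).map Prod.snd) (κ * N)) :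
    ‖∑ ω, a ω * ℓ (ExteriorAlgebra.map (LinearMap.snd ℂ (Replicas 𝕏) (𝕏 ⊕ 𝕏 → ℂ))
      (wick (fstForm (𝕏 ⊕ 𝕏 → ℂ) A)
        (word (((I ω).map fun p => Finsupp.single p (1 : ℂ)).map
            (LinearMap.inl ℂ (Replicas 𝕏) (𝕏 ⊕ 𝕏 → ℂ))) *
          word (((J ω).map fun p => Pi.single p.2 (1 : ℂ)).map
            (LinearMap.inr ℂ (Replicas 𝕏) (𝕏 ⊕ 𝕏 → ℂ))) *
          word ((r ω).map fun p => ((Finsupp.single p (1 : ℂ), Pi.single p.2 (1 : ℂ)) :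
            Replicas 𝕏 × (𝕏 ⊕ 𝕏 → ℂ))))))‖ ≤
      N * γ ^ n * h ^ t.length * (h + γ) ^ tr.length := by
  induction tr generalizing a I J r n t with
  | nil =>
    have hr' : ∀ ω, r ω = [] := fun ω => List.map_eq_nil_iff.1 (hr ω)
    simp only [hr', List.map_nil, word_nil, mul_one, map_snd_wick_mul hA, map_smul, smul_eq_mul,
      ← mul_assoc, List.length_nil, pow_zero]
    -- Without external letters the spread gives no control, and the vanishing of `ℓ` on constants
    -- is needed.
    by_cases ht : t = []
    · have hJ' : ∀ ω, J ω = [] := fun ω => List.map_eq_nil_iff.1 ((hJ ω).trans ht)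
      simp only [hJ', List.map_nil, word_nil, hℓ.map_one, mul_zero, Finset.sum_const_zero, norm_zero]
      positivity
    · have hc : ∀ ω, ‖ct (wick A (word ((I ω).map fun p => Finsupp.single p (1 : ℂ))))‖ ≤ γ ^ n :=
        fun ω => hI ω ▸ hC (I ω)
      have h1 := hℓ.bound Ω _ (fun ω => (J ω).map Prod.snd) t (N * γ ^ n)
        (fun ω => by rw [← hJ ω, List.map_map]; rfl) ht (by positivity) (by
          have := hsp.mul_right (by positivity) hc
          simpa only [hr', List.append_nil, mul_assoc] using this)
      simpa only [gword, List.map_map, Function.comp_def] using h1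
  | cons b tr ih =>
    have hr' : ∀ ω, ∃ p r', r ω = p :: r' ∧ r'.map (fun p => p.2.isLeft) = tr := fun ω => by
      obtain ⟨p, r', h1, -, h3⟩ := List.map_eq_cons_iff.1 (hr ω)
      exact ⟨p, r', h1, h3⟩
    choose p r' hpr hr' using hr'
    have hJlen : ∀ ω, (J ω).length = t.length := fun ω => by rw [← hJ ω, List.length_map]
    have hb : ∀ ω, (p ω).2.isLeft = b := fun ω => by
      have := hr ω
      rw [hpr] at this
      exact (List.cons.inj this).1
    have h1 := ih a (fun ω => I ω ++ [p ω]) J r' (n + 1) t (fun ω => by simp [hI]) hJ hr' (by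
      have := hsp.eraseIdx t.length
      refine cast ?_ this
      congr 1
      ext1 ω
      rw [hpr, List.map_append, List.eraseIdx_append_of_length_le (by simp [hJlen]), List.map_append]
      simp [hJlen])
    have h2 := ih a I (fun ω => J ω ++ [p ω]) r' n (t ++ [b]) hI (fun ω => by simp [hJ, hb]) hr' (by
      simpa [hpr] using hsp)
    simp only [hpr, List.map_cons]
    simp only [word_mul_word_mul_cons, map_add, map_smul, smul_eq_mul, mul_add,
      Finset.sum_add_distrib, List.length_map, hJlen, mul_left_comm (a _)]
    rw [← Finset.mul_sum]
    refine (norm_add_le _ _).trans ?_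
    rw [norm_mul, norm_pow, norm_neg, norm_one, one_pow, one_mul]
    simp only [List.map_append, List.map_cons, List.map_nil, List.length_append, List.length_cons,
      List.length_nil, zero_add] at h1 h2 ⊢
    refine (add_le_add h1 h2).trans (le_of_eq ?_)
    ring

theorem isGaussBounded_of_isNormBounded {κ h γ : ℝ} (hh : 0 ≤ h) (hγ : 0 ≤ γ)
    {C : 𝕏 → 𝕏 → ℂ} (hC : ∀ (k : ℕ) (S : ℕ → ℕ → ℝ), IsInterp k S → ∀ l,
      ‖ct (wick (replicaForm C S) (replicaWord l))‖ ≤ γ ^ l.length)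
    {ℓ : Fields 𝕏 →ₗ[ℂ] ℂ} (hℓ : IsNormBounded κ h ℓ) :
    IsGaussBounded κ C 1 (h + γ) ℓ := by
  intro k S hS Ω _ a l t N ht ht0 hN hsp
  have h1 := norm_sum_expansion_le hh hγ hℓ (replicaForm_isAlt C hS.symm) (hC k S hS) hN t a
    (fun _ => []) (fun _ => []) l 0 [] (fun _ => rfl) (fun _ => rfl) ht (by simpa using hsp)
  simp only [List.map_nil, word_nil, one_mul, pow_zero, mul_one, List.length_nil] at h1
  simp only [one_mul, map_wick_eq (replicaForm_isAlt C hS.symm), replicaWord, map_word, List.map_map]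
  convert h1 using 10
  exact Prod.ext rfl (collapse_single _)

end GaussianBound

/-! ### Derivative of the majorizing product. -/

section ListProd

variable {α : Type*}

theorem hasDerivAt_list_prod (y : ℝ) (d : α → ℝ) (t : List α) (s : ℝ) :
    HasDerivAt (fun s => (t.map fun p => y + s * d p).prod)
      (∑ i : Fin t.length, d t[(i : ℕ)] * ((t.eraseIdx i).map fun p => y + s * d p).prod) s := by
  induction t with
  | nil => simpa using hasDerivAt_const s (1 : ℝ)
  | cons p t ih =>
    have h1 : HasDerivAt (fun s => y + s * d p) (d p) s := by
      simpa using ((hasDerivAt_id s).mul_const (d p)).const_add y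
    simp only [List.map_cons, List.prod_cons]
    refine (h1.fun_mul ih).congr_deriv ?_
    simp only [List.length_cons]
    rw [Fin.sum_univ_succ, Finset.mul_sum]
    simp [mul_left_comm]

theorem pow_length_le_prod {y : ℝ} (hy : 0 ≤ y) (d : α → ℝ) (hd : ∀ p, 0 ≤ d p) (t : List α) :
    y ^ t.length ≤ (t.map fun p => y + d p).prod := by
  induction t with
  | nil => simp
  | cons p t ih =>
    rw [List.length_cons, pow_succ', List.map_cons, List.prod_cons]
    exact mul_le_mul (le_add_of_nonneg_right (hd p)) ih (by positivity)
      (add_nonneg hy (hd p))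

end ListProd

theorem contr_gword {σ : Type*} [DecidableEq σ] (d : Module.Dual ℂ (σ → ℂ)) (l : List σ) {n : ℕ}
    (hn : l.length = n) : contr d (gword l) =
      ∑ j : Fin n, ((-1 : ℂ) ^ (j : ℕ) * d (Pi.single (l[(j : ℕ)]'(hn ▸ j.2)) 1)) •
        gword (l.eraseIdx j) := by
  subst hn
  rw [gword, contr_word, ← Fin.sum_congr' _ (List.length_map (as := l)
    fun z : σ => Pi.single z (1 : ℂ)).symm]
  refine Finset.sum_congr rfl fun j _ => ?_
  simp [gword, List.eraseIdx_map]

theorem IsInterp.eq_of_le {k : ℕ} {S : ℕ → ℕ → ℝ} (hS : IsInterp k S) (a : ℕ) {b : ℕ}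
    (hb : k ≤ b) : S a b = S a k := by
  rw [← hS.stable a b, ← hS.stable a k, min_eq_right hb, min_self]

/-! ### The inductive estimate of the expectations. -/

section Clouds

universe u

variable {𝕏 : Type u} [DecidableEq 𝕏]

/-- A representation of a Grassmann polynomial by families of monomials of norm at most `N`. -/
structure CloudRep (κ : ℝ) (V : Fields 𝕏) (T : Type) [Fintype T] where
  Ω : T → Type u
  fintype : ∀ τ, Fintype (Ω τ)
  weight : ∀ τ, Ω τ → ℂ
  monomial : ∀ τ, Ω τ → List (𝕏 ⊕ 𝕏)
  type : T → List Bool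
  N : T → ℝ
  N_nonneg : ∀ τ, 0 ≤ N τ
  map_monomial : ∀ τ ω, (monomial τ ω).map Sum.isLeft = type τ
  two_le : ∀ τ, 2 ≤ (type τ).length
  spread : ∀ τ, Spread (weight τ) (monomial τ) (κ * N τ)
  eq_sum : V = ∑ τ, ∑ ω, weight τ ω • gword (monomial τ ω)

attribute [instance] CloudRep.fintype

/-- The derivative of `∑ N x ^ n` for a representation by monomials of degree `n` and norm `N`. -/
def CloudRep.deriv {κ : ℝ} {V : Fields 𝕏} {T : Type} [Fintype T] (R : CloudRep κ V T) (x : ℝ) : ℝ :=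
  ∑ τ, (R.type τ).length * (R.N τ * x ^ ((R.type τ).length - 1))

theorem CloudRep.deriv_nonneg {κ : ℝ} {V : Fields 𝕏} {T : Type} [Fintype T] (R : CloudRep κ V T)
    {x : ℝ} (hx : 0 ≤ x) : 0 ≤ R.deriv x :=
  Finset.sum_nonneg fun τ _ => by have := R.N_nonneg τ; positivity

theorem CloudRep.length_monomial {κ : ℝ} {V : Fields 𝕏} {T : Type} [Fintype T]
    (R : CloudRep κ V T) (τ : T) (ω : R.Ω τ) : (R.monomial τ ω).length = (R.type τ).length := by
  rw [← R.map_monomial τ ω, List.length_map]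

/-- The letter at position `j` of a monomial. -/
def CloudRep.letter {κ : ℝ} {V : Fields 𝕏} {T : Type} [Fintype T]
    (R : CloudRep κ V T) (τ : T) (j : Fin (R.type τ).length) (ω : R.Ω τ) : 𝕏 ⊕ 𝕏 :=
  (R.monomial τ ω)[(j : ℕ)]'(by rw [R.length_monomial]; exact j.2)

theorem replicaWord_append {𝕏 : Type*} (l l' : List (ℕ × (𝕏 ⊕ 𝕏))) :
    replicaWord (l ++ l') = replicaWord l * replicaWord l' := by
  simp [replicaWord]

variable [Fintype 𝕏]

theorem CloudRep.contr_eq {κ : ℝ} {V : Fields 𝕏} {T : Type} [Fintype T] (R : CloudRep κ V T)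
    (C : 𝕏 → 𝕏 → ℂ) (z : 𝕏 ⊕ 𝕏) : contr (covForm C (Pi.single z 1)) V =
      ∑ τ, ∑ j : Fin (R.type τ).length, ∑ ω, ((-1 : ℂ) ^ (j : ℕ) * (R.weight τ ω * cov C z (R.letter τ j ω))) •
        gword ((R.monomial τ ω).eraseIdx j) := by
  conv_lhs => rw [R.eq_sum]
  simp only [map_sum, map_smul]
  refine Finset.sum_congr rfl fun τ _ => ?_
  rw [Finset.sum_comm]
  refine Finset.sum_congr rfl fun ω _ => ?_
  rw [contr_gword _ _ (R.length_monomial τ ω), Finset.smul_sum]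
  refine Finset.sum_congr rfl fun j _ => ?_
  rw [smul_smul, covForm_single, CloudRep.letter]
  congr 1
  ring

/-- Induction on the order `n`. The derivative in the cut parameter selects a letter `p` of the
word, with factor `S(p, k)`, and joins it to a letter of a new `V`; the remaining letters of `V`
have unit covariance with their own replica and contribute powers of `y + c`. Summation over all
monomials of `V` and their letters gives `R.deriv (y + c)`. The product over the letters is stable
under this operation, since its own derivative is the same sum over `p` with the factor `c S(p, k)`;
this explains the division by `c` in the rate. -/
theorem norm_sum_expectation_le {κ : ℝ} (hκ : 0 ≤ κ) (C : 𝕏 → 𝕏 → ℂ) {V : Fields 𝕏}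
    (hV : parity V = V) {T : Type} [Fintype T] (R : CloudRep κ V T) {M y c δ : ℝ} (hM : 0 ≤ M)
    (hy : 0 ≤ y) (hc : 0 < c) (hδ : 0 ≤ δ) (hcov : ∀ z, ∑ z', ‖cov C z z'‖ ≤ δ)
    {ℓ : Fields 𝕏 →ₗ[ℂ] ℂ} (hℓ : IsGaussBounded κ C M y ℓ) (n k : ℕ) (S : ℕ → ℕ → ℝ)
    (hS : IsInterp k S) (Ω : Type u) [Fintype Ω] (a : Ω → ℂ) (l : Ω → List (ℕ × (𝕏 ⊕ 𝕏)))
    (t : List (ℕ × Bool)) (N : ℝ) (ht : ∀ ω, (l ω).map (fun p => (p.1, p.2.isLeft)) = t)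
    (htk : ∀ p ∈ t, p.1 ≤ k) (ht0 : t ≠ []) (hN : 0 ≤ N)
    (hsp : Spread a (fun ω => (l ω).map Prod.snd) (κ * N)) :
    ‖∑ ω, a ω * ℓ (expectation C V S (k + 1) n (replicaWord (l ω)))‖ ≤
      M * (κ * δ / c * R.deriv (y + c)) ^ n * N * (t.map fun p => y + c * S p.1 k).prod := by
  induction n generalizing k S Ω t N with
  | zero =>
    simp only [expectation_zero, pow_zero, mul_one]
    refine (hℓ k S hS Ω a l (t.map Prod.snd) N (fun ω => ?_) (by simpa using ht0) hN hsp).trans ?_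
    · rw [← ht ω, List.map_map]; rfl
    · rw [List.length_map]
      exact mul_le_mul_of_nonneg_left (pow_length_le_prod hy _
        (fun p => mul_nonneg hc.le (hS.nonneg _ _)) t) (by positivity)
  | succ n ih =>
    set Q := κ * δ / c * R.deriv (y + c) with hQ
    have hQ0 : 0 ≤ Q := mul_nonneg (by positivity) (R.deriv_nonneg (by positivity))
    have hlen : ∀ ω, (l ω).length = t.length := fun ω => by rw [← ht ω, List.length_map]
    have hlk : ∀ ω, ∀ p ∈ l ω, p.1 ≤ k := fun ω p hp =>
      htk (p.1, p.2.isLeft) (ht ω ▸ List.mem_map.2 ⟨p, hp, rfl⟩)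
    let w : Fin t.length → Ω → ℕ × (𝕏 ⊕ 𝕏) := fun i ω => (l ω)[(i : ℕ)]'(by rw [hlen]; exact i.2)
    have hw : ∀ i ω, (w i ω).1 = t[(i : ℕ)].1 := fun i ω => by
      simp only [w, ← ht ω, List.getElem_map]
    have hSk : ∀ b, S b (k + 1) = S b k := fun b => hS.eq_of_le b (Nat.le_succ k)
    let f : ℝ → ℂ := fun s =>
      ∑ ω, a ω * ℓ (expectation C V (cut k S s) (k + 1) (n + 1) (replicaWord (l ω)))
    let G : ℝ → (i : Fin t.length) → (τ : T) → (j : Fin (R.type τ).length) → ℂ := fun s i τ j =>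
      ∑ p : Ω × R.Ω τ, a p.1 * R.weight τ p.2 * cov C (w i p.1).2 (R.letter τ j p.2) *
        ℓ (expectation C V (cut k S s) (k + 1) n (replicaWord ((l p.1).eraseIdx i ++
          ((R.monomial τ p.2).eraseIdx j).map fun z => (k + 1, z))))
    let f' : ℝ → ℂ := fun s => ∑ i : Fin t.length, ∑ τ, ∑ j : Fin (R.type τ).length,
      ((-1 : ℂ) ^ (t.length - 1 - i) * (-1 : ℂ) ^ (j : ℕ)) * (S t[(i : ℕ)].1 k : ℂ) * G s i τ j
    have hf : ∀ s, HasDerivAt f (f' s) s := by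
      intro s
      have h := HasDerivAt.fun_sum fun (ω : Ω) (_ : ω ∈ Finset.univ) =>
        (hasDerivAt_expectation C hV hS.symm k n (l ω) (hlk ω) ℓ s).const_mul (a ω)
      refine h.congr_deriv ?_
      have h1 : ∀ ω, ∑ i : Fin (l ω).length, (-1 : ℂ) ^ ((l ω).length - 1 - i) *
          ((S (l ω)[(i : ℕ)].1 (k + 1) : ℂ) * ℓ (expectation C V (cut k S s) (k + 1) n
            (replicaWord ((l ω).eraseIdx i) * ExteriorAlgebra.map (replicate (k + 1))
              (contr (covForm C (Pi.single (l ω)[(i : ℕ)].2 1)) V)))) =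
          ∑ i : Fin t.length, (-1 : ℂ) ^ (t.length - 1 - i) *
          ((S t[(i : ℕ)].1 k : ℂ) * ℓ (expectation C V (cut k S s) (k + 1) n
            (replicaWord ((l ω).eraseIdx i) * ExteriorAlgebra.map (replicate (k + 1))
              (contr (covForm C (Pi.single (w i ω).2 1)) V)))) := by
        intro ω
        rw [← Fin.sum_congr' _ (hlen ω).symm]
        refine Finset.sum_congr rfl fun i _ => ?_
        simp only [Fin.val_cast, hlen, ← hw i ω, hSk]
        rfl
      simp only [h1]
      simp only [R.contr_eq, map_sum, map_smul, Finset.mul_sum, map_replicate_gword,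
        mul_smul_comm, smul_eq_mul, f', G, Fintype.sum_prod_type, ← replicaWord_append]
      rw [Finset.sum_comm]
      refine Finset.sum_congr rfl fun i _ => ?_
      rw [Finset.sum_comm]
      refine Finset.sum_congr rfl fun τ _ => ?_
      rw [Finset.sum_comm]
      refine Finset.sum_congr rfl fun j _ => Finset.sum_congr rfl fun ω _ =>
        Finset.sum_congr rfl fun ω' _ => ?_
      ring
    have hG : ∀ s, 0 ≤ s → s ≤ 1 → ∀ i τ j, ‖G s i τ j‖ ≤ M * Q ^ n * N *
        ((t.eraseIdx i).map fun p => y + s * (c * S p.1 k)).prod *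
          (κ * δ * (R.N τ * (y + c) ^ ((R.type τ).length - 1))) := by
      intro s h0 h1 i τ j
      have hcut := hS.cut h0 h1
      set t' := t.eraseIdx i ++ ((R.type τ).eraseIdx j).map fun b => (k + 1, b) with ht'
      have hNτ := R.N_nonneg τ
      have htype : ∀ p : Ω × R.Ω τ, ((l p.1).eraseIdx i ++
          ((R.monomial τ p.2).eraseIdx j).map fun z => (k + 1, z)).map
            (fun p => (p.1, p.2.isLeft)) = t' := fun p => by
        have h : (R.type τ).eraseIdx j = ((R.monomial τ p.2).eraseIdx j).map Sum.isLeft := by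
          rw [← List.eraseIdx_map, R.map_monomial]
        rw [List.map_append, ← List.eraseIdx_map, ht, List.map_map, ht', h, List.map_map]
        rfl
      have hk1 : ∀ p ∈ t', p.1 ≤ k + 1 := by
        intro p hp
        rcases List.mem_append.1 hp with hp | hp
        · exact (htk p (List.mem_of_mem_eraseIdx hp)).trans (Nat.le_succ k)
        · obtain ⟨b, -, rfl⟩ := List.mem_map.1 hp
          exact le_rfl
      have hjlen : ((R.type τ).eraseIdx j).length = (R.type τ).length - 1 :=
        List.length_eraseIdx_of_lt j.2
      have ht0' : t' ≠ [] := by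
        intro h
        have := congrArg List.length h
        rw [ht', List.length_append, List.length_map, hjlen] at this
        have := R.two_le τ
        simp at *
        omega
      have hspread : Spread (fun p : Ω × R.Ω τ => a p.1 * R.weight τ p.2 *
          cov C (w i p.1).2 (R.letter τ j p.2)) (fun p => ((l p.1).eraseIdx i ++
            ((R.monomial τ p.2).eraseIdx j).map fun z => (k + 1, z)).map Prod.snd)
          (κ * (N * R.N τ * (κ * δ))) := by
        have h := hsp.contract (R.spread τ) (by positivity) (by positivity)
          (n := t.length) (i := i) (j := j) (fun ω => by rw [List.length_map, hlen])
          (w := fun ω => (w i ω).2) (fun ω => by simp [w, hlen])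
          (w' := R.letter τ j) (fun ω => by simp [CloudRep.letter, R.length_monomial]) (cov C) hδ
          hcov (fun z' => by simpa only [cov_swap C _ z', norm_neg] using hcov z')
        have e : κ * (N * R.N τ * (κ * δ)) = κ * N * (κ * R.N τ) * δ := by ring
        rw [e]
        refine cast ?_ h
        congr 1
        ext1 p
        simp [List.eraseIdx_map, Function.comp_def]
      have h2 := ih (k + 1) (cut k S s) hcut (Ω × R.Ω τ) _ _ t' (N * R.N τ * (κ * δ)) htype hk1
        ht0' (by positivity) hspread
      -- The new letters occupy replica `k + 1`, so the exponential is moved to replica `k + 2`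
      -- before the induction hypothesis is used.
      have h3 : ∀ p : Ω × R.Ω τ, expectation C V (cut k S s) (k + 1) n
          (replicaWord ((l p.1).eraseIdx i ++
            ((R.monomial τ p.2).eraseIdx j).map fun z => (k + 1, z))) =
          expectation C V (cut k S s) (k + 1 + 1) n (replicaWord ((l p.1).eraseIdx i ++
            ((R.monomial τ p.2).eraseIdx j).map fun z => (k + 1, z))) := fun p => by
        refine (expectation_glue C V hcut.symm hcut.stable n _ (map_glue_replicaWord _ ?_)
          (Nat.le_succ _)).symm
        intro q hq
        exact hk1 (q.1, q.2.isLeft) (htype p ▸ List.mem_map.2 ⟨q, hq, rfl⟩)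
      simp only [G, h3]
      refine h2.trans (le_of_eq ?_)
      -- Old letters are separated from the replica `k + 1` by the cut and get the factor `s`; the
      -- new letters lie in this replica and get `S = 1`.
      have h4 : (t'.map fun p => y + c * cut k S s p.1 (k + 1)).prod =
          ((t.eraseIdx i).map fun p => y + s * (c * S p.1 k)).prod *
            (y + c) ^ ((R.type τ).length - 1) := by
        rw [ht', List.map_append, List.prod_append, List.map_map]
        congr 1
        · congr 1
          refine List.map_congr_left fun p hp => ?_
          rw [cut_of_lt S s (htk p (List.mem_of_mem_eraseIdx hp)) (Nat.lt_succ_self k), hSk]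
          ring
        · rw [← hjlen, Function.comp_def]
          simp [hcut.diag]
      rw [h4]
      ring
    -- The majorant vanishes at `s = 0`, as `f` does. At `s = 1` the subtracted power of `y` is
    -- dropped.
    let B : ℝ → ℝ := fun s => M * Q ^ (n + 1) * N *
      ((t.map fun p => y + s * (c * S p.1 k)).prod - y ^ t.length)
    have hB : ∀ s, HasDerivAt B (M * Q ^ (n + 1) * N * ∑ i : Fin t.length,
        c * S t[(i : ℕ)].1 k * ((t.eraseIdx i).map fun p => y + s * (c * S p.1 k)).prod) s :=
      fun s => ((hasDerivAt_list_prod y (fun p : ℕ × Bool => c * S p.1 k) t s).sub_const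
        _).const_mul _
    have hbound : ∀ s ∈ Set.Ico (0 : ℝ) 1, ‖f' s‖ ≤ M * Q ^ (n + 1) * N * ∑ i : Fin t.length,
        c * S t[(i : ℕ)].1 k * ((t.eraseIdx i).map fun p => y + s * (c * S p.1 k)).prod := by
      rintro s ⟨h0, h1⟩
      have h2 : ∀ i : Fin t.length, ‖∑ τ, ∑ j : Fin (R.type τ).length,
          ((-1 : ℂ) ^ (t.length - 1 - i) * (-1 : ℂ) ^ (j : ℕ)) * (S t[(i : ℕ)].1 k : ℂ) *
            G s i τ j‖ ≤ M * Q ^ (n + 1) * N * (c * S t[(i : ℕ)].1 k *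
              ((t.eraseIdx i).map fun p => y + s * (c * S p.1 k)).prod) := by
        intro i
        have hSi := hS.nonneg t[(i : ℕ)].1 k
        calc _ ≤ ∑ τ, ∑ j : Fin (R.type τ).length, S t[(i : ℕ)].1 k * (M * Q ^ n * N *
              ((t.eraseIdx i).map fun p => y + s * (c * S p.1 k)).prod *
              (κ * δ * (R.N τ * (y + c) ^ ((R.type τ).length - 1)))) := by
              refine (norm_sum_le _ _).trans (Finset.sum_le_sum fun τ _ =>
                (norm_sum_le _ _).trans (Finset.sum_le_sum fun j _ => ?_))
              rw [norm_mul, norm_mul, norm_mul, norm_pow, norm_pow, norm_neg, norm_one, one_pow,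
                one_pow, one_mul, one_mul, Complex.norm_real, Real.norm_of_nonneg hSi]
              exact mul_le_mul_of_nonneg_left (hG s h0 h1.le i τ j) hSi
          _ = _ := by
              -- The factor `c` from the derivative of the product turns the rate `Q` into the exact
              -- cost of adding one `V`.
              have e1 : Q * c = κ * δ * R.deriv (y + c) := by
                rw [hQ]
                field_simp
              have e2 : ∀ x A P : ℝ, ∑ τ, ∑ _j : Fin (R.type τ).length, x * (A * P *
                  (κ * δ * (R.N τ * (y + c) ^ ((R.type τ).length - 1)))) =
                  x * A * P * (κ * δ * R.deriv (y + c)) := fun x A P => by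
                simp only [Finset.sum_const, Finset.card_univ, Fintype.card_fin, nsmul_eq_mul,
                  CloudRep.deriv, Finset.mul_sum]
                exact Finset.sum_congr rfl fun τ _ => by ring
              rw [e2, ← e1]
              ring
      rw [Finset.mul_sum]
      exact (norm_sum_le _ _).trans (Finset.sum_le_sum fun i _ => h2 i)
    have hcont : ContinuousOn f (Set.Icc 0 1) := fun s _ =>
      (hf s).continuousAt.continuousWithinAt
    have hstart : ‖f 0‖ ≤ B 0 := by
      have h0 : f 0 = 0 := by
        refine Finset.sum_eq_zero fun ω _ => ?_
        have hcut := hS.cut le_rfl zero_le_one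
        rw [expectation_eq_zero C V hcut.symm (hcut.diag _) _
          (fun p hp => cut_zero_of_lt S (hlk ω p hp) (Nat.lt_succ_self k)), map_zero, mul_zero]
      simp [h0, B]
    have hmain := image_norm_le_of_norm_deriv_right_le_deriv_boundary hcont
      (fun s _ => (hf s).hasDerivWithinAt) hstart hB hbound (Set.right_mem_Icc.2 zero_le_one)
    simp only [f, B, cut_one, one_mul] at hmain
    refine hmain.trans (mul_le_mul_of_nonneg_left ?_ (by positivity))
    linarith [pow_nonneg hy t.length]

end Clouds

/-! ### Absorbing a derivative into a larger radius. -/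

section Elementary

theorem mul_pow_le_add_pow {z e : ℝ} (hz : 0 ≤ z) (he : 0 ≤ e) (n : ℕ) :
    e * (n * z ^ (n - 1)) ≤ (z + e) ^ n := by
  have h : z ^ n + e * (n * z ^ (n - 1)) ≤ (z + e) ^ n := by
    induction n with
    | zero => simp
    | succ n ih =>
      have h1 : z * (e * (n * z ^ (n - 1))) = e * (n * z ^ n) := by
        rcases n with _ | n
        · simp
        · simp only [Nat.add_sub_cancel]; ring
      have h2 := mul_le_mul_of_nonneg_left ih (add_nonneg hz he)
      have h3 : 0 ≤ e * (e * (n * z ^ (n - 1))) := by positivity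
      rw [pow_succ' (z + e)]
      refine le_trans ?_ h2
      simp only [Nat.add_sub_cancel]
      push_cast
      have : (z + e) * (z ^ n + e * (n * z ^ (n - 1))) = z ^ (n + 1) + z * (e * (n * z ^ (n - 1)))
        + e * z ^ n + e * (e * (n * z ^ (n - 1))) := by ring
      rw [this, h1]
      nlinarith
  exact (le_add_of_nonneg_left (by positivity)).trans h

/-- Keep the first three terms of the binomial expansion. The claim reduces to `z² - n z e + n (n -
1) / 2 e² ≥ 0`, whose discriminant `n (2 - n) e²` is nonpositive exactly because `n ≥ 2`. -/
theorem two_mul_pow_le_add_pow {z e : ℝ} (hz : 0 ≤ z) (he : 0 ≤ e) {n : ℕ} (hn : 2 ≤ n) :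
    2 * e * (n * z ^ (n - 1)) ≤ (z + e) ^ n := by
  obtain ⟨m, rfl⟩ := Nat.exists_eq_add_of_le' hn
  have h : z ^ m * (z ^ 2 + (m + 2) * z * e + (m + 2) * (m + 1) / 2 * e ^ 2) ≤
      (z + e) ^ (m + 2) := by
    clear hn
    induction m with
    | zero => apply le_of_eq; push_cast; ring
    | succ m ih =>
      have h2 := mul_le_mul_of_nonneg_left ih (add_nonneg hz he)
      have h3 : (z + e) ^ (m + 1 + 2) = (z + e) * (z + e) ^ (m + 2) := by ring
      rw [h3]
      refine le_trans ?_ h2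
      have h4 : 0 ≤ z ^ m * ((m + 2) * (m + 1) / 2 * e ^ 3) := by positivity
      push_cast
      have : (z + e) * (z ^ m * (z ^ 2 + (m + 2) * z * e + (m + 2) * (m + 1) / 2 * e ^ 2)) =
        z ^ (m + 1) * (z ^ 2 + (m + 1 + 2) * z * e + (m + 1 + 2) * (m + 1 + 1) / 2 * e ^ 2) +
          z ^ m * ((m + 2) * (m + 1) / 2 * e ^ 3) := by ring
      rw [this]
      linarith
  refine le_trans ?_ h
  have h1 : m + 2 - 1 = m + 1 := rfl
  rw [h1]
  have h2 : 0 ≤ z ^ 2 - (m + 2) * z * e + (m + 2) * (m + 1) / 2 * e ^ 2 := by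
    have h3 : (0 : ℝ) ≤ (m + 2) * m / 4 * e ^ 2 := by positivity
    nlinarith [sq_nonneg (z - (m + 2) / 2 * e)]
  have h3 := mul_nonneg (pow_nonneg hz m) h2
  push_cast
  rw [pow_succ]
  nlinarith

end Elementary

/-! ### Even polynomials as families of monomials of degree at least two. -/

section EvenPart

universe u

variable {𝕏 : Type u} [Fintype 𝕏]

/-- The degrees of the monomials in an even polynomial without constant term. -/
abbrev DegreeIndex (n : ℕ) : Type := {p : Fin n × Fin n // 2 ≤ (p.1 : ℕ) + p.2}

theorem sum_degreeIndex {β : Type*} [AddCommMonoid β] (n : ℕ) (F : ℕ → ℕ → β) :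
    ∑ τ : DegreeIndex n, F τ.1.1 τ.1.2 =
      ∑ mb ∈ Finset.range n, ∑ m ∈ Finset.range n, if 2 ≤ mb + m then F mb m else 0 := by
  rw [← Finset.sum_subtype (Finset.univ.filter fun p : Fin n × Fin n => 2 ≤ (p.1 : ℕ) + p.2)
    (by simp) fun p : Fin n × Fin n => F p.1 p.2, Finset.sum_filter, Fintype.sum_prod_type,
    Finset.sum_range]
  simp only [Finset.sum_range]

theorem coeff_eq_zero_of_mem_evenPart {κ : ℝ} {V : Fields 𝕏} (hV : V ∈ evenPart 𝕏 κ) {mb m : ℕ}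
    (h : ¬(2 ≤ mb + m ∧ Even (mb + m))) (X : Fin mb → 𝕏) (Y : Fin m → 𝕏) : coeff κ X Y V = 0 := by
  by_cases he : Even (mb + m)
  · have h0 : mb + m = 0 := by
      rcases he with ⟨r, hr⟩
      by_contra h1
      exact h ⟨by omega, r, hr⟩
    obtain ⟨rfl, rfl⟩ : mb = 0 ∧ m = 0 := by omega
    simp [coeff, hV.1]
  · exact hV.2 mb m he X Y

variable [DecidableEq 𝕏]

theorem parity_of_mem_evenPart {κ : ℝ} (hκ : 0 < κ) {V : Fields 𝕏} (hV : V ∈ evenPart 𝕏 κ) :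
    parity V = V := by
  conv_rhs => rw [eq_fieldPolynomial hκ V]
  conv_lhs => rw [eq_fieldPolynomial hκ V]
  simp only [fieldPolynomial, map_sum, map_smul, prod_ofFn_gen, ← gword_append, parity_gword]
  refine Finset.sum_congr rfl fun mb _ => Finset.sum_congr rfl fun m _ => ?_
  congr 1
  refine Finset.sum_congr rfl fun X _ => Finset.sum_congr rfl fun Y _ => ?_
  by_cases he : Even (mb + m)
  · simp [he.neg_one_pow]
  · rw [hV.2 mb m he, zero_smul, zero_smul]

/-- The weights contain one power of `κ` per variable, and the kernel norm contains one fewer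
because one variable is fixed; this is the extra `κ` in the bound. -/
theorem spread_coeff {κ : ℝ} (hκ : 0 ≤ κ) {mb m : ℕ} (v : (Fin mb → 𝕏) → (Fin m → 𝕏) → ℂ) :
    Spread (fun Z : (Fin mb → 𝕏) × (Fin m → 𝕏) => (κ : ℂ) ^ (mb + m) * v Z.1 Z.2)
      (fun Z => (List.ofFn fun i => (Sum.inl (Z.1 i) : 𝕏 ⊕ 𝕏)) ++
        List.ofFn fun j => (Sum.inr (Z.2 j) : 𝕏 ⊕ 𝕏)) (κ * kernelNorm κ v) := by
  have h0 := kernelNorm_nonneg hκ v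
  have key : ∀ (i : Fin mb ⊕ Fin m) (x : 𝕏), ∑ Z : (Fin mb → 𝕏) × (Fin m → 𝕏),
      (if Sum.elim Z.1 Z.2 i = x then ‖(κ : ℂ) ^ (mb + m) * v Z.1 Z.2‖ else 0) ≤
        κ * kernelNorm κ v := by
    intro i x
    have hn : 1 ≤ mb + m := by
      rcases i with i | i
      · have := i.2; omega
      · have := i.2; omega
    obtain ⟨k, hk⟩ := Nat.exists_eq_add_of_le' hn
    refine le_trans (le_of_eq ?_) (mul_le_mul_of_nonneg_left (slice_le_kernelNorm v i x) hκ)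
    rw [Finset.sum_filter, ← (Equiv.sumArrowEquivProdArrow _ _ _).symm.sum_comp, Finset.mul_sum,
      Finset.mul_sum]
    refine Finset.sum_congr rfl fun Z _ => ?_
    have : (Equiv.sumArrowEquivProdArrow (Fin mb) (Fin m) 𝕏).symm Z = Sum.elim Z.1 Z.2 := rfl
    rw [this, hk]
    split_ifs
    · rw [norm_mul, norm_pow, Complex.norm_real, Real.norm_of_nonneg hκ]
      simp [pow_succ', mul_assoc]
    · simp
  intro i z
  by_cases hi : i < mb
  · have h1 : ∀ Z : (Fin mb → 𝕏) × (Fin m → 𝕏), ((List.ofFn fun i => (Sum.inl (Z.1 i) : 𝕏 ⊕ 𝕏)) ++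
        List.ofFn fun j => (Sum.inr (Z.2 j) : 𝕏 ⊕ 𝕏))[i]? = some (Sum.inl (Z.1 ⟨i, hi⟩)) := by
      intro Z
      rw [List.getElem?_append_left (by simpa using hi)]
      simp [hi]
    simp only [h1]
    rcases z with x | y
    · simpa using key (Sum.inl ⟨i, hi⟩) x
    · simpa using mul_nonneg hκ h0
  · by_cases hi' : i < mb + m
    · have hi2 : i - mb < m := by omega
      have h1 : ∀ Z : (Fin mb → 𝕏) × (Fin m → 𝕏),
          ((List.ofFn fun i => (Sum.inl (Z.1 i) : 𝕏 ⊕ 𝕏)) ++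
          List.ofFn fun j => (Sum.inr (Z.2 j) : 𝕏 ⊕ 𝕏))[i]? =
            some (Sum.inr (Z.2 ⟨i - mb, hi2⟩)) := by
        intro Z
        rw [List.getElem?_append_right (by simpa using hi)]
        simp [hi2]
      simp only [h1]
      rcases z with x | y
      · simpa using mul_nonneg hκ h0
      · simpa using key (Sum.inr ⟨i - mb, hi2⟩) y
    · have h1 : ∀ Z : (Fin mb → 𝕏) × (Fin m → 𝕏),
          ((List.ofFn fun i => (Sum.inl (Z.1 i) : 𝕏 ⊕ 𝕏)) ++
          List.ofFn fun j => (Sum.inr (Z.2 j) : 𝕏 ⊕ 𝕏))[i]? = none := by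
        intro Z
        rw [List.getElem?_eq_none_iff]
        simp
        omega
      simp only [h1]
      simpa using mul_nonneg hκ h0

/-- The representation of an even polynomial by its coefficient functions. -/
def cloudRep {κ : ℝ} (hκ : 0 < κ) {V : Fields 𝕏} (hV : V ∈ evenPart 𝕏 κ) :
    CloudRep κ V (DegreeIndex (Fintype.card 𝕏 + 1)) where
  Ω τ := (Fin τ.1.1 → 𝕏) × (Fin τ.1.2 → 𝕏)
  fintype _ := inferInstance
  weight τ Z := (κ : ℂ) ^ ((τ.1.1 : ℕ) + τ.1.2) * coeff κ Z.1 Z.2 V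
  monomial τ Z := (List.ofFn fun i => (Sum.inl (Z.1 i) : 𝕏 ⊕ 𝕏)) ++
    List.ofFn fun j => (Sum.inr (Z.2 j) : 𝕏 ⊕ 𝕏)
  type τ := List.replicate τ.1.1 true ++ List.replicate τ.1.2 false
  N τ := kernelNorm κ fun (X : Fin τ.1.1 → 𝕏) (Y : Fin τ.1.2 → 𝕏) => coeff κ X Y V
  N_nonneg τ := kernelNorm_nonneg hκ.le _
  map_monomial τ Z := by
    rw [List.map_append, List.map_ofFn, List.map_ofFn]
    simp [Function.comp_def, List.ofFn_const]
  two_le τ := by simpa using τ.2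
  spread τ := spread_coeff hκ.le fun (X : Fin τ.1.1 → 𝕏) (Y : Fin τ.1.2 → 𝕏) => coeff κ X Y V
  eq_sum := by
    conv_lhs => rw [eq_fieldPolynomial hκ V]
    rw [sum_degreeIndex (Fintype.card 𝕏 + 1) fun mb m => ∑ Z : (Fin mb → 𝕏) × (Fin m → 𝕏),
      ((κ : ℂ) ^ (mb + m) * coeff κ Z.1 Z.2 V) •
        gword ((List.ofFn fun i => (Sum.inl (Z.1 i) : 𝕏 ⊕ 𝕏)) ++
          List.ofFn fun j => (Sum.inr (Z.2 j) : 𝕏 ⊕ 𝕏)), fieldPolynomial]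
    refine Finset.sum_congr rfl fun mb _ => Finset.sum_congr rfl fun m _ => ?_
    split_ifs with h
    · rw [Fintype.sum_prod_type, Finset.smul_sum]
      refine Finset.sum_congr rfl fun X _ => ?_
      rw [Finset.smul_sum]
      refine Finset.sum_congr rfl fun Y _ => ?_
      rw [prod_ofFn_gen, prod_ofFn_gen, gword_append, smul_smul]
    · simp [coeff_eq_zero_of_mem_evenPart hV fun h' => h h'.1]

theorem sum_cloudRep_le_hNorm {κ : ℝ} (hκ : 0 < κ) {V : Fields 𝕏} (hV : V ∈ evenPart 𝕏 κ) {x : ℝ}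
    (hx : 0 ≤ x) (F : ℕ → ℝ) (hF : ∀ n, 2 ≤ n → F n ≤ x ^ n) :
    ∑ τ, (cloudRep hκ hV).N τ * F ((cloudRep hκ hV).type τ).length ≤ hNorm κ x V := by
  have h := sum_degreeIndex (Fintype.card 𝕏 + 1) fun mb m =>
    kernelNorm κ (fun (X : Fin mb → 𝕏) (Y : Fin m → 𝕏) => coeff κ X Y V) * F (mb + m)
  simp only [cloudRep, List.length_append, List.length_replicate]
  rw [h, hNorm]
  refine Finset.sum_le_sum fun mb _ => Finset.sum_le_sum fun m _ => ?_
  have h0 := kernelNorm_nonneg hκ.le fun (X : Fin mb → 𝕏) (Y : Fin m → 𝕏) => coeff κ X Y V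
  split_ifs with h1 h2
  · exact mul_le_mul_of_nonneg_left (hF _ h1) h0
  · omega
  · positivity
  · exact le_rfl

end EvenPart

/-! ### The logarithmic derivative of `μ_C * e^{λV}` and its norm. -/

section ConnectedTerms

universe u

variable {𝕏 : Type u} [Fintype 𝕏]

theorem sum_norm_cov_le {κ : ℝ} (hκ : 0 < κ) (C : 𝕏 → 𝕏 → ℂ) (z : 𝕏 ⊕ 𝕏) :
    ∑ z', ‖cov C z z'‖ ≤ covNorm κ C / κ := by
  rw [le_div_iff₀' hκ]
  rcases z with X | X
  · refine le_trans (le_trans (le_of_eq ?_) (le_ciSup (f := fun X => κ * ∑ Y, ‖C Y X‖)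
      (Set.finite_range _).bddAbove X)) (le_max_right _ _)
    simp [Fintype.sum_sum_type, cov]
  · refine le_trans (le_trans (le_of_eq ?_) (le_ciSup (f := fun X => κ * ∑ Y, ‖C X Y‖)
      (Set.finite_range _).bddAbove X)) (le_max_left _ _)
    simp [Fintype.sum_sum_type, cov]

variable [DecidableEq 𝕏]

/-- The coefficients of `λ` in `(μ_C * exp (λ V))⁻¹ d/dλ (μ_C * exp (λ V))`. -/
def connectedTerm (C : 𝕏 → 𝕏 → ℂ) (V : Fields 𝕏) (q : ℕ) : Fields 𝕏 :=
  expectation C V (fun _ _ => 1) 1 q (ExteriorAlgebra.map (replicate 0) V)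

/-- For `S = 1` all replicas have the same fields, so the insertion is `μ_C * (V e^{λV})`, the
derivative of the moment series with respect to `λ`. -/
theorem mk_connectedTerm_mul (C : 𝕏 → 𝕏 → ℂ) (V : Fields 𝕏) :
    PowerSeries.mk (connectedTerm C V) * momentSeries C V =
      PowerSeries.mk fun n => ((n + 1 : ℕ) : ℂ) • PowerSeries.coeff (n + 1) (momentSeries C V) := by
  have h : PowerSeries.mk (connectedTerm C V) =
      insertionSeries C V (fun _ _ => 1) 1 (ExteriorAlgebra.map (replicate 0) V) *
        momentInv C V := by
    ext1 q
    rw [PowerSeries.coeff_mk, connectedTerm, expectation_apply]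
  rw [h, mul_assoc, momentInv_mul_series, mul_one]
  ext1 n
  simp only [insertionSeries, momentSeries, PowerSeries.coeff_mk]
  rw [← covForm_compl₁₂_collapse, ← wick_map (covForm_isAlt C), map_mul, map_collapse_replicate,
    map_collapse_replicate, ← map_smul]
  congr 1
  have h1 : ((n : ℂ) + 1) ≠ 0 := Nat.cast_add_one_ne_zero n
  rw [mul_smul_comm, ← pow_succ', smul_smul, Nat.factorial_succ]
  congr 1
  push_cast
  field_simp

theorem sum_connectedTerm_mul (C : 𝕏 → 𝕏 → ℂ) (V : Fields 𝕏) (n : ℕ) :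
    ∑ p ∈ Finset.HasAntidiagonal.antidiagonal n,
      connectedTerm C V p.1 * PowerSeries.coeff p.2 (momentSeries C V) =
      ((n + 1 : ℕ) : ℂ) • PowerSeries.coeff (n + 1) (momentSeries C V) := by
  have h := congrArg (PowerSeries.coeff n) (mk_connectedTerm_mul C V)
  simpa only [PowerSeries.coeff_mul, PowerSeries.coeff_mk] using h

theorem parity_coeff_momentSeries (C : 𝕏 → 𝕏 → ℂ) {V : Fields 𝕏} (hV : parity V = V) (n : ℕ) :
    parity (PowerSeries.coeff n (momentSeries C V)) = PowerSeries.coeff n (momentSeries C V) := by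
  rw [momentSeries, PowerSeries.coeff_mk, parity_wick (covForm_isAlt C), map_smul, map_pow, hV]

/-- The inserted `V` is a family of words in replica `0`, and the interpolation starts from `k = 0`
and `S = 1`, where every letter contributes `y + c`. -/
theorem norm_connectedTerm_le {κ : ℝ} (hκ : 0 ≤ κ) (C : 𝕏 → 𝕏 → ℂ) {V : Fields 𝕏}
    (hV : parity V = V) {T : Type} [Fintype T] (R : CloudRep κ V T) {M y c δ : ℝ} (hM : 0 ≤ M)
    (hy : 0 ≤ y) (hc : 0 < c) (hδ : 0 ≤ δ) (hcov : ∀ z, ∑ z', ‖cov C z z'‖ ≤ δ)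
    {ℓ : Fields 𝕏 →ₗ[ℂ] ℂ} (hℓ : IsGaussBounded κ C M y ℓ) (q : ℕ) :
    ‖ℓ (connectedTerm C V q)‖ ≤ M * (κ * δ / c * R.deriv (y + c)) ^ q *
      ∑ τ, R.N τ * (y + c) ^ (R.type τ).length := by
  have h : ℓ (connectedTerm C V q) = ∑ τ, ∑ ω, R.weight τ ω * ℓ (expectation C V (fun _ _ => 1)
      (0 + 1) q (replicaWord ((R.monomial τ ω).map fun z => (0, z)))) := by
    rw [connectedTerm]
    nth_rw 2 [R.eq_sum]
    simp only [map_sum, map_smul, map_replicate_gword, smul_eq_mul]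
  rw [h, Finset.mul_sum]
  refine (norm_sum_le _ _).trans (Finset.sum_le_sum fun τ _ => ?_)
  have h1 := norm_sum_expectation_le hκ C hV R hM hy hc hδ hcov hℓ q 0 (fun _ _ => 1)
    (isInterp_one 0) (R.Ω τ) (R.weight τ) (fun ω => (R.monomial τ ω).map fun z => (0, z))
    ((R.type τ).map fun b => (0, b)) (R.N τ)
    (fun ω => by rw [← R.map_monomial τ ω]; simp [Function.comp_def])
    (fun p hp => by obtain ⟨b, -, rfl⟩ := List.mem_map.1 hp; exact le_rfl)
    (fun h => by have := R.two_le τ; rw [List.map_eq_nil_iff.1 h] at this; simp at this)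
    (R.N_nonneg τ) (by simpa [Function.comp_def] using R.spread τ)
  refine h1.trans (le_of_eq ?_)
  simp [mul_assoc, Function.comp_def]

theorem norm_connectedTerm_le_hNorm {κ : ℝ} (hκ : 0 < κ) (C : 𝕏 → 𝕏 → ℂ) {γ ω h : ℝ} (hγ : 0 < γ)
    (hω : 0 < ω) (hCω : covNorm κ C ≤ ω * γ ^ 2) (hh : 0 < h) {h' ω' : ℝ}
    (hcase : (h' = h + 3 * γ ∧ ω' = ω) ∨ (h' = h + 2 * γ ∧ ω' = 2 * ω)) {V : Fields 𝕏}
    (hV : V ∈ evenPart 𝕏 κ) {M : ℝ} (hM : 0 ≤ M) {ℓ : Fields 𝕏 →ₗ[ℂ] ℂ}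
    (hℓ : IsGaussBounded κ C M (h + γ) ℓ) (q : ℕ) :
    ‖ℓ (connectedTerm C V q)‖ ≤ M * (ω' * hNorm κ h' V) ^ q * hNorm κ h' V := by
  have hcov : ∀ z, ∑ z', ‖cov C z z'‖ ≤ ω * γ ^ 2 / κ := fun z =>
    (sum_norm_cov_le hκ C z).trans (div_le_div_of_nonneg_right hCω hκ.le)
  have hpar := parity_of_mem_evenPart hκ hV
  suffices H : ∃ c, 0 < c ∧ κ * (ω * γ ^ 2 / κ) / c * (cloudRep hκ hV).deriv (h + γ + c) ≤
      ω' * hNorm κ h' V ∧ ∑ τ, (cloudRep hκ hV).N τ * (h + γ + c) ^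
        ((cloudRep hκ hV).type τ).length ≤ hNorm κ h' V by
    obtain ⟨c, hc, h1, h2⟩ := H
    refine (norm_connectedTerm_le hκ.le C hpar (cloudRep hκ hV) hM (by positivity) hc
      (by positivity) hcov hℓ q).trans ?_
    have h3 := (cloudRep hκ hV).deriv_nonneg (x := h + γ + c) (by positivity)
    have h4 : 0 ≤ ∑ τ, (cloudRep hκ hV).N τ * (h + γ + c) ^
        ((cloudRep hκ hV).type τ).length := Finset.sum_nonneg fun τ _ =>
      mul_nonneg ((cloudRep hκ hV).N_nonneg τ) (by positivity)
    have h5 : 0 ≤ ω' * hNorm κ h' V := le_trans (by positivity) h1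
    gcongr
  have hderiv : ∀ x e : ℝ, e * (cloudRep hκ hV).deriv x = ∑ τ, (cloudRep hκ hV).N τ *
      (e * (((cloudRep hκ hV).type τ).length * x ^ (((cloudRep hκ hV).type τ).length - 1))) := by
    intro x e
    rw [CloudRep.deriv, Finset.mul_sum]
    exact Finset.sum_congr rfl fun τ _ => by ring
  rcases hcase with ⟨rfl, rfl⟩ | ⟨rfl, rfl⟩
  -- With `c = γ` the radius is `h + 2γ` and the rate is `ω γ` times the derivative there; one more
  -- `γ` in the radius absorbs the derivative.
  · refine ⟨γ, hγ, ?_, ?_⟩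
    · have e : κ * (ω' * γ ^ 2 / κ) / γ = ω' * γ := by field_simp
      rw [e, mul_assoc, hderiv]
      refine mul_le_mul_of_nonneg_left (sum_cloudRep_le_hNorm hκ hV (by positivity)
        (fun n => γ * (n * (h + γ + γ) ^ (n - 1))) fun n _ => ?_) hω.le
      exact (mul_pow_le_add_pow (by positivity) hγ.le n).trans (le_of_eq (by ring))
    · refine sum_cloudRep_le_hNorm hκ hV (by positivity) (fun n => (h + γ + γ) ^ n) fun n _ => ?_
      exact pow_le_pow_left₀ (by positivity) (by linarith) n
  -- With `c = γ / 2` the radius is `h + 3γ / 2` and the rate is `2 ω γ` times the derivative. As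
  -- all degrees are at least two, the factor `γ = 2 (γ / 2)` is absorbed by raising the radius by
  -- `γ / 2` only.
  · refine ⟨γ / 2, by positivity, ?_, ?_⟩
    · have e : κ * (ω * γ ^ 2 / κ) / (γ / 2) = 2 * ω * (2 * (γ / 2)) := by field_simp
      rw [e, mul_assoc (2 * ω), hderiv]
      refine mul_le_mul_of_nonneg_left (sum_cloudRep_le_hNorm hκ hV (by positivity)
        (fun n => 2 * (γ / 2) * (n * (h + γ + γ / 2) ^ (n - 1))) fun n hn => ?_) (by positivity)
      exact (two_mul_pow_le_add_pow (by positivity) (by positivity) hn).trans (le_of_eq (by ring))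
    · refine sum_cloudRep_le_hNorm hκ hV (by positivity) (fun n => (h + γ + γ / 2) ^ n)
        fun n _ => ?_
      exact pow_le_pow_left₀ (by positivity) (by linarith) n

end ConnectedTerms

/-! ### Differentiation in the Grassmann algebra. -/

section Calculus

variable {σ : Type*} [Finite σ]

/-- Multiplication of Grassmann polynomials as a continuous bilinear map. -/
def mulL : Grassmann σ →L[ℂ] Grassmann σ →L[ℂ] Grassmann σ :=
  (LinearMap.mul ℂ (Grassmann σ)).toContinuousBilinearMap

theorem mulL_apply (x y : Grassmann σ) : mulL x y = x * y := rfl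

theorem hasDerivAt_grassmann_mul {x y : ℂ → Grassmann σ} {x' y' : Grassmann σ} {z : ℂ}
    (hx : HasDerivAt x x' z) (hy : HasDerivAt y y' z) :
    HasDerivAt (fun z => x z * y z) (x z * y' + x' * y z) z := by
  have h := mulL.hasDerivAt_of_bilinear (fun _ => hx) fun _ => hy
  simpa only [mulL_apply] using h

theorem hasDerivAt_grassmann_pow {x : ℂ → Grassmann σ} {x' : Grassmann σ} {z : ℂ}
    (hx : HasDerivAt x x' z) (hc : Commute (x z) x') (k : ℕ) :
    HasDerivAt (fun z => x z ^ (k + 1)) (((k + 1 : ℕ) : ℂ) • (x z ^ k * x')) z := by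
  induction k with
  | zero => simpa using hx
  | succ k ih =>
    have h := hasDerivAt_grassmann_mul ih hx
    simp only [← pow_succ] at h
    refine h.congr_deriv ?_
    rw [smul_mul_assoc, mul_assoc, ← hc.eq, ← mul_assoc, ← pow_succ]
    push_cast
    rw [add_smul ((k : ℂ) + 1), one_smul, add_comm]

theorem hasDerivAt_linearMap {E F : Type*} [NormedAddCommGroup E] [NormedSpace ℂ E]
    [FiniteDimensional ℂ E] [NormedAddCommGroup F] [NormedSpace ℂ F] {x : ℂ → E} {x' : E} {z : ℂ}
    (hx : HasDerivAt x x' z) (L : E →ₗ[ℂ] F) : HasDerivAt (fun z => L (x z)) (L x') z :=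
  (LinearMap.toContinuousLinearMap L).hasFDerivAt.comp_hasDerivAt z hx

theorem hasSum_linearMap {ι' : Type*} {E F : Type*} [NormedAddCommGroup E] [NormedSpace ℂ E]
    [FiniteDimensional ℂ E] [NormedAddCommGroup F] [NormedSpace ℂ F] {x : ι' → E} {x' : E}
    (hx : HasSum x x') (L : E →ₗ[ℂ] F) : HasSum (fun i => L (x i)) (L x') :=
  hx.mapL (LinearMap.toContinuousLinearMap L)

/-- Termwise differentiation gives a geometric sum, and `∑ (1 - u) ^ k * u * b = (1 - (1 - u) ^
card) * b`. The last power annihilates `b` because neither `1 - u` nor `b` has a constant term. -/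
theorem hasDerivAt_glog {σ : Type*} [Fintype σ] {u : ℂ → Grassmann σ} {b : Grassmann σ} {z : ℂ}
    (hu : HasDerivAt u (b * u z) z) (hb : ct b = 0) (hu1 : ct (u z) = 1)
    (hpar : parity (u z) = u z) : HasDerivAt (fun z => glog (u z)) b z := by
  have hc : ∀ y, Commute (u z - 1) y := fun y =>
    (commute_of_parity hpar y).sub_left (Commute.one_left y)
  have h : HasDerivAt (fun z => glog (u z)) (∑ k ∈ Finset.range (Fintype.card σ),
      (1 - u z) ^ k * (b * u z)) z := by
    simp only [glog, ← Finset.Ico_succ_right_eq_Icc, Finset.sum_Ico_eq_sum_range]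
    refine HasDerivAt.fun_sum fun k _ => ?_
    have h1 := (hasDerivAt_grassmann_pow (hu.sub_const 1) (hc _) k).const_smul
      ((-1 : ℂ) ^ (1 + k + 1) / ((1 + k : ℕ) : ℂ))
    simp only [add_comm 1 k]
    simp only [add_comm 1 k] at h1
    refine h1.congr_deriv ?_
    have hk : ((k + 1 : ℕ) : ℂ) ≠ 0 := Nat.cast_ne_zero.2 (Nat.succ_ne_zero k)
    rw [smul_smul, div_mul_cancel₀ _ hk, ← neg_sub (u z) 1, neg_pow (u z - 1), mul_assoc,
      Algebra.smul_def]
    simp [pow_succ]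
  refine h.congr_deriv ?_
  have hb' : b * u z = u z * b := ((commute_of_parity hpar b).eq).symm
  rw [← Finset.sum_mul, hb', ← mul_assoc]
  have h2 := geom_sum_mul_neg (1 - u z) (Fintype.card σ)
  rw [sub_sub_cancel] at h2
  have h3 := pow_finrank_mul_eq_zero (x := 1 - u z) (y := b) (by simp [hu1]) hb
  rw [Module.finrank_fintype_fun_eq_card] at h3
  rw [h2, sub_mul, one_mul, h3, sub_zero]

end Calculus

/-! ### The differential equation in `λ` and the series of the logarithm. -/

section LogSeries

variable {σ : Type*} [Fintype σ]

/-- The part of a Grassmann polynomial without field-independent term. -/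
def bodyFree : Grassmann σ →ₗ[ℂ] Grassmann σ :=
  LinearMap.id - Algebra.linearMap ℂ (Grassmann σ) ∘ₗ (ct : Grassmann σ →ₐ[ℂ] ℂ).toLinearMap

theorem bodyFree_apply (x : Grassmann σ) :
    bodyFree x = x - algebraMap ℂ (Grassmann σ) (ct x) := rfl

theorem ct_bodyFree (x : Grassmann σ) : ct (bodyFree x) = 0 := by
  rw [bodyFree_apply, map_sub, ct_algebraMap, sub_self]

theorem glog_one : glog (1 : Grassmann σ) = 0 := by
  rw [glog]
  refine Finset.sum_eq_zero fun k hk => ?_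
  rw [sub_self, zero_pow (by have := (Finset.mem_Icc.1 hk).1; omega), smul_zero]

theorem summable_pow_smul {R : ℕ → Grassmann σ} {K r ρ : ℝ} (hr : 0 ≤ r)
    (hR : ∀ q, ‖R q‖ ≤ K * r ^ q) (hρ0 : 0 ≤ ρ) (hρ : r * ρ < 1) {z : ℂ} (hz : ‖z‖ ≤ ρ) :
    Summable fun q => z ^ q • R q := by
  have := FiniteDimensional.complete ℂ (Grassmann σ)
  have hK : 0 ≤ K := by simpa using (norm_nonneg _).trans (hR 0)
  refine Summable.of_norm_bounded ((summable_geometric_of_lt_one (mul_nonneg hr hρ0) hρ).mul_left K)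
    fun q => ?_
  rw [norm_smul, norm_pow, mul_pow]
  calc ‖z‖ ^ q * ‖R q‖ ≤ ρ ^ q * (K * r ^ q) :=
        mul_le_mul (pow_le_pow_left₀ (norm_nonneg _) hz q) (hR q) (norm_nonneg _) (by positivity)
    _ = _ := by ring

theorem hasDerivAt_tsum_pow {R : ℕ → Grassmann σ} {K r ρ : ℝ} (hr : 0 ≤ r)
    (hR : ∀ q, ‖R q‖ ≤ K * r ^ q) (hρ0 : 0 < ρ) (hρ : r * ρ < 1) {z : ℂ} (hz : ‖z‖ < ρ) :
    HasDerivAt (fun z : ℂ => ∑' q, (z ^ (q + 1) / ((q + 1 : ℕ) : ℂ)) • R q)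
      (∑' q, z ^ q • R q) z := by
  have := FiniteDimensional.complete ℂ (Grassmann σ)
  have hK : 0 ≤ K := by simpa using (norm_nonneg _).trans (hR 0)
  refine hasDerivAt_tsum_of_isPreconnected (g := fun q (z : ℂ) => (z ^ (q + 1) / ((q + 1 : ℕ) : ℂ)) • R q)
    (g' := fun q z => z ^ q • R q) (t := Metric.ball 0 ρ) (y₀ := 0)
    (u := fun q => K * (r * ρ) ^ q)
    ((summable_geometric_of_lt_one (by positivity) hρ).mul_left K) Metric.isOpen_ball
    (convex_ball (0 : ℂ) ρ).isPreconnected (fun q y _ => ?_) (fun q y hy => ?_)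
    (Metric.mem_ball_self hρ0) ?_ (by simpa using hz)
  · have hq : ((q + 1 : ℕ) : ℂ) ≠ 0 := Nat.cast_ne_zero.2 (Nat.succ_ne_zero q)
    refine (((hasDerivAt_pow (q + 1) y).div_const _).smul_const (R q)).congr_deriv ?_
    rw [mul_div_cancel_left₀ _ hq, Nat.add_sub_cancel]
  · rw [norm_smul, norm_pow, mul_pow]
    have hy' : ‖y‖ ≤ ρ := by simpa using (Metric.mem_ball.1 hy).le
    calc ‖y‖ ^ q * ‖R q‖ ≤ ρ ^ q * (K * r ^ q) :=
        mul_le_mul (pow_le_pow_left₀ (norm_nonneg _) hy' q) (hR q) (norm_nonneg _) (by positivity)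
      _ = _ := by ring
  · simp

/-- The recursion `hU` is the equation `U' = b U` for formal power series. It becomes an identity of
functions since `U` is a polynomial and the series of `b` converges. -/
theorem hasDerivAt_sum_pow {R U : ℕ → Grassmann σ} {N : ℕ} (hN : ∀ n, N < n → U n = 0)
    (hU : ∀ n, ∑ p ∈ Finset.HasAntidiagonal.antidiagonal n, R p.1 * U p.2 =
      ((n + 1 : ℕ) : ℂ) • U (n + 1)) {z : ℂ} {b : Grassmann σ}
    (hb : HasSum (fun q => z ^ q • R q) b) :
    HasDerivAt (fun z : ℂ => ∑ n ∈ Finset.range (N + 1), z ^ n • U n)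
      (b * ∑ n ∈ Finset.range (N + 1), z ^ n • U n) z := by
  have h1 : HasSum (fun n => ∑ j ∈ Finset.range (N + 1),
      if j ≤ n then z ^ n • (R (n - j) * U j) else 0)
      (b * ∑ n ∈ Finset.range (N + 1), z ^ n • U n) := by
    rw [Finset.mul_sum]
    refine hasSum_sum fun j _ => ?_
    have h := hasSum_linearMap hb (LinearMap.mulRight ℂ (z ^ j • U j))
    have hinj : Function.Injective fun n : ℕ => n + j := add_left_injective j
    have e : (fun n => if j ≤ n then z ^ n • (R (n - j) * U j) else 0) ∘ (fun n => n + j) =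
        fun n => LinearMap.mulRight ℂ (z ^ j • U j) (z ^ n • R n) := by
      ext1 n
      simp only [Function.comp_apply, Nat.le_add_left, if_true, Nat.add_sub_cancel,
        LinearMap.mulRight_apply, smul_mul_assoc, mul_smul_comm, smul_smul, pow_add,
        mul_comm (z ^ n)]
    rw [← hinj.hasSum_iff, e]
    · exact h
    · intro n hn
      rw [if_neg]
      exact fun hj => hn ⟨n - j, by simp [hj]⟩
  have h2 : ∀ n, (∑ j ∈ Finset.range (N + 1), if j ≤ n then z ^ n • (R (n - j) * U j) else 0) =
      z ^ n • ((n + 1 : ℕ) : ℂ) • U (n + 1) := by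
    intro n
    rw [← hU, ← Finset.Nat.sum_antidiagonal_swap]
    simp only [Prod.fst_swap, Prod.snd_swap]
    rw [Finset.Nat.sum_antidiagonal_eq_sum_range_succ (fun j i => R i * U j), Finset.smul_sum,
      ← Finset.sum_filter]
    refine Finset.sum_subset (fun j hj => ?_) fun j hj hj' => ?_
    · have := (Finset.mem_filter.1 hj).2
      exact Finset.mem_range.2 (by omega)
    · rw [hN j, mul_zero, smul_zero]
      simp only [Finset.mem_filter, Finset.mem_range, not_and, Nat.succ_eq_add_one] at hj hj'
      omega
  simp only [h2] at h1
  have h3 : HasSum (fun n : ℕ => z ^ n • ((n + 1 : ℕ) : ℂ) • U (n + 1))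
      (∑ n ∈ Finset.range N, z ^ n • ((n + 1 : ℕ) : ℂ) • U (n + 1)) := by
    refine hasSum_sum_of_ne_finset_zero fun n hn => ?_
    rw [hN (n + 1) (by simpa using hn), smul_zero, smul_zero]
  rw [h1.unique h3]
  have h4 := HasDerivAt.fun_sum fun (n : ℕ) (_ : n ∈ Finset.range (N + 1)) =>
    (hasDerivAt_pow n z).smul_const (U n)
  refine h4.congr_deriv ?_
  rw [Finset.sum_range_succ']
  simp [smul_smul, mul_comm]

/-- Let `w` be the primitive of `B = ∑ z ^ q R q` with `w 0 = 0`. The constant term of `U` solves a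
scalar linear equation with coefficient `ct B`, so it equals `exp (ct w)`. After normalization, the
logarithm and the part of `w` without constant term have the same derivative on the disc and both
vanish at `0`. -/
theorem ct_ne_zero_and_hasSum_glog {R U : ℕ → Grassmann σ} {N : ℕ} (hN : ∀ n, N < n → U n = 0)
    (hU0 : U 0 = 1) (hU : ∀ n, ∑ p ∈ Finset.HasAntidiagonal.antidiagonal n, R p.1 * U p.2 =
      ((n + 1 : ℕ) : ℂ) • U (n + 1)) (hpar : ∀ n, parity (U n) = U n) {K r ρ : ℝ} (hr : 0 ≤ r)
    (hR : ∀ q, ‖R q‖ ≤ K * r ^ q) (hρ0 : 0 < ρ) (hρ : r * ρ < 1) {z : ℂ} (hz : ‖z‖ < ρ) :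
    ct (∑ n ∈ Finset.range (N + 1), z ^ n • U n) ≠ 0 ∧
      HasSum (fun q => (z ^ (q + 1) / ((q + 1 : ℕ) : ℂ)) • bodyFree (R q))
        (glog ((ct (∑ n ∈ Finset.range (N + 1), z ^ n • U n))⁻¹ •
          ∑ n ∈ Finset.range (N + 1), z ^ n • U n)) := by
  have := FiniteDimensional.complete ℂ (Grassmann σ)
  let B : ℂ → Grassmann σ := fun z => ∑' q, z ^ q • R q
  let w : ℂ → Grassmann σ := fun z => ∑' q, (z ^ (q + 1) / ((q + 1 : ℕ) : ℂ)) • R q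
  let Uf : ℂ → Grassmann σ := fun z => ∑ n ∈ Finset.range (N + 1), z ^ n • U n
  have hw : ∀ z, ‖z‖ < ρ → HasDerivAt w (B z) z := fun z hz => hasDerivAt_tsum_pow hr hR hρ0 hρ hz
  have hUf : ∀ z, ‖z‖ < ρ → HasDerivAt Uf (B z * Uf z) z := fun z hz =>
    hasDerivAt_sum_pow hN hU (summable_pow_smul hr hR hρ0.le hρ hz.le).hasSum
  have hU00 : Uf 0 = 1 := by
    simp [Uf, Finset.sum_range_succ', hU0]
  have hw0 : w 0 = 0 := by simp [w]
  have hball : ∀ {z : ℂ}, z ∈ Metric.ball (0 : ℂ) ρ ↔ ‖z‖ < ρ := by simp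
  have hconn := (convex_ball (0 : ℂ) ρ).isPreconnected
  have hZ : ∀ z, ‖z‖ < ρ → ct (Uf z) = Complex.exp (ct (w z)) := by
    intro z hz
    have hd : ∀ z, ‖z‖ < ρ →
        HasDerivAt (fun z => Complex.exp (-ct (w z)) * ct (Uf z)) 0 z := by
      intro z hz
      have h1 := (hasDerivAt_linearMap (hw z hz) (ct : Grassmann σ →ₐ[ℂ] ℂ).toLinearMap).neg.cexp
      have h2 := hasDerivAt_linearMap (hUf z hz) (ct : Grassmann σ →ₐ[ℂ] ℂ).toLinearMap
      refine (h1.mul h2).congr_deriv ?_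
      simp only [AlgHom.toLinearMap_apply, map_mul, Pi.neg_apply]
      ring
    have h := Metric.isOpen_ball.is_const_of_deriv_eq_zero hconn
      (fun y hy => (hd y (hball.1 hy)).differentiableAt.differentiableWithinAt)
      (fun y hy => (hd y (hball.1 hy)).deriv) (hball.2 hz) (Metric.mem_ball_self hρ0)
    simp only [hU00, hw0, map_zero, neg_zero, Complex.exp_zero, map_one, mul_one] at h
    rw [Complex.exp_neg, inv_mul_eq_one₀ (Complex.exp_ne_zero _)] at h
    exact h.symm
  have hZ0 : ∀ z, ‖z‖ < ρ → ct (Uf z) ≠ 0 := fun z hz => by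
    rw [hZ z hz]; exact Complex.exp_ne_zero _
  refine ⟨hZ0 z hz, ?_⟩
  have hglog : ∀ z, ‖z‖ < ρ →
      HasDerivAt (fun z => glog ((ct (Uf z))⁻¹ • Uf z)) (bodyFree (B z)) z := by
    intro z hz
    have h1 := (hasDerivAt_linearMap (hUf z hz) (ct : Grassmann σ →ₐ[ℂ] ℂ).toLinearMap).inv (hZ0 z hz)
    refine hasDerivAt_glog (u := fun z => (ct (Uf z))⁻¹ • Uf z)
      ((h1.smul (hUf z hz)).congr_deriv ?_) (ct_bodyFree _) ?_ ?_
    · simp only [AlgHom.toLinearMap_apply, map_mul, Pi.inv_apply, bodyFree_apply]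
      rw [sub_mul, mul_smul_comm, ← Algebra.smul_def, smul_smul, sub_eq_add_neg, ← neg_smul]
      congr 2
      have := hZ0 z hz
      field_simp
    · simp [hZ0 z hz]
    · simp only [Uf, map_smul, map_sum, hpar]
  have heq := Metric.isOpen_ball.eqOn_of_deriv_eq hconn
    (fun y hy => (hglog y (hball.1 hy)).differentiableAt.differentiableWithinAt)
    (fun y hy => (hasDerivAt_linearMap (hw y (hball.1 hy)) bodyFree).differentiableAt.differentiableWithinAt)
    (fun y hy => by
      rw [(hglog y (hball.1 hy)).deriv, (hasDerivAt_linearMap (hw y (hball.1 hy)) bodyFree).deriv])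
    (Metric.mem_ball_self hρ0) (by simp [hU00, hw0, glog_one]) (hball.2 hz)
  simp only at heq
  have hs : HasSum (fun q => (z ^ (q + 1) / ((q + 1 : ℕ) : ℂ)) • R q) (w z) := by
    refine Summable.hasSum ?_
    have h1 := (summable_pow_smul hr hR hρ0.le hρ hz.le).norm.mul_left ‖z‖
    refine Summable.of_norm_bounded h1 fun q => ?_
    rw [norm_smul, norm_smul, ← mul_assoc, norm_div, norm_pow, norm_pow, ← pow_succ']
    refine mul_le_mul_of_nonneg_right (div_le_self (by positivity) ?_) (norm_nonneg _)
    rw [Complex.norm_natCast]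
    exact_mod_cast Nat.succ_le_succ (Nat.zero_le q)
  have h2 := hasSum_linearMap hs bodyFree
  simp only [map_smul] at h2
  rw [← heq] at h2
  exact h2

end LogSeries

/-! ### Analyticity of the Grassmann operations. -/

section Analyticity

variable {σ : Type*} [Fintype σ] {E : Type*} [NormedAddCommGroup E] [NormedSpace ℂ E]

theorem analyticAt_grassmann_mul {x y : E → Grassmann σ} {e : E} (hx : AnalyticAt ℂ x e)
    (hy : AnalyticAt ℂ y e) : AnalyticAt ℂ (fun e => x e * y e) e :=
  (mulL.analyticAt_bilinear (x e, y e)).comp₂ hx hy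

theorem analyticAt_grassmann_pow {x : E → Grassmann σ} {e : E} (hx : AnalyticAt ℂ x e) (k : ℕ) :
    AnalyticAt ℂ (fun e => x e ^ k) e := by
  induction k with
  | zero => simpa using analyticAt_const
  | succ k ih => simpa only [pow_succ] using analyticAt_grassmann_mul ih hx

theorem analyticAt_linearMap {F G : Type*} [NormedAddCommGroup F] [NormedSpace ℂ F]
    [FiniteDimensional ℂ F] [NormedAddCommGroup G] [NormedSpace ℂ G] {x : E → F} {e : E}
    (hx : AnalyticAt ℂ x e) (L : F →ₗ[ℂ] G) : AnalyticAt ℂ (fun e => L (x e)) e :=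
  ((LinearMap.toContinuousLinearMap L).analyticAt (x e)).comp hx

theorem analyticAt_gexp {x : E → Grassmann σ} {e : E} (hx : AnalyticAt ℂ x e) :
    AnalyticAt ℂ (fun e => gexp (x e)) e := by
  simp only [gexp]
  exact Finset.analyticAt_fun_sum _ fun k _ => analyticAt_const.fun_smul (analyticAt_grassmann_pow hx k)

theorem analyticAt_glog {x : E → Grassmann σ} {e : E} (hx : AnalyticAt ℂ x e) :
    AnalyticAt ℂ (fun e => glog (x e)) e := by
  simp only [glog]
  exact Finset.analyticAt_fun_sum _ fun k _ => analyticAt_const.fun_smul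
    (analyticAt_grassmann_pow (hx.fun_sub analyticAt_const) k)

end Analyticity

theorem iteratedDeriv_eq_of_hasSum {F : Type*} [NormedAddCommGroup F] [NormedSpace ℂ F]
    [CompleteSpace F] {f : ℂ → F} {c : ℕ → F} {ρ : ℝ} (hρ : 0 < ρ)
    (h : ∀ z : ℂ, ‖z‖ < ρ → HasSum (fun n => z ^ n • c n) (f z)) (n : ℕ) :
    iteratedDeriv n f 0 = (n ! : ℂ) • c n := by
  let p : FormalMultilinearSeries ℂ ℂ F := fun n =>
    ContinuousMultilinearMap.mkPiRing ℂ (Fin n) (c n)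
  have hp : HasFPowerSeriesAt f p 0 := by
    rw [hasFPowerSeriesAt_iff]
    filter_upwards [Metric.ball_mem_nhds (0 : ℂ) hρ] with z hz
    simpa [p, FormalMultilinearSeries.coeff] using h z (by simpa using hz)
  obtain ⟨r, hr⟩ := hp
  have h1 := hr.factorial_smul 1 n
  rw [iteratedDeriv_eq_iteratedFDeriv, ← h1, ← Nat.cast_smul_eq_nsmul ℂ]
  simp [p]

/-! ### Convergence of the series of the effective action. -/

section EffectiveAction

universe u

variable {𝕏 : Type u} [Fintype 𝕏] [DecidableEq 𝕏]

theorem kernelNorm_mul_le_hNorm {κ h : ℝ} (hκ : 0 ≤ κ) (hh : 0 ≤ h) {mb m : ℕ}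
    (hmb : mb ≤ Fintype.card 𝕏) (hm : m ≤ Fintype.card 𝕏) (h1 : 1 ≤ mb + m) (W : Fields 𝕏) :
    kernelNorm κ (fun (X : Fin mb → 𝕏) (Y : Fin m → 𝕏) => coeff κ X Y W) * h ^ (mb + m) ≤
      hNorm κ h W := by
  have h0 : ∀ mb m : ℕ, 0 ≤ if 1 ≤ mb + m then
      kernelNorm κ (fun (X : Fin mb → 𝕏) (Y : Fin m → 𝕏) => coeff κ X Y W) * h ^ (mb + m)
      else 0 := fun mb m => by
    split_ifs
    · exact mul_nonneg (kernelNorm_nonneg hκ _) (by positivity)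
    · exact le_rfl
  have h2 := Finset.single_le_sum (f := fun m => if 1 ≤ mb + m then
      kernelNorm κ (fun (X : Fin mb → 𝕏) (Y : Fin m → 𝕏) => coeff κ X Y W) * h ^ (mb + m)
      else 0) (fun m _ => h0 mb m) (Finset.mem_range.2 (Nat.lt_succ_of_le hm))
  have h3 := Finset.single_le_sum (f := fun mb => ∑ m ∈ Finset.range (Fintype.card 𝕏 + 1),
    if 1 ≤ mb + m then
      kernelNorm κ (fun (X : Fin mb → 𝕏) (Y : Fin m → 𝕏) => coeff κ X Y W) * h ^ (mb + m)
      else 0) (fun mb _ => Finset.sum_nonneg fun m _ => h0 mb m)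
      (Finset.mem_range.2 (Nat.lt_succ_of_le hmb))
  refine le_trans ?_ (h2.trans h3)
  rw [if_pos h1]

theorem exists_norm_coeff_le {κ h : ℝ} (hκ : 0 < κ) (hh : 0 < h) {mb m : ℕ}
    (hmb : mb ≤ Fintype.card 𝕏) (hm : m ≤ Fintype.card 𝕏) :
    ∃ c, 0 ≤ c ∧ ∀ (W : Fields 𝕏) (X : Fin mb → 𝕏) (Y : Fin m → 𝕏),
      ‖coeff κ X Y W‖ ≤ c * (‖ct W‖ + hNorm κ h W) := by
  by_cases h1 : 1 ≤ mb + m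
  · refine ⟨(κ ^ (mb + m - 1) * h ^ (mb + m))⁻¹, by positivity, fun W X Y => ?_⟩
    rw [inv_mul_eq_div, le_div_iff₀' (by positivity)]
    refine le_trans ?_ ((kernelNorm_mul_le_hNorm hκ.le hh.le hmb hm h1 W).trans
      (le_add_of_nonneg_left (norm_nonneg _)))
    rw [mul_right_comm]
    refine mul_le_mul_of_nonneg_right ?_ (by positivity)
    have key : ∀ i : Fin mb ⊕ Fin m, κ ^ (mb + m - 1) * ‖coeff κ X Y W‖ ≤
        kernelNorm κ (fun (X : Fin mb → 𝕏) (Y : Fin m → 𝕏) => coeff κ X Y W) := by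
      intro i
      refine le_trans (mul_le_mul_of_nonneg_left ?_ (by positivity))
        (slice_le_kernelNorm _ i (Sum.elim X Y i))
      exact Finset.single_le_sum (f := fun Z : Fin mb ⊕ Fin m → 𝕏 =>
        ‖coeff κ (Z ∘ Sum.inl) (Z ∘ Sum.inr) W‖) (fun _ _ => norm_nonneg _)
        (a := Sum.elim X Y) (by simp)
    rcases Nat.eq_zero_or_pos mb with h2 | h2
    · exact key (Sum.inr ⟨0, by omega⟩)
    · exact key (Sum.inl ⟨0, h2⟩)
  · obtain ⟨rfl, rfl⟩ : mb = 0 ∧ m = 0 := by omega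
    refine ⟨1, zero_le_one, fun W X Y => ?_⟩
    have : coeff κ X Y W = ct W := by simp [coeff, body]
    rw [this, one_mul]
    exact le_add_of_nonneg_right (hNorm_nonneg hκ.le hh.le W)

/-- Together with the constant term, the `h`-norm controls the auxiliary norm of the algebra. The
constant is irrelevant: it is needed for convergence only. -/
theorem exists_norm_le {κ h : ℝ} (hκ : 0 < κ) (hh : 0 < h) :
    ∃ K, 0 ≤ K ∧ ∀ W : Fields 𝕏, ‖W‖ ≤ K * (‖ct W‖ + hNorm κ h W) := by
  have hc : ∀ mb m : ℕ, ∃ c, 0 ≤ c ∧ (mb ≤ Fintype.card 𝕏 → m ≤ Fintype.card 𝕏 →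
      ∀ (W : Fields 𝕏) (X : Fin mb → 𝕏) (Y : Fin m → 𝕏),
        ‖coeff κ X Y W‖ ≤ c * (‖ct W‖ + hNorm κ h W)) := by
    intro mb m
    by_cases hb : mb ≤ Fintype.card 𝕏 ∧ m ≤ Fintype.card 𝕏
    · obtain ⟨c, h1, h2⟩ := exists_norm_coeff_le hκ hh hb.1 hb.2
      exact ⟨c, h1, fun _ _ => h2⟩
    · exact ⟨0, le_rfl, fun h1 h2 => absurd ⟨h1, h2⟩ hb⟩
  choose c hc0 hc using hc
  refine ⟨∑ mb ∈ Finset.range (Fintype.card 𝕏 + 1), ∑ m ∈ Finset.range (Fintype.card 𝕏 + 1),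
    κ ^ (mb + m) * ∑ X : Fin mb → 𝕏, ∑ Y : Fin m → 𝕏, c mb m *
      ‖((List.ofFn fun i => gen (Sum.inl (X i) : 𝕏 ⊕ 𝕏)).prod *
        (List.ofFn fun j => gen (Sum.inr (Y j) : 𝕏 ⊕ 𝕏)).prod)‖,
    Finset.sum_nonneg fun mb _ => Finset.sum_nonneg fun m _ => mul_nonneg (by positivity)
      (Finset.sum_nonneg fun X _ => Finset.sum_nonneg fun Y _ =>
        mul_nonneg (hc0 mb m) (norm_nonneg _)), fun W => ?_⟩
  conv_lhs => rw [eq_fieldPolynomial hκ W, fieldPolynomial]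
  simp only [Finset.sum_mul, mul_assoc]
  refine (norm_sum_le _ _).trans (Finset.sum_le_sum fun mb hmb => (norm_sum_le _ _).trans
    (Finset.sum_le_sum fun m hm => ?_))
  rw [norm_smul, norm_pow, Complex.norm_real, Real.norm_of_nonneg hκ.le]
  refine mul_le_mul_of_nonneg_left ?_ (by positivity)
  refine (norm_sum_le _ _).trans (Finset.sum_le_sum fun X _ => (norm_sum_le _ _).trans
    (Finset.sum_le_sum fun Y _ => ?_))
  rw [norm_smul, mul_left_comm, mul_comm]
  exact (mul_le_mul_of_nonneg_left (hc mb m (Nat.le_of_lt_succ (Finset.mem_range.1 hmb))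
    (Nat.le_of_lt_succ (Finset.mem_range.1 hm)) W X Y) (norm_nonneg _)).trans
      (le_of_eq (by ring))

theorem convolution_gexp_smul {κ : ℝ} (hκ : 0 < κ) (C : 𝕏 → 𝕏 → ℂ) (V : Fields 𝕏) (z : ℂ) :
    convolution κ C (gexp (z • V)) = ∑ n ∈ Finset.range (Fintype.card (𝕏 ⊕ 𝕏) + 1),
      z ^ n • PowerSeries.coeff n (momentSeries C V) := by
  rw [convolution_eq_wick hκ, gexp, map_sum]
  refine Finset.sum_congr rfl fun n _ => ?_
  rw [momentSeries, PowerSeries.coeff_mk, smul_pow, smul_comm, map_smul]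

theorem coeff_momentSeries_eq_zero (C : 𝕏 → 𝕏 → ℂ) {V : Fields 𝕏} (hV : ct V = 0) {n : ℕ}
    (hn : Fintype.card (𝕏 ⊕ 𝕏) < n) : PowerSeries.coeff n (momentSeries C V) = 0 := by
  rw [momentSeries, PowerSeries.coeff_mk, pow_eq_zero_of_finrank_lt hV
    (by rwa [Module.finrank_fintype_fun_eq_card]), smul_zero, map_zero]

variable {κ : ℝ} {H : Type*} [NormedAddCommGroup H] [InnerProductSpace ℂ H]
  {C : 𝕏 → 𝕏 → ℂ} {f g : 𝕏 → H} {γ ω h h' ω' : ℝ}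

theorem norm_ct_connectedTerm_le (hκ : 0 < κ) (hC : ∀ X Y, C X Y = inner ℂ (f X) (g Y))
    (hγ : 0 < γ) (hf : ∀ X, ‖f X‖ ≤ γ) (hg : ∀ X, ‖g X‖ ≤ γ) (hω : 0 < ω)
    (hCω : covNorm κ C ≤ ω * γ ^ 2) (hh : 0 < h)
    (hcase : (h' = h + 3 * γ ∧ ω' = ω) ∨ (h' = h + 2 * γ ∧ ω' = 2 * ω)) {V : Fields 𝕏}
    (hV : V ∈ evenPart 𝕏 κ) (q : ℕ) : ‖ct (connectedTerm C V q)‖ ≤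
      κ * Fintype.card (𝕏 ⊕ 𝕏) * (ω' * hNorm κ h' V) ^ q * hNorm κ h' V :=
  norm_connectedTerm_le_hNorm hκ C hγ hω hCω hh hcase hV (by positivity)
    (isGaussBounded_ct hκ.le hγ.le (by linarith) fun _ _ hS l =>
      norm_ct_wick_replicaWord_le C f g hC hγ.le hf hg hS l) q

theorem norm_apply_connectedTerm_le (hκ : 0 < κ) (hC : ∀ X Y, C X Y = inner ℂ (f X) (g Y))
    (hγ : 0 < γ) (hf : ∀ X, ‖f X‖ ≤ γ) (hg : ∀ X, ‖g X‖ ≤ γ) (hω : 0 < ω)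
    (hCω : covNorm κ C ≤ ω * γ ^ 2) (hh : 0 < h)
    (hcase : (h' = h + 3 * γ ∧ ω' = ω) ∨ (h' = h + 2 * γ ∧ ω' = 2 * ω)) {V : Fields 𝕏}
    (hV : V ∈ evenPart 𝕏 κ) {ℓ : Fields 𝕏 →ₗ[ℂ] ℂ} (hℓ : IsNormBounded κ h ℓ) (q : ℕ) :
    ‖ℓ (connectedTerm C V q)‖ ≤ (ω' * hNorm κ h' V) ^ q * hNorm κ h' V := by
  simpa only [one_mul] using norm_connectedTerm_le_hNorm hκ C hγ hω hCω hh hcase hV zero_le_one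
    (isGaussBounded_of_isNormBounded hh.le hγ.le (fun _ _ hS l =>
      norm_ct_wick_replicaWord_le C f g hC hγ.le hf hg hS l) hℓ) q

/-- The power series of the effective action in the interaction. -/
theorem exists_hasSum_effectiveAction (hκ : 0 < κ) (hC : ∀ X Y, C X Y = inner ℂ (f X) (g Y))
    (hγ : 0 < γ) (hf : ∀ X, ‖f X‖ ≤ γ) (hg : ∀ X, ‖g X‖ ≤ γ) (hω : 0 < ω)
    (hCω : covNorm κ C ≤ ω * γ ^ 2) (hh : 0 < h)
    (hcase : (h' = h + 3 * γ ∧ ω' = ω) ∨ (h' = h + 2 * γ ∧ ω' = 2 * ω)) {V : Fields 𝕏}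
    (hV : V ∈ evenPart 𝕏 κ) (hsmall : ω' * hNorm κ h' V < 1) :
    ∃ ρ : ℝ, 1 < ρ ∧ ∀ z : ℂ, ‖z‖ < ρ → normalization κ C (z • V) ≠ 0 ∧
      HasSum (fun q => (z ^ (q + 1) / ((q + 1 : ℕ) : ℂ)) • bodyFree (connectedTerm C V q))
        (effectiveAction κ C (z • V)) := by
  have hh' : 0 ≤ h' := by rcases hcase with ⟨rfl, -⟩ | ⟨rfl, -⟩ <;> positivity
  have hω' : 0 ≤ ω' := by rcases hcase with ⟨-, rfl⟩ | ⟨-, rfl⟩ <;> positivity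
  have hv := hNorm_nonneg hκ.le hh' V
  have hr : 0 ≤ ω' * hNorm κ h' V := mul_nonneg hω' hv
  obtain ⟨K, hK, hKW⟩ := exists_norm_le (𝕏 := 𝕏) hκ hh
  have hR : ∀ q, ‖connectedTerm C V q‖ ≤ K * ((κ * Fintype.card (𝕏 ⊕ 𝕏) + 1) * hNorm κ h' V) *
      (ω' * hNorm κ h' V) ^ q := by
    intro q
    obtain ⟨ℓ, h1, h2⟩ := exists_isNormBounded hκ hh.le (connectedTerm C V q)
    have h3 := norm_apply_connectedTerm_le hκ hC hγ hf hg hω hCω hh hcase hV h2 q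
    rw [h1, Complex.norm_real, Real.norm_of_nonneg (hNorm_nonneg hκ.le hh.le _)] at h3
    have h4 := norm_ct_connectedTerm_le hκ hC hγ hf hg hω hCω hh hcase hV q
    refine (hKW _).trans ((mul_le_mul_of_nonneg_left (add_le_add h4 h3) hK).trans (le_of_eq ?_))
    ring
  set r := ω' * hNorm κ h' V with hrdef
  have hr1 : 0 < 1 + r := by linarith
  -- For `0 ≤ r < 1` this radius exceeds `1`, while its product with `r` stays below `1`.
  refine ⟨2 / (1 + r), by rw [lt_div_iff₀ hr1]; linarith, fun z hz => ?_⟩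
  have hct : ct V = 0 := hV.1
  have hpar := parity_of_mem_evenPart hκ hV
  have h1 := ct_ne_zero_and_hasSum_glog (N := Fintype.card (𝕏 ⊕ 𝕏))
    (fun n hn => coeff_momentSeries_eq_zero C hct hn)
    (by rw [PowerSeries.coeff_zero_eq_constantCoeff_apply, constantCoeff_momentSeries,
      Units.val_one]) (sum_connectedTerm_mul C V) (parity_coeff_momentSeries C hpar) hr hR
    (by positivity) (by rw [mul_div_assoc', div_lt_one hr1]; linarith) hz
  rw [← convolution_gexp_smul hκ] at h1
  exact h1

end EffectiveAction

/-! ### Analyticity in `V`, norm bounds and the theorem. -/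

section Main

theorem apply_bodyFree {𝕏 : Type*} [Fintype 𝕏] {ℓ : Fields 𝕏 →ₗ[ℂ] ℂ} (hℓ : ℓ 1 = 0) (x : Fields 𝕏) :
    ℓ (bodyFree x) = ℓ x := by
  rw [bodyFree_apply, map_sub, Algebra.algebraMap_eq_smul_one, map_smul, hℓ, smul_zero, sub_zero]

universe u

variable {𝕏 : Type u} [Fintype 𝕏] [DecidableEq 𝕏] {κ : ℝ} {H : Type*} [NormedAddCommGroup H]
  [InnerProductSpace ℂ H] {C : 𝕏 → 𝕏 → ℂ} {f g : 𝕏 → H} {γ ω h h' ω' : ℝ}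

/-- By nilpotency all operations are polynomial in `V`, except for the division by the
normalization. -/
theorem analyticAt_effectiveAction (hκ : 0 < κ) (C : 𝕏 → 𝕏 → ℂ) (V : evenPart 𝕏 κ)
    (hZ : normalization κ C (V : Fields 𝕏) ≠ 0) :
    AnalyticAt ℂ (fun V : evenPart 𝕏 κ => effectiveAction κ C (V : Fields 𝕏)) V := by
  have e : (fun V : evenPart 𝕏 κ => effectiveAction κ C (V : Fields 𝕏)) = fun V : evenPart 𝕏 κ =>
      glog ((ct (wick (covForm C) (gexp (V : Fields 𝕏))))⁻¹ •
        wick (covForm C) (gexp (V : Fields 𝕏))) := by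
    ext1 V
    simp only [effectiveAction, normalization, convolution_eq_wick hκ, body]
  rw [normalization, convolution_eq_wick hκ] at hZ
  have hx : AnalyticAt ℂ (fun V : evenPart 𝕏 κ => (V : Fields 𝕏)) V :=
    (evenPart 𝕏 κ).subtypeL.analyticAt V
  have hU := analyticAt_linearMap (analyticAt_gexp hx) (wick (covForm C))
  have hct := analyticAt_linearMap hU (ct : Fields 𝕏 →ₐ[ℂ] ℂ).toLinearMap
  rw [e]
  exact analyticAt_glog ((hct.fun_inv hZ).fun_smul hU)

theorem exists_hasSum_effectiveActionTerm (hκ : 0 < κ)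
    (hC : ∀ X Y, C X Y = inner ℂ (f X) (g Y)) (hγ : 0 < γ) (hf : ∀ X, ‖f X‖ ≤ γ)
    (hg : ∀ X, ‖g X‖ ≤ γ) (hω : 0 < ω) (hCω : covNorm κ C ≤ ω * γ ^ 2) (hh : 0 < h)
    (hcase : (h' = h + 3 * γ ∧ ω' = ω) ∨ (h' = h + 2 * γ ∧ ω' = 2 * ω)) {V : Fields 𝕏}
    (hV : V ∈ evenPart 𝕏 κ) (hsmall : ω' * hNorm κ h' V < 1) :
    (∀ q : ℕ, (((q + 1).factorial : ℂ)⁻¹) • effectiveActionTerm κ C (q + 1) V =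
      (((q + 1 : ℕ) : ℂ)⁻¹) • bodyFree (connectedTerm C V q)) ∧
    HasSum (fun q : ℕ => (((q + 1).factorial : ℂ)⁻¹) • effectiveActionTerm κ C (q + 1) V)
      (effectiveAction κ C V) := by
  obtain ⟨ρ, hρ, hz⟩ := exists_hasSum_effectiveAction hκ hC hγ hf hg hω hCω hh hcase hV hsmall
  have := FiniteDimensional.complete ℂ (Fields 𝕏)
  let c : ℕ → Fields 𝕏 := fun
    | 0 => 0
    | q + 1 => (((q + 1 : ℕ) : ℂ)⁻¹) • bodyFree (connectedTerm C V q)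
  have hs : ∀ z : ℂ, ‖z‖ < ρ → HasSum (fun n => z ^ n • c n) (effectiveAction κ C (z • V)) := by
    intro z hzρ
    have h1 := (hasSum_nat_add_iff (f := fun n => z ^ n • c n) 1).1 (by
      have h2 := (hz z hzρ).2
      simpa only [div_eq_mul_inv, mul_smul] using h2)
    simpa [c] using h1
  have hterm : ∀ q : ℕ, (((q + 1).factorial : ℂ)⁻¹) • effectiveActionTerm κ C (q + 1) V =
      (((q + 1 : ℕ) : ℂ)⁻¹) • bodyFree (connectedTerm C V q) := by
    intro q
    rw [effectiveActionTerm, iteratedDeriv_eq_of_hasSum (by linarith) hs, smul_smul,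
      inv_mul_cancel₀ (Nat.cast_ne_zero.2 (Nat.factorial_ne_zero _)), one_smul]
  refine ⟨hterm, ?_⟩
  simp only [hterm]
  have h1 := (hz 1 (by simpa using hρ)).2
  simpa only [one_pow, one_smul, one_div] using h1

/-- The functional realizing the norm of the sum `W` is applied term by term. It does not see
constant terms, and the bound of each term holds for every such functional. -/
theorem hNorm_le_of_hasSum (hκ : 0 < κ) (hC : ∀ X Y, C X Y = inner ℂ (f X) (g Y))
    (hγ : 0 < γ) (hf : ∀ X, ‖f X‖ ≤ γ) (hg : ∀ X, ‖g X‖ ≤ γ) (hω : 0 < ω)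
    (hCω : covNorm κ C ≤ ω * γ ^ 2) (hh : 0 < h)
    (hcase : (h' = h + 3 * γ ∧ ω' = ω) ∨ (h' = h + 2 * γ ∧ ω' = 2 * ω)) {V : Fields 𝕏}
    (hV : V ∈ evenPart 𝕏 κ) {P : ℕ} {W : Fields 𝕏} (hW : HasSum (fun q : ℕ =>
      (((q + P + 1 : ℕ) : ℂ)⁻¹) • bodyFree (connectedTerm C V (q + P))) W) {b : ℝ}
    (hb : HasSum (fun q : ℕ => (((q + P + 1 : ℕ) : ℝ)⁻¹) *
      ((ω' * hNorm κ h' V) ^ (q + P) * hNorm κ h' V)) b) : hNorm κ h W ≤ b := by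
  obtain ⟨ℓ, h1, h2⟩ := exists_isNormBounded hκ hh.le W
  have h3 := (hasSum_linearMap hW ℓ).norm_le_of_bounded hb fun q => by
    rw [map_smul, apply_bodyFree h2.map_one, norm_smul, norm_inv, Complex.norm_natCast]
    exact mul_le_mul_of_nonneg_left
      (norm_apply_connectedTerm_le hκ hC hγ hf hg hω hCω hh hcase hV h2 _) (by positivity)
  rwa [h1, Complex.norm_real, Real.norm_of_nonneg (hNorm_nonneg hκ.le hh.le W)] at h3

end Main

end GrassmannRG

end

open GrassmannRG in
theorem theorem1 {𝕏 : Type*} [Fintype 𝕏] [DecidableEq 𝕏]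
    -- `∫ dX = κ ∑_X`
    {κ : ℝ} (hκ : 0 < κ)
    {H : Type*} [NormedAddCommGroup H] [InnerProductSpace ℂ H] [CompleteSpace H]
    (C : 𝕏 → 𝕏 → ℂ) (f g : 𝕏 → H) {γ ω h : ℝ}
    (hC : ∀ X Y, C X Y = inner ℂ (f X) (g Y))
    (hγ : 0 < γ) (hf : ∀ X, ‖f X‖ ≤ γ) (hg : ∀ X, ‖g X‖ ≤ γ)
    (hω : 0 < ω) (hCω : covNorm κ C ≤ ω * γ ^ 2)
    (hh : 0 < h) :
    -- first with `h' = h + 3 γ`, then with `h + 2 γ` and `2 ω` in place of `ω`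
    ∀ h' ω' : ℝ, (h' = h + 3 * γ ∧ ω' = ω) ∨ (h' = h + 2 * γ ∧ ω' = 2 * ω) →
      -- `W` is analytic in `V`
      AnalyticOnNhd ℂ (fun V : evenPart 𝕏 κ => effectiveAction κ C (V : Fields 𝕏))
        {V : evenPart 𝕏 κ | ω' * hNorm κ h' (V : Fields 𝕏) < 1} ∧
      ∀ V ∈ evenPart 𝕏 κ, ω' * hNorm κ h' V < 1 →
        -- `W` is well defined
        normalization κ C V ≠ 0 ∧
        -- `W` is analytic (a polynomial) in the fields
        effectiveAction κ C V =
          fieldPolynomial κ (fun _ _ X Y => coeff κ X Y (effectiveAction κ C V)) ∧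
        -- the norm bound
        hNorm κ h (effectiveAction κ C V) ≤ -(1 / ω') * Real.log (1 - ω' * hNorm κ h' V) ∧
        -- the expansion in powers of `V`, and its remainder
        HasSum (fun p : ℕ => (((p + 1).factorial : ℂ)⁻¹) • effectiveActionTerm κ C (p + 1) V)
          (effectiveAction κ C V) ∧
        ∀ P : ℕ, 1 ≤ P →
          hNorm κ h (effectiveAction κ C V -
              ∑ p ∈ Finset.Icc 1 P, ((p.factorial : ℂ)⁻¹) • effectiveActionTerm κ C p V)
            ≤ ω' ^ P * hNorm κ h' V ^ (P + 1) / (1 - ω' * hNorm κ h' V) := by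
  intro h' ω' hcase
  have hω' : 0 < ω' := by rcases hcase with ⟨-, rfl⟩ | ⟨-, rfl⟩ <;> positivity
  have hh' : 0 ≤ h' := by rcases hcase with ⟨rfl, -⟩ | ⟨rfl, -⟩ <;> positivity
  have hZ : ∀ V ∈ evenPart 𝕏 κ, ω' * hNorm κ h' V < 1 → normalization κ C V ≠ 0 := by
    intro V hV hs
    obtain ⟨ρ, hρ, hz⟩ := exists_hasSum_effectiveAction hκ hC hγ hf hg hω hCω hh hcase hV hs
    simpa only [one_smul] using (hz 1 (by simpa using hρ)).1
  refine ⟨fun V hV => analyticAt_effectiveAction hκ C V (hZ V V.2 hV), fun V hV hs => ?_⟩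
  obtain ⟨hterm, hsum⟩ :=
    exists_hasSum_effectiveActionTerm hκ hC hγ hf hg hω hCω hh hcase hV hs
  have hv := hNorm_nonneg hκ.le hh' V
  set v := hNorm κ h' V with hv_def
  have hr : 0 ≤ ω' * v := by positivity
  refine ⟨hZ V hV hs, eq_fieldPolynomial hκ _, ?_, hsum, fun P _ => ?_⟩
  · refine hNorm_le_of_hasSum (P := 0) hκ hC hγ hf hg hω hCω hh hcase hV
      (by simpa only [hterm, add_zero] using hsum) ?_
    -- The majorants `(ω' v) ^ q v / (q + 1)` sum to the logarithm, with a factor `1 / ω'` since `v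
    -- = (ω' v) / ω'`.
    have h1 := (Real.hasSum_pow_div_log_of_abs_lt_one (abs_lt.2 ⟨by linarith, hs⟩)).mul_left (1 / ω')
    rw [mul_neg, ← neg_mul] at h1
    have e : (fun q : ℕ => ((q + 0 + 1 : ℕ) : ℝ)⁻¹ *
        ((ω' * hNorm κ h' V) ^ (q + 0) * hNorm κ h' V)) =
        fun i : ℕ => 1 / ω' * ((ω' * v) ^ (i + 1) / ((i : ℝ) + 1)) := by
      ext1 q
      push_cast
      rw [add_zero, add_zero, pow_succ, ← hv_def]
      field_simp
    rw [e]
    exact h1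
  · have h1 := (hasSum_nat_add_iff' P).2 hsum
    have h2 : ∑ p ∈ Finset.Icc 1 P, ((p.factorial : ℂ)⁻¹) • effectiveActionTerm κ C p V =
        ∑ i ∈ Finset.range P, (((i + 1).factorial : ℂ)⁻¹) • effectiveActionTerm κ C (i + 1) V := by
      rw [← Finset.Ico_succ_right_eq_Icc, Finset.sum_Ico_eq_sum_range]
      simp [add_comm 1]
    rw [h2]
    have hgeo : Summable fun q => (ω' * v) ^ (q + P) * v := by
      simp only [pow_add, mul_assoc]
      exact (summable_geometric_of_lt_one hr hs).mul_right _
    -- For the remainder the denominators are dropped, which leaves a geometric series.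
    have hle : ∀ q : ℕ, ((q + P + 1 : ℕ) : ℝ)⁻¹ * ((ω' * v) ^ (q + P) * v) ≤
        (ω' * v) ^ (q + P) * v := fun q =>
      mul_le_of_le_one_left (by positivity)
        (inv_le_one_of_one_le₀ (by exact_mod_cast Nat.succ_le_succ (Nat.zero_le _)))
    have hsm := Summable.of_nonneg_of_le (fun q => by positivity) hle hgeo
    refine (hNorm_le_of_hasSum (P := P) hκ hC hγ hf hg hω hCω hh hcase hV
      (by simpa only [hterm] using h1) hsm.hasSum).trans ((hsm.tsum_le_tsum hle hgeo).trans
        (le_of_eq ?_))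
    simp only [pow_add, mul_assoc]
    rw [tsum_mul_right, tsum_geometric_of_lt_one hr hs, mul_pow, pow_one]
    field_simp
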